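/- **Proposition 2.1.** Let $\Omega\subset\mathbb R^2$ be a bounded simply connected Lipschitz domain, that is, a non-empty bounded simply connected open set such that near every boundary point, in suitable orthonormal coordinates, $\Omega$ is the region strictly above the graph of a Lipschitz function. Let $\epsilon>0$ and $h_{ex}\in\mathbb R$. Write $\operatorname{curl} b=\partial_1b^2-\partial_2b^1$ and $\nabla_b v=\nabla v-i\,b\,v$ (derivatives in the weak sense), and let $$X=\{(v,b)\in H^1(\Omega;\mathbb C)\times H^1_{loc}(\mathbb R^2;\mathbb R^2):\ \operatorname{curl} b-h_{ex}\in L^2(\mathbb R^2)\},\qquad X_\Omega=H^1(\Omega;\mathbb C)\times H^1(\Omega;\mathbb R^2),$$ $$GL_\epsilon(v,b)=\frac12\int_\Omega\Big[|\nabla_b v|^2+\frac1{2\epsilon^2}(1-|v|^2)^2\Big]dx+\frac12\int_{\mathbb R^2}(\operatorname{curl} b-h_{ex})^2dx\qquad\text{for }(v,b)\in X,$$ $$F_\epsilon(v,b)=\frac12\int_\Omega\Big[|\nabla_b v|^2+\frac1{2\epsilon^2}(1-|v|^2)^2\Big]dx+\frac12\int_\Omega(\operatorname{curl} b-h_{ex})^2dx\qquad\text{for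 }(v,b)\in X_\Omega.$$ Then $GL_\epsilon$ attains its minimum on $X$, $F_\epsilon$ attains its minimum on $X_\Omega$, both minima are finite, and $$\min_{(v,b)\in X}GL_\epsilon(v,b)=\min_{(v,b)\in X_\Omega}F_\epsilon(v,b).$$ -/

import Mathlib

open MeasureTheory Set
open scoped ENNReal NNReal ContDiff

noncomputable section

namespace GL2D

/-- The Euclidean plane; the coordinates `x₁`, `x₂` of a point `x` are `x 0`, `x 1`. -/
abbrev Plane : Type := EuclideanSpace ℝ (Fin 2)

/-- The boundary of `Ω` is Lipschitz (with compact boundary in mind): near each boundary point and in suitable orthonormal coordinates, `Ω` is the region lying strictly above the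
graph of a Lipschitz function of one variable. -/
def HasLipschitzBoundary (Ω : Set Plane) : Prop :=
  ∀ p ∈ frontier Ω, ∃ (e : Plane ≃ₗᵢ[ℝ] Plane) (γ : ℝ → ℝ) (K : ℝ≥0) (r : ℝ),
    0 < r ∧ LipschitzWith K γ ∧
      ∀ y ∈ Metric.ball p r, (y ∈ Ω ↔ γ (e y 0) < e y 1)

/-- A bounded simply connected Lipschitz domain in the plane. (`IsSimplyConnected` contains
non-emptiness and path-connectedness.) -/
structure IsBddSimplyConnectedLipschitzDomain (Ω : Set Plane) : Prop where
  isOpen : IsOpen Ω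
  isBounded : Bornology.IsBounded Ω
  isSimplyConnected : IsSimplyConnected Ω
  hasLipschitzBoundary : HasLipschitzBoundary Ω

section Weak

variable {F : Type*} [NormedAddCommGroup F] [NormedSpace ℝ F]

/-- The classical partial derivative `∂ⱼ φ` of a real function on the plane. -/
def partialDeriv (j : Fin 2) (φ : Plane → ℝ) (x : Plane) : ℝ :=
  fderiv ℝ φ x (EuclideanSpace.single j 1)

/-- `g` is a weak (distributional) partial derivative `∂ⱼ f` on the open set `Ω`; only the values of
`f` and `g` in `Ω` matter. -/
structure HasWeakPartial (Ω : Set Plane) (j : Fin 2) (f g : Plane → F) : Prop where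
  locallyIntegrableOn : LocallyIntegrableOn f Ω
  locallyIntegrableOn_deriv : LocallyIntegrableOn g Ω
  integral_eq : ∀ φ : Plane → ℝ, ContDiff ℝ ∞ φ → HasCompactSupport φ → tsupport φ ⊆ Ω →
    ∫ x in Ω, partialDeriv j φ x • f x = - ∫ x in Ω, φ x • g x

open Classical in
/-- The weak partial derivative `∂ⱼ f` on `Ω`: a representative of it if it exists, and `0`
otherwise. -/
def weakPartial (Ω : Set Plane) (j : Fin 2) (f : Plane → F) : Plane → F :=
  if h : ∃ g, HasWeakPartial Ω j f g then h.choose else 0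

theorem hasWeakPartial_weakPartial {Ω : Set Plane} {j : Fin 2} {f g : Plane → F}
    (h : HasWeakPartial Ω j f g) : HasWeakPartial Ω j f (weakPartial Ω j f) := by
  have h' : ∃ g, HasWeakPartial Ω j f g := ⟨g, h⟩
  rw [weakPartial, dif_pos h']
  exact h'.choose_spec

/-- The weak derivative is unique almost everywhere, so `weakPartial` is well defined. -/
theorem HasWeakPartial.weakPartial_ae_eq [CompleteSpace F] {Ω : Set Plane} (hΩ : IsOpen Ω)
    {j : Fin 2} {f g : Plane → F} (h : HasWeakPartial Ω j f g) :
    ∀ᵐ x, x ∈ Ω → weakPartial Ω j f x = g x := by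
  have h' := hasWeakPartial_weakPartial h
  have key : ∀ᵐ x, x ∈ Ω → (weakPartial Ω j f - g) x = 0 := by
    apply hΩ.ae_eq_zero_of_integral_contDiff_smul_eq_zero
      (h'.locallyIntegrableOn_deriv.sub h.locallyIntegrableOn_deriv)
    intro φ hφ hc hs
    have hz : ∀ x, x ∉ Ω → φ x • (weakPartial Ω j f - g) x = 0 := by
      intro x hx
      rw [image_eq_zero_of_notMem_tsupport (fun hx' => hx (hs hx')), zero_smul]
    have hint : ∀ u : Plane → F, LocallyIntegrableOn u Ω →
        IntegrableOn (fun x => φ x • u x) Ω := by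
      intro u hu
      have h1 : IntegrableOn u (tsupport φ) := hu.integrableOn_compact_subset hs hc
      have h2 : IntegrableOn (fun x => φ x • u x) (tsupport φ) :=
        h1.continuousOn_smul hφ.continuous.continuousOn hc
      have h3 : Integrable (fun x => φ x • u x) := by
        rw [← integrableOn_iff_integrable_of_support_subset (s := tsupport φ)]
        · exact h2
        · intro x hx
          by_contra hx'
          exact hx (by simp [image_eq_zero_of_notMem_tsupport hx'])
      exact h3.integrableOn
    rw [← setIntegral_eq_integral_of_forall_compl_eq_zero hz]
    simp only [Pi.sub_apply, smul_sub]
    rw [integral_sub (hint _ h'.locallyIntegrableOn_deriv) (hint _ h.locallyIntegrableOn_deriv)]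
    have e1 := h'.integral_eq φ hφ hc hs
    rw [h.integral_eq φ hφ hc hs, neg_inj] at e1
    rw [e1, sub_self]
  filter_upwards [key] with x hx hxΩ
  exact sub_eq_zero.mp (hx hxΩ)

/-- `f ∈ H¹(Ω; F)`: `f` and its weak first partial derivatives on `Ω` are in `L²(Ω)`. -/
def MemH1 (Ω : Set Plane) (f : Plane → F) : Prop :=
  MemLp f 2 (volume.restrict Ω) ∧
    ∀ j : Fin 2, ∃ g : Plane → F, HasWeakPartial Ω j f g ∧ MemLp g 2 (volume.restrict Ω)

/-- `f ∈ H¹_loc(ℝ²; F)`: `f` and its weak first partial derivatives on the plane are square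
integrable on each compact set. -/
def MemH1Loc (f : Plane → F) : Prop :=
  (∀ C : Set Plane, IsCompact C → MemLp f 2 (volume.restrict C)) ∧
    ∀ j : Fin 2, ∃ g : Plane → F, HasWeakPartial univ j f g ∧
      ∀ C : Set Plane, IsCompact C → MemLp g 2 (volume.restrict C)

end Weak

/-- The two-dimensional weak curl `∂₁ b² - ∂₂ b¹` on `Ω`. -/
def weakCurl (Ω : Set Plane) (b : Plane → Plane) (x : Plane) : ℝ :=
  weakPartial Ω 0 (fun y => b y 1) x - weakPartial Ω 1 (fun y => b y 0) x

/-- The squared modulus `|∇_b v|² = ∑ⱼ |∂ⱼ v - i bʲ v|²` of the covariant gradient on `Ω`. -/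
def covGradSq (Ω : Set Plane) (v : Plane → ℂ) (b : Plane → Plane) (x : Plane) : ℝ :=
  ∑ j : Fin 2, ‖weakPartial Ω j v x - Complex.I * (b x j : ℂ) * v x‖ ^ 2

/-- The part `½ ∫_Ω |∇_b v|² + (1 / 2ε²) (1 - |v|²)²` of the energy. All energies are integrals of
non-negative functions and take values in `[0, ∞]`. -/
def matterEnergy (Ω : Set Plane) (ε : ℝ) (v : Plane → ℂ) (b : Plane → Plane) : ℝ≥0∞ :=
  2⁻¹ * ∫⁻ x in Ω, ENNReal.ofReal
    (covGradSq Ω v b x + 1 / (2 * ε ^ 2) * (1 - ‖v x‖ ^ 2) ^ 2)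

/-- The magnetic energy `½ ∫_U (curl b - h)²`, the curl being taken on `U`. -/
def magneticEnergy (U : Set Plane) (h : ℝ) (b : Plane → Plane) : ℝ≥0∞ :=
  2⁻¹ * ∫⁻ x in U, ENNReal.ofReal ((weakCurl U b x - h) ^ 2)

/-- The full-plane Ginzburg-Landau energy `GL_ε(v, b)`. -/
def energyGL (Ω : Set Plane) (ε h : ℝ) (p : (Plane → ℂ) × (Plane → Plane)) : ℝ≥0∞ :=
  matterEnergy Ω ε p.1 p.2 + magneticEnergy univ h p.2

/-- The energy `F_ε(v, b)`, whose magnetic part is integrated over `Ω` only. -/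
def energyF (Ω : Set Plane) (ε h : ℝ) (p : (Plane → ℂ) × (Plane → Plane)) : ℝ≥0∞ :=
  matterEnergy Ω ε p.1 p.2 + magneticEnergy Ω h p.2

/-- The space `X` of pairs `(v, b) ∈ H¹(Ω; ℂ) × H¹_loc(ℝ²; ℝ²)` with `curl b - h ∈ L²(ℝ²)`.
A vector field is in a Sobolev space iff its components are. -/
def spaceX (Ω : Set Plane) (h : ℝ) : Set ((Plane → ℂ) × (Plane → Plane)) :=
  {p | MemH1 Ω p.1 ∧ (∀ j : Fin 2, MemH1Loc (fun x => p.2 x j)) ∧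
    MemLp (fun x => weakCurl univ p.2 x - h) 2 volume}

/-- The space `X_Ω = H¹(Ω; ℂ) × H¹(Ω; ℝ²)`; only the values of `v` and `b` in `Ω` matter. -/
def spaceXΩ (Ω : Set Plane) : Set ((Plane → ℂ) × (Plane → Plane)) :=
  {p | MemH1 Ω p.1 ∧ ∀ j : Fin 2, MemH1 Ω (fun x => p.2 x j)}

end GL2D

end

noncomputable section

namespace GL2D

/-! One inequality is soft: `X ⊆ X_Ω` after restriction, and `F ≤ GL` on `X`, because `GL` only adds
the magnetic energy outside `Ω`. It therefore suffices to produce one `p ∈ X` with `GL(p) ≤ inf F`;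
this `p` then minimises both energies and the two values coincide.

The field is encoded as `β = b² + i b¹`, for which `(∂₁ + i∂₂) β = curl b + i div b`. The operator
`∂₁ + i∂₂` is inverted by convolution `T` with `1 / (2π z)` (`integral_cauchyKernel_mul_dbar`,
`ae_eq_cauchyTransform`). Given `(v, b) ∈ X_Ω`, let `H` have real part `1_Ω (curl b - hex)` and
imaginary part `1_Ω div b` minus a smooth approximation of it. By Weyl's lemma, `β` differs from
`uniformField hex + T H` by a smooth field without curl (`exists_cauchyTransform_add`). On the
simply connected `Ω` this field is a gradient, so a smooth gauge change `v ↦ exp(iξ) v` replaces `β`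
by `uniformField hex + T H` at equal energy (`exists_gauge`). The new field lives on the whole
plane, and its curl minus `hex` is `Re H`, which vanishes off `Ω`. Hence `F` becomes a functional of
`v`, its covariant derivatives `w` and `H`, the magnetic part being `½ ∫_{ℝ²} (Re H)²`.

The direct method applies to this functional. The energy bounds `v` in `L⁴`, `w` in `L²` and `Re H`
in `L²`, while `‖Im H‖ ≤ 1` by construction. Young's inequality bounds `T H` in `L⁴` on bounded
sets, so `∇v = w + i b v` is bounded in `L²` (`exists_bound`). Along a subsequence `v`, `w`, `∇v`,
`H` converge weakly in `L²`. Since `T` is completely continuous from `L²` to `L⁴`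
(`tendsto_eLpNorm_cauchyTransform_sub`), the fields converge strongly and the relation between `w`
and `∇v` survives. The same compactness applied to `χ v = T((∂₁ + i∂₂)(χ v))`, `χ` a cutoff, yields
local Rellich convergence, hence `v` converges almost everywhere along a further subsequence.
Fatou's lemma handles the potential and weak lower semicontinuity the quadratic terms
(`exists_gauge_limit`).

The limit is a pair in `X`: `T` maps compactly supported `L²` data to functions with gradient in
`L²(ℝ²)` (`exists_hasWeakPartial_cauchyTransform`). Its `GL` energy equals the limiting reduced
energy (`mem_spaceX_and_energyGL_eq`). -/

/-- The identification `x ↦ x₁ + i x₂` of the plane with `ℂ`. -/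
def planeToComplex : Plane ≃ₗᵢ[ℝ] ℂ := Complex.orthonormalBasisOneI.repr.symm

theorem planeToComplex_apply (x : Plane) :
    planeToComplex x = (x 0 : ℂ) + (x 1 : ℂ) * Complex.I := by
  rw [planeToComplex, ← OrthonormalBasis.sum_repr_symm]
  simp [Fin.sum_univ_two]

theorem planeToComplex_single_zero :
    planeToComplex (EuclideanSpace.single (0 : Fin 2) (1 : ℝ)) = 1 := by
  simp [planeToComplex_apply]

theorem planeToComplex_single_one :
    planeToComplex (EuclideanSpace.single (1 : Fin 2) (1 : ℝ)) = Complex.I := by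
  simp [planeToComplex_apply]

/-! ### The operator `∂₁ + i∂₂` and its fundamental solution -/

section pd

variable {F : Type*} [NormedAddCommGroup F] [NormedSpace ℝ F]

/-- The classical partial derivative of a vector-valued function on the plane. -/
def pd (j : Fin 2) (f : Plane → F) (x : Plane) : F :=
  fderiv ℝ f x (EuclideanSpace.single j 1)

end pd

/-- The operator `∂₁ + i ∂₂`. -/
def dbar (f : Plane → ℂ) (x : Plane) : ℂ := pd 0 f x + Complex.I * pd 1 f x

/-- The fundamental solution of `∂₁ + i ∂₂`. -/
def cauchyKernel (x : Plane) : ℂ := (2 * Real.pi * planeToComplex x)⁻¹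

theorem norm_cauchyKernel (x : Plane) : ‖cauchyKernel x‖ = (2 * Real.pi)⁻¹ * ‖x‖⁻¹ := by
  simp [cauchyKernel, mul_comm, abs_of_pos Real.pi_pos]

theorem cauchyKernel_neg (x : Plane) : cauchyKernel (-x) = - cauchyKernel x := by
  simp [cauchyKernel, inv_neg]

theorem measurable_cauchyKernel : Measurable cauchyKernel := by
  unfold cauchyKernel
  exact ((planeToComplex.continuous.measurable).const_mul _).inv

/-- In polar coordinates `∂₁ + i∂₂ = exp(iθ) (∂_r + (i/r) ∂_θ)`, so the Jacobian cancels the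
singularity and the integrand becomes `(2π)⁻¹ (A + i B)` with `A = ∂_r ψ` and `B = r⁻¹ ∂_θ ψ`. On
each ray `A` integrates to `-ψ 0`, and on each circle `B` integrates to zero by periodicity. -/
theorem integral_polar_cauchy {ψ : ℂ → ℂ} (hψ : ContDiff ℝ 1 ψ) (hc : HasCompactSupport ψ) :
    ∫ w : ℂ, (2 * Real.pi * w)⁻¹ * (fderiv ℝ ψ w 1 + Complex.I * fderiv ℝ ψ w Complex.I) = - ψ 0 := by
  rw [← Complex.integral_comp_polarCoord_symm]
  set e : ℝ → ℂ := fun θ => Complex.exp (θ * Complex.I) with he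
  have hecont : Continuous e := by fun_prop
  have hen : ∀ θ, ‖e θ‖ = 1 := fun θ => Complex.norm_exp_ofReal_mul_I θ
  set A : ℝ × ℝ → ℂ := fun p => fderiv ℝ ψ (p.1 * e p.2) (e p.2) with hA
  set B : ℝ × ℝ → ℂ := fun p => fderiv ℝ ψ (p.1 * e p.2) (Complex.I * e p.2) with hB
  have hfc : Continuous (fderiv ℝ ψ) := hψ.continuous_fderiv one_ne_zero
  have hAc : Continuous A := by
    have : Continuous fun p : ℝ × ℝ => fderiv ℝ ψ (p.1 * e p.2) := hfc.comp (by fun_prop)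
    exact this.clm_apply (by fun_prop)
  have hBc : Continuous B := by
    have : Continuous fun p : ℝ × ℝ => fderiv ℝ ψ (p.1 * e p.2) := hfc.comp (by fun_prop)
    exact this.clm_apply (by fun_prop)
  obtain ⟨R, hR0, hR⟩ : ∃ R > 0, ∀ w : ℂ, R < ‖w‖ → fderiv ℝ ψ w = 0 := by
    obtain ⟨R, hR⟩ := (hc.fderiv (𝕜 := ℝ)).isCompact.isBounded.subset_closedBall 0
    refine ⟨max R 1, by positivity, fun w hw => ?_⟩
    apply image_eq_zero_of_notMem_tsupport
    intro h
    have := hR h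
    simp only [Metric.mem_closedBall, dist_zero_right] at this
    exact absurd (this.trans (le_max_left _ _)) (not_le.mpr hw)
  have hint : ∀ G : ℝ × ℝ → ℂ, Continuous G → (∀ p : ℝ × ℝ, R < p.1 → G p = 0) →
      IntegrableOn G (Ioi (0 : ℝ) ×ˢ Ioo (-Real.pi) Real.pi) := by
    intro G hG hz
    have h1 : IntegrableOn G (Icc 0 R ×ˢ Icc (-Real.pi) Real.pi) :=
      hG.continuousOn.integrableOn_compact (isCompact_Icc.prod isCompact_Icc)
    refine (h1.of_forall_sdiff_eq_zero (measurableSet_Ioi.prod measurableSet_Ioo) ?_)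
    rintro ⟨r, θ⟩ ⟨⟨h1, h2⟩, h3⟩
    apply hz
    by_contra h4
    exact h3 ⟨⟨le_of_lt h1, not_lt.mp h4⟩, ⟨h2.1.le, h2.2.le⟩⟩
  have hn : ∀ p : ℝ × ℝ, R < p.1 → fderiv ℝ ψ (p.1 * e p.2) = 0 := by
    intro p hp
    apply hR
    rw [norm_mul, hen, mul_one, Complex.norm_real, Real.norm_eq_abs]
    exact hp.trans_le (le_abs_self _)
  have hAi := hint A hAc (fun p hp => by simp [hA, hn p hp])
  have hBi := hint B hBc (fun p hp => by simp [hB, hn p hp])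
  have key : ∀ p ∈ polarCoord.target, p.1 • ((2 * Real.pi * (Complex.polarCoord.symm p))⁻¹ *
      (fderiv ℝ ψ (Complex.polarCoord.symm p) 1 +
        Complex.I * fderiv ℝ ψ (Complex.polarCoord.symm p) Complex.I)) =
      (2 * Real.pi : ℂ)⁻¹ * (A p + Complex.I * B p) := by
    rintro ⟨r, θ⟩ ⟨hr, -⟩
    have hr' : (r : ℂ) ≠ 0 := by
      have : (0 : ℝ) < r := hr
      exact_mod_cast this.ne'
    have hs : Complex.polarCoord.symm (r, θ) = r * e θ := by
      rw [Complex.polarCoord_symm_apply, he]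
      simp only [Complex.exp_mul_I]
      push_cast; ring
    rw [hs]
    have e1 : e θ = (Real.cos θ) • (1 : ℂ) + (Real.sin θ) • Complex.I := by
      simp [he, Complex.exp_mul_I]
    have e2 : Complex.I * e θ = (-Real.sin θ) • (1 : ℂ) + (Real.cos θ) • Complex.I := by
      simp [he, Complex.exp_mul_I, mul_add, ← mul_assoc]
      ring_nf; simp; ring
    simp only [hA, hB]
    set a := fderiv ℝ ψ (r * e θ) 1
    set b := fderiv ℝ ψ (r * e θ) Complex.I
    have ea : fderiv ℝ ψ (r * e θ) (e θ) = Real.cos θ * a + Real.sin θ * b := by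
      conv_lhs => rw [show (fderiv ℝ ψ (r * e θ)) (e θ) =
        (fderiv ℝ ψ (r * e θ)) ((Real.cos θ) • (1 : ℂ) + (Real.sin θ) • Complex.I) by rw [← e1]]
      rw [map_add, map_smul, map_smul, Complex.real_smul, Complex.real_smul]
    have eb : fderiv ℝ ψ (r * e θ) (Complex.I * e θ) = -Real.sin θ * a + Real.cos θ * b := by
      rw [e2, map_add, map_smul, map_smul, Complex.real_smul, Complex.real_smul]
      push_cast; ring
    rw [ea, eb]
    have einv : (e θ)⁻¹ = Real.cos θ - Real.sin θ * Complex.I := by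
      simp only [he]
      rw [← Complex.exp_neg, show -((θ : ℂ) * Complex.I) = (-θ : ℂ) * Complex.I by ring,
        Complex.exp_mul_I]
      simp; ring
    rw [Complex.real_smul, mul_inv, mul_inv (r : ℂ), einv]
    have hI : Complex.I ^ 2 = -1 := Complex.I_sq
    field_simp
    ring_nf
    rw [hI]; ring
  rw [setIntegral_congr_fun (by exact polarCoord.open_target.measurableSet) key]
  rw [integral_const_mul]
  have hIA : ∫ p in polarCoord.target, A p = - (2 * Real.pi) * ψ 0 := by
    rw [show polarCoord.target = Ioi (0 : ℝ) ×ˢ Ioo (-Real.pi) Real.pi from rfl,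
      Measure.volume_eq_prod, ← setIntegral_prod_swap, setIntegral_prod]
    · have : ∀ θ : ℝ, ∫ r in Ioi (0 : ℝ), A (r, θ) = - ψ 0 := by
        intro θ
        set q : ℝ → ℂ := fun r => ψ (r * e θ)
        have hd : ∀ r : ℝ, HasDerivAt q (A (r, θ)) r := by
          intro r
          have h1 : HasDerivAt (fun r : ℝ => (r : ℂ) * e θ) (e θ) r := by
            simpa using (Complex.ofRealCLM.hasDerivAt (x := r)).mul_const (e θ)
          exact ((hψ.differentiable one_ne_zero _).hasFDerivAt).comp_hasDerivAt r h1
        have hq : ContDiff ℝ 1 q := by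
          apply hψ.comp
          exact (Complex.ofRealCLM.contDiff).mul contDiff_const
        have hqc : HasCompactSupport q := by
          apply hc.comp_isClosedEmbedding
          have : Isometry (fun r : ℝ => (r : ℂ) * e θ) := by
            apply Isometry.of_dist_eq
            intro x y
            rw [dist_eq_norm, dist_eq_norm, ← sub_mul, norm_mul, hen, mul_one, ← Complex.ofReal_sub,
              Complex.norm_real]
          exact this.isClosedEmbedding
        have := HasCompactSupport.integral_Ioi_deriv_eq hq hqc 0
        rw [show (deriv q) = fun r => A (r, θ) from funext fun r => (hd r).deriv] at this
        rw [this]; simp [q]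
      simp only [Prod.swap, this]
      rw [setIntegral_const]
      simp only [measureReal_def, Real.volume_Ioo, sub_neg_eq_add, smul_neg, Complex.real_smul]
      rw [ENNReal.toReal_ofReal (by positivity)]
      push_cast
      ring
    · have := hAi
      rw [Measure.volume_eq_prod] at this
      exact this.swap
  have hIB : ∫ p in polarCoord.target, B p = 0 := by
    rw [show polarCoord.target = Ioi (0 : ℝ) ×ˢ Ioo (-Real.pi) Real.pi from rfl,
      Measure.volume_eq_prod, setIntegral_prod]
    · apply setIntegral_eq_zero_of_forall_eq_zero
      intro r hr
      have hr' : (r : ℂ) ≠ 0 := by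
        have : (0 : ℝ) < r := hr
        exact_mod_cast this.ne'
      rw [← integral_Ioc_eq_integral_Ioo,
        ← intervalIntegral.integral_of_le (by linarith [Real.pi_pos])]
      have hd : ∀ θ : ℝ, HasDerivAt (fun θ : ℝ => ((r : ℂ))⁻¹ * ψ (r * e θ)) (B (r, θ)) θ := by
        intro θ
        have h0 : HasDerivAt e (Complex.I * e θ) θ := by
          have h00 : HasDerivAt (fun θ : ℝ => (θ : ℂ) * Complex.I) (Complex.I) θ := by
            simpa using (Complex.ofRealCLM.hasDerivAt (x := θ)).mul_const Complex.I
          simpa only [mul_comm Complex.I] using h00.cexp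
        have h1 : HasDerivAt (fun θ : ℝ => (r : ℂ) * e θ) (r • (Complex.I * e θ)) θ := by
          rw [Complex.real_smul]
          exact h0.const_mul _
        have h2 := ((hψ.differentiable one_ne_zero (r * e θ)).hasFDerivAt).comp_hasDerivAt θ h1
        rw [map_smul] at h2
        have h3 := h2.const_mul ((r : ℂ)⁻¹)
        rw [Complex.real_smul, ← mul_assoc, inv_mul_cancel₀ hr', one_mul] at h3
        exact h3
      rw [intervalIntegral.integral_eq_sub_of_hasDerivAt (fun θ _ => hd θ)]
      · simp [he, Complex.exp_neg]
      · exact (hBc.comp (by fun_prop : Continuous fun θ : ℝ => (r, θ))).intervalIntegrable _ _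
    · rw [← Measure.volume_eq_prod]
      exact hBi
  have hadd : ∫ p in polarCoord.target, (A p + Complex.I * B p) =
      (∫ p in polarCoord.target, A p) + ∫ p in polarCoord.target, Complex.I * B p :=
    integral_add hAi (hBi.const_mul Complex.I)
  rw [hadd, integral_const_mul, hIA, hIB]
  have : (Real.pi : ℂ) ≠ 0 := by exact_mod_cast Real.pi_ne_zero
  field_simp
  ring

theorem integral_cauchyKernel_mul_dbar {φ : Plane → ℂ} (hφ : ContDiff ℝ 1 φ)
    (hc : HasCompactSupport φ) : ∫ x, cauchyKernel x * dbar φ x = - φ 0 := by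
  set ψ : ℂ → ℂ := φ ∘ planeToComplex.symm
  have h := integral_polar_cauchy (ψ := ψ)
    (hφ.comp planeToComplex.symm.toContinuousLinearEquiv.contDiff)
    (hc.comp_isClosedEmbedding planeToComplex.symm.toHomeomorph.isClosedEmbedding)
  rw [← planeToComplex.measurePreserving.integral_comp
    planeToComplex.toHomeomorph.measurableEmbedding] at h
  rw [show ψ 0 = φ 0 by simp [ψ]] at h
  rw [← h]
  congr 1
  ext x
  have hd : ∀ v : ℂ, fderiv ℝ ψ (planeToComplex x) v = fderiv ℝ φ x (planeToComplex.symm v) := by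
    intro v
    have h1 : HasFDerivAt φ (fderiv ℝ φ x) (planeToComplex.symm (planeToComplex x)) := by
      simpa using (hφ.differentiable one_ne_zero x).hasFDerivAt
    have h2 := h1.comp (planeToComplex x)
      (planeToComplex.symm.toContinuousLinearEquiv.hasFDerivAt)
    rw [h2.fderiv]
    rfl
  rw [hd, hd, ← planeToComplex_single_zero, ← planeToComplex_single_one]
  simp only [LinearIsometryEquiv.symm_apply_apply]
  rw [planeToComplex_single_one]
  rfl

/-! ### Integrability of the kernel and Young's inequality -/

/-- The radial integrand is a multiple of `r ^ (1 - s)`, integrable at `0` because `s < 2`. The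
exponents needed later are `1` and `4/3`. -/
theorem lintegral_ball_cauchyKernel_rpow_lt_top (D : ℝ) {s : ℝ} (hs0 : 0 ≤ s) (hs : s < 2) :
    ∫⁻ x in Metric.ball (0 : Plane) D, ‖cauchyKernel x‖ₑ ^ s < ⊤ := by
  rcases le_or_gt D 0 with hD | hD
  · simp [Metric.ball_eq_empty.mpr hD]
  have h1 : Integrable (fun x : Plane =>
      (Iio D).indicator (fun r : ℝ => ((2 * Real.pi)⁻¹ * r⁻¹) ^ s) ‖x‖) volume := by
    rw [integrable_fun_norm_addHaar]
    simp only [finrank_euclideanSpace, Fintype.card_fin, Nat.add_one_sub_one, pow_one, smul_eq_mul]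
    have h2 : IntegrableOn (fun y : ℝ => ((2 * Real.pi)⁻¹) ^ s * y ^ (1 - s)) (Ioo 0 D) :=
      (((intervalIntegral.integrableOn_Ioo_rpow_iff hD).mpr (by linarith)).const_mul _)
    rw [← integrable_indicator_iff measurableSet_Ioo] at h2
    rw [← integrable_indicator_iff measurableSet_Ioi]
    refine h2.congr (.of_forall fun y => ?_)
    by_cases hy0 : 0 < y
    · by_cases hyD : y < D
      · rw [indicator_of_mem (show y ∈ Ioo 0 D from ⟨hy0, hyD⟩),
          indicator_of_mem (show y ∈ Ioi 0 from hy0)]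
        rw [indicator_of_mem (show y ∈ Iio D from hyD),
          Real.mul_rpow (by positivity) (by positivity), Real.inv_rpow hy0.le,
          Real.rpow_sub hy0, Real.rpow_one]
        ring
      · rw [indicator_of_notMem (fun h => hyD h.2), indicator_of_mem (show y ∈ Ioi 0 from hy0)]
        rw [indicator_of_notMem (show y ∉ Iio D from hyD), mul_zero]
    · rw [indicator_of_notMem (fun h => hy0 h.1),
        indicator_of_notMem (show y ∉ Ioi 0 from hy0)]
  have h3 := h1.hasFiniteIntegral
  rw [HasFiniteIntegral] at h3
  rw [← lintegral_indicator measurableSet_ball]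
  refine lt_of_eq_of_lt (lintegral_congr fun x => ?_) h3
  by_cases hx : ‖x‖ < D
  · rw [indicator_of_mem (by simpa using hx), indicator_of_mem (show ‖x‖ ∈ Iio D from hx),
      ← norm_cauchyKernel, ← ofReal_norm, ← ofReal_norm,
      ENNReal.ofReal_rpow_of_nonneg (norm_nonneg _) hs0,
      Real.norm_of_nonneg (Real.rpow_nonneg (norm_nonneg _) _)]
  · rw [indicator_of_notMem (by simpa using hx), indicator_of_notMem (show ‖x‖ ∉ Iio D from hx)]
    simp

/-- Young's inequality for the exponents `3/4 + 1/2 = 1 + 1/4`. Write `h k = (k^{4/3} h²)^{1/4}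
(k^{4/3})^{1/2} (h²)^{1/4}`, apply Hölder with weights `1/4, 1/2, 1/4`, and integrate in `x` by
Tonelli and translation invariance. -/
theorem lintegral_conv_pow_four_le {k h : Plane → ℝ≥0∞} (hk : Measurable k)
    (hh : AEMeasurable h) :
    ∫⁻ x, (∫⁻ y, h y * k (x - y)) ^ (4 : ℝ) ≤
      (∫⁻ x, k x ^ (4 / 3 : ℝ)) ^ (3 : ℝ) * (∫⁻ x, h x ^ (2 : ℝ)) ^ (2 : ℝ) := by
  have hb : ∀ x : Plane, ∫⁻ y, k (x - y) ^ (4 / 3 : ℝ) = ∫⁻ y, k y ^ (4 / 3 : ℝ) := fun x =>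
    lintegral_sub_left_eq_self (fun y => k y ^ (4 / 3 : ℝ)) x
  set b := ∫⁻ y, k y ^ (4 / 3 : ℝ) with hbdef
  set c := ∫⁻ x, h x ^ (2 : ℝ) with hc
  have hpt : ∀ x : Plane, (∫⁻ y, h y * k (x - y)) ^ (4 : ℝ) ≤
      (∫⁻ y, k (x - y) ^ (4 / 3 : ℝ) * h y ^ (2 : ℝ)) * (b ^ (2 : ℝ) * c) := by
    intro x
    have hkx : Measurable fun y => k (x - y) := hk.comp (measurable_const.sub measurable_id)
    have h3 := ENNReal.lintegral_prod_norm_pow_le (μ := (volume : Measure Plane)) Finset.univ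
      (f := ![fun y => k (x - y) ^ (4 / 3 : ℝ) * h y ^ (2 : ℝ), fun y => k (x - y) ^ (4 / 3 : ℝ),
        fun y => h y ^ (2 : ℝ)]) (p := ![1 / 4, 1 / 2, 1 / 4])
      (by
        intro i _
        fin_cases i
        · exact (hkx.pow_const _).aemeasurable.mul (hh.pow_const _)
        · exact (hkx.pow_const _).aemeasurable
        · exact hh.pow_const _)
      (by simp [Fin.sum_univ_three]; norm_num)
      (by intro i _; fin_cases i <;> simp)
    simp only [Fin.prod_univ_three, Matrix.cons_val_zero, Matrix.cons_val_one,
      Matrix.cons_val, hb] at h3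
    have h4 : ∀ u w : ℝ≥0∞, (u ^ (4 / 3 : ℝ) * w ^ (2 : ℝ)) ^ (1 / 4 : ℝ) *
        (u ^ (4 / 3 : ℝ)) ^ (1 / 2 : ℝ) * (w ^ (2 : ℝ)) ^ (1 / 4 : ℝ) = w * u := by
      intro u w
      rw [ENNReal.mul_rpow_of_nonneg _ _ (by norm_num)]
      simp only [← ENNReal.rpow_mul]
      calc _ = (w ^ (2 * (1 / 4) : ℝ) * w ^ (2 * (1 / 4) : ℝ)) *
          (u ^ (4 / 3 * (1 / 4) : ℝ) * u ^ (4 / 3 * (1 / 2) : ℝ)) := by ring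
        _ = w * u := by
          rw [← ENNReal.rpow_add_of_nonneg _ _ (by norm_num) (by norm_num),
            ← ENNReal.rpow_add_of_nonneg _ _ (by norm_num) (by norm_num)]
          norm_num
    simp only [h4] at h3
    refine (ENNReal.rpow_le_rpow h3 (by norm_num : (0 : ℝ) ≤ 4)).trans (le_of_eq ?_)
    rw [ENNReal.mul_rpow_of_nonneg _ _ (by norm_num), ENNReal.mul_rpow_of_nonneg _ _ (by norm_num)]
    simp only [← ENNReal.rpow_mul]
    norm_num
    simp only [hc, mul_assoc, ENNReal.rpow_ofNat]
  calc ∫⁻ x, (∫⁻ y, h y * k (x - y)) ^ (4 : ℝ)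
      ≤ ∫⁻ x, (∫⁻ y, k (x - y) ^ (4 / 3 : ℝ) * h y ^ (2 : ℝ)) * (b ^ (2 : ℝ) * c) :=
        lintegral_mono hpt
    _ = (∫⁻ x, ∫⁻ y, k (x - y) ^ (4 / 3 : ℝ) * h y ^ (2 : ℝ)) * (b ^ (2 : ℝ) * c) := by
        have hm : AEMeasurable (Function.uncurry fun x y : Plane =>
            k (x - y) ^ (4 / 3 : ℝ) * h y ^ (2 : ℝ)) (volume.prod volume) :=
          ((hk.comp measurable_sub).pow_const _).aemeasurable.mul (hh.comp_snd.pow_const _)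
        exact lintegral_mul_const'' _ hm.lintegral_prod_right'
    _ = (b * c) * (b ^ (2 : ℝ) * c) := by
        congr 1
        have hm : AEMeasurable (Function.uncurry fun x y : Plane =>
            k (x - y) ^ (4 / 3 : ℝ) * h y ^ (2 : ℝ)) (volume.prod volume) :=
          ((hk.comp measurable_sub).pow_const _).aemeasurable.mul (hh.comp_snd.pow_const _)
        rw [lintegral_lintegral_swap hm]
        have : ∀ y : Plane, ∫⁻ x, k (x - y) ^ (4 / 3 : ℝ) * h y ^ (2 : ℝ) = b * h y ^ (2 : ℝ) := by
          intro y
          rw [lintegral_mul_const]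
          · rw [lintegral_sub_right_eq_self (fun y => k y ^ (4 / 3 : ℝ)) y]
          · exact (hk.comp (measurable_id.sub measurable_const)).pow_const _
        simp only [this]
        rw [lintegral_const_mul'' _ (hh.pow_const _)]
    _ = b ^ (3 : ℝ) * c ^ (2 : ℝ) := by
        have e1 : b ^ (3 : ℝ) = b * b ^ (2 : ℝ) := by
          conv_rhs => rw [← ENNReal.rpow_one b, ← ENNReal.rpow_mul,
            ← ENNReal.rpow_add_of_nonneg _ _ (by norm_num) (by norm_num)]
          norm_num
        have e2 : c ^ (2 : ℝ) = c * c := by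
          rw [ENNReal.rpow_two, sq]
        rw [e1, e2]; ring

theorem eLpNorm_conv_four_le {k h : Plane → ℂ} (hk : Measurable k)
    (hh : AEStronglyMeasurable h) :
    eLpNorm (fun x => ∫ y, h y * k (x - y)) 4 volume ≤
      (∫⁻ x, ‖k x‖ₑ ^ (4 / 3 : ℝ)) ^ (3 / 4 : ℝ) * eLpNorm h 2 volume := by
  rw [eLpNorm_eq_lintegral_rpow_enorm_toReal (by norm_num) (by norm_num),
    eLpNorm_eq_lintegral_rpow_enorm_toReal (by norm_num) (by norm_num)]
  have h1 : ∫⁻ x, ‖∫ y, h y * k (x - y)‖ₑ ^ (4 : ℝ) ≤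
      ∫⁻ x, (∫⁻ y, ‖h y‖ₑ * ‖k (x - y)‖ₑ) ^ (4 : ℝ) := by
    apply lintegral_mono
    intro x
    apply ENNReal.rpow_le_rpow _ (by norm_num)
    refine (enorm_integral_le_lintegral_enorm _).trans (le_of_eq ?_)
    simp only [enorm_mul]
  have h2 := h1.trans (lintegral_conv_pow_four_le hk.enorm hh.enorm)
  simp only [ENNReal.toReal_ofNat]
  refine (ENNReal.rpow_le_rpow h2 (by norm_num)).trans (le_of_eq ?_)
  rw [ENNReal.mul_rpow_of_nonneg _ _ (by norm_num)]
  simp only [← ENNReal.rpow_mul]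
  norm_num

/-! ### The Cauchy transform of `L²` data with bounded support -/

/-- The Cauchy transform `h ↦ cauchyKernel * h`. -/
def cauchyTransform (h : Plane → ℂ) (x : Plane) : ℂ := ∫ y, h y * cauchyKernel (x - y)

/-- The Cauchy kernel cut off outside the ball of radius `D`. -/
def truncKernel (D : ℝ) : Plane → ℂ := (Metric.ball (0 : Plane) D).indicator cauchyKernel

theorem measurable_truncKernel (D : ℝ) : Measurable (truncKernel D) :=
  measurable_cauchyKernel.indicator measurableSet_ball

theorem lintegral_truncKernel (D : ℝ) {s : ℝ} (hs : 0 < s) :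
    ∫⁻ x, ‖truncKernel D x‖ₑ ^ s = ∫⁻ x in Metric.ball (0 : Plane) D, ‖cauchyKernel x‖ₑ ^ s := by
  rw [← lintegral_indicator measurableSet_ball]
  congr 1
  ext x
  by_cases hx : x ∈ Metric.ball (0 : Plane) D <;> simp [truncKernel, hx, hs]

theorem integrable_truncKernel (D : ℝ) : Integrable (truncKernel D) := by
  refine ⟨(measurable_truncKernel D).aestronglyMeasurable, ?_⟩
  have := lintegral_truncKernel D (s := 1) one_pos
  simp only [ENNReal.rpow_one] at this
  rw [HasFiniteIntegral, this]
  simpa using lintegral_ball_cauchyKernel_rpow_lt_top D (s := 1) (by norm_num) (by norm_num)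

theorem locallyIntegrable_cauchyKernel : LocallyIntegrable cauchyKernel := by
  intro x
  refine ⟨Metric.ball 0 (‖x‖ + 1), Metric.isOpen_ball.mem_nhds (by simp), ?_⟩
  exact (integrable_indicator_iff measurableSet_ball).mp (integrable_truncKernel _)

/-- The kernel decays too slowly to lie in `L^{4/3}` or `L¹` of the plane. When the data and the
evaluation point stay in balls, only differences of norm below `R + R'` occur, so a truncated kernel
does the same work. -/
theorem cauchyTransform_eq_truncKernel {H : Plane → ℂ} {R R' D : ℝ} (hD : R + R' ≤ D)
    (hH : Function.support H ⊆ Metric.ball 0 R) {x : Plane} (hx : x ∈ Metric.ball (0 : Plane) R') :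
    cauchyTransform H x = ∫ y, H y * truncKernel D (x - y) := by
  unfold cauchyTransform
  congr 1
  ext y
  by_cases hy : H y = 0
  · simp [hy]
  · have h1 : ‖y‖ < R := by simpa using hH hy
    have h2 : ‖x‖ < R' := by simpa using hx
    have : x - y ∈ Metric.ball (0 : Plane) D := by
      rw [mem_ball_zero_iff]
      linarith [norm_sub_le x y]
    rw [truncKernel, indicator_of_mem this]

theorem aestronglyMeasurable_cauchyTransform {H : Plane → ℂ} (hH : AEStronglyMeasurable H) :
    AEStronglyMeasurable (cauchyTransform H) := by
  have : AEStronglyMeasurable (fun p : Plane × Plane => H p.2 * cauchyKernel (p.1 - p.2))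
      (volume.prod volume) :=
    hH.comp_snd.mul (measurable_cauchyKernel.comp measurable_sub).aestronglyMeasurable
  exact this.integral_prod_right'

theorem eLpNorm_cauchyTransform_le {H : Plane → ℂ} {R : ℝ} (hH : AEStronglyMeasurable H)
    (hs : Function.support H ⊆ Metric.ball 0 R) (R' : ℝ) :
    eLpNorm (cauchyTransform H) 4 (volume.restrict (Metric.ball 0 R')) ≤
      (∫⁻ x, ‖truncKernel (R + R') x‖ₑ ^ (4 / 3 : ℝ)) ^ (3 / 4 : ℝ) * eLpNorm H 2 volume := by
  refine le_trans ?_ (eLpNorm_conv_four_le (measurable_truncKernel (R + R')) hH)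
  rw [eLpNorm_congr_ae (g := fun x => ∫ y, H y * truncKernel (R + R') (x - y))]
  · exact eLpNorm_mono_measure _ Measure.restrict_le_self
  · filter_upwards [ae_restrict_mem measurableSet_ball] with x hx
    exact cauchyTransform_eq_truncKernel le_rfl hs hx

theorem lintegral_truncKernel_lt_top (D : ℝ) :
    (∫⁻ x, ‖truncKernel D x‖ₑ ^ (4 / 3 : ℝ)) ^ (3 / 4 : ℝ) < ⊤ := by
  rw [lintegral_truncKernel D (by norm_num)]
  exact ENNReal.rpow_lt_top_of_nonneg (by norm_num)
    (lintegral_ball_cauchyKernel_rpow_lt_top D (by norm_num) (by norm_num)).ne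

theorem memLp_cauchyTransform {H : Plane → ℂ} {R : ℝ} (hH : MemLp H 2)
    (hs : Function.support H ⊆ Metric.ball 0 R) (R' : ℝ) :
    MemLp (cauchyTransform H) 4 (volume.restrict (Metric.ball 0 R')) :=
  ⟨(aestronglyMeasurable_cauchyTransform hH.1).restrict,
    (eLpNorm_cauchyTransform_le hH.1 hs R').trans_lt
      (ENNReal.mul_lt_top (lintegral_truncKernel_lt_top _) hH.2)⟩

theorem integrable_of_memLp_two {H : Plane → ℂ} {R : ℝ} (hH : MemLp H 2)
    (hs : Function.support H ⊆ Metric.ball 0 R) : Integrable H := by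
  rw [← integrableOn_iff_integrable_of_support_subset hs]
  have : IsFiniteMeasure (volume.restrict (Metric.ball (0 : Plane) R)) :=
    ⟨by rw [Measure.restrict_apply_univ]; exact measure_ball_lt_top⟩
  exact (hH.restrict _).integrable (by norm_num)

/-! ### Partial derivatives and the Cauchy transform of smooth functions -/

section pd

variable {F : Type*} [NormedAddCommGroup F] [NormedSpace ℝ F]

theorem contDiff_pd {f : Plane → F} (hf : ContDiff ℝ ∞ f) (j : Fin 2) : ContDiff ℝ ∞ (pd j f) :=
  (hf.fderiv_right (m := ∞) (by simp)).clm_apply contDiff_const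

theorem hasCompactSupport_pd {f : Plane → F} (hf : HasCompactSupport f) (j : Fin 2) :
    HasCompactSupport (pd j f) :=
  (hf.fderiv (𝕜 := ℝ)).comp_left (g := fun L : Plane →L[ℝ] F => L (EuclideanSpace.single j 1))
    (by simp)

theorem support_pd_subset (f : Plane → F) (j : Fin 2) : Function.support (pd j f) ⊆ tsupport f := by
  intro x hx
  by_contra h
  apply hx
  have : fderiv ℝ f x = 0 := by
    by_contra h'
    exact h (support_fderiv_subset ℝ h')
  simp [pd, this]

end pd

theorem pd_mul {f g : Plane → ℂ} {x : Plane} (hf : DifferentiableAt ℝ f x)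
    (hg : DifferentiableAt ℝ g x) (j : Fin 2) :
    pd j (fun y => f y * g y) x = pd j f x * g x + f x * pd j g x := by
  simp only [pd]
  rw [fderiv_fun_mul hf hg]
  simp
  ring

theorem pd_ofReal {χ : Plane → ℝ} {x : Plane} (hχ : DifferentiableAt ℝ χ x) (j : Fin 2) :
    pd j (fun y => (χ y : ℂ)) x = ((pd j χ x : ℝ) : ℂ) := by
  have := (Complex.ofRealCLM.hasFDerivAt (x := χ x)).comp x hχ.hasFDerivAt
  simp only [pd]
  rw [show (fun y => (χ y : ℂ)) = Complex.ofRealCLM ∘ χ from rfl, this.fderiv]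
  rfl

theorem dbar_mul {f g : Plane → ℂ} {x : Plane} (hf : DifferentiableAt ℝ f x)
    (hg : DifferentiableAt ℝ g x) :
    dbar (fun y => f y * g y) x = dbar f x * g x + f x * dbar g x := by
  simp only [dbar]
  rw [pd_mul hf hg, pd_mul hf hg]
  ring

theorem contDiff_dbar {f : Plane → ℂ} (hf : ContDiff ℝ ∞ f) : ContDiff ℝ ∞ (dbar f) :=
  (contDiff_pd hf 0).add (contDiff_const.mul (contDiff_pd hf 1))

theorem hasCompactSupport_dbar {f : Plane → ℂ} (hf : HasCompactSupport f) :
    HasCompactSupport (dbar f) :=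
  (hasCompactSupport_pd hf 0).add (hasCompactSupport_pd hf 1).mul_left

theorem integral_mul_pd {f g : Plane → ℂ} (hf : ContDiff ℝ 1 f) (hg : ContDiff ℝ 1 g)
    (hc : HasCompactSupport f) (j : Fin 2) :
    ∫ x, f x * pd j g x = - ∫ x, pd j f x * g x := by
  have hf' : Continuous (pd j f) := (hf.continuous_fderiv one_ne_zero).clm_apply continuous_const
  have hg' : Continuous (pd j g) := (hg.continuous_fderiv one_ne_zero).clm_apply continuous_const
  apply integral_mul_fderiv_eq_neg_fderiv_mul_of_integrable
  · exact (hf'.mul hg.continuous).integrable_of_hasCompactSupport (hasCompactSupport_pd hc j).mul_right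
  · exact (hf.continuous.mul hg').integrable_of_hasCompactSupport hc.mul_right
  · exact (hf.continuous.mul hg.continuous).integrable_of_hasCompactSupport hc.mul_right
  · exact fun x _ => hf.differentiable one_ne_zero x
  · exact fun x _ => hg.differentiable one_ne_zero x

theorem exists_tsupport_subset_ball {F : Type*} [Zero F] {f : Plane → F}
    (hf : HasCompactSupport f) : ∃ R > 0, tsupport f ⊆ Metric.ball 0 R := by
  obtain ⟨R, hR⟩ := hf.isCompact.isBounded.subset_ball_lt 0 0
  exact ⟨R, hR⟩

theorem cauchyTransform_eq_convolution (h : Plane → ℂ) :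
    cauchyTransform h = convolution h cauchyKernel (ContinuousLinearMap.mul ℝ ℂ) volume := by
  ext x; rfl

theorem contDiff_cauchyTransform {h : Plane → ℂ} (hh : ContDiff ℝ ∞ h)
    (hc : HasCompactSupport h) : ContDiff ℝ ∞ (cauchyTransform h) := by
  rw [cauchyTransform_eq_convolution]
  exact hc.contDiff_convolution_left (n := ⊤) _ hh locallyIntegrable_cauchyKernel

theorem pd_cauchyTransform {h : Plane → ℂ} (hh : ContDiff ℝ ∞ h)
    (hc : HasCompactSupport h) (j : Fin 2) (x : Plane) :
    pd j (cauchyTransform h) x = cauchyTransform (pd j h) x := by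
  have h1 : ContDiff ℝ 1 h := hh.of_le (by simp)
  have := hc.hasFDerivAt_convolution_left (ContinuousLinearMap.mul ℝ ℂ) h1
    locallyIntegrable_cauchyKernel x
  rw [cauchyTransform_eq_convolution, cauchyTransform_eq_convolution, pd, this.fderiv]
  have hce : ConvolutionExistsAt (fderiv ℝ h) cauchyKernel x
      (ContinuousLinearMap.precompL Plane (ContinuousLinearMap.mul ℝ ℂ)) volume :=
    (hc.fderiv (𝕜 := ℝ)).convolutionExists_left _ (h1.continuous_fderiv one_ne_zero)
      locallyIntegrable_cauchyKernel x
  rw [convolution, convolution, ContinuousLinearMap.integral_apply hce]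
  rfl

theorem integrable_mul_cauchyKernel {h : Plane → ℂ} (hh : Continuous h)
    (hc : HasCompactSupport h) (x : Plane) : Integrable fun y => h y * cauchyKernel (x - y) :=
  hc.convolutionExists_left (ContinuousLinearMap.mul ℝ ℂ) hh locallyIntegrable_cauchyKernel x

/-- This is the fundamental solution identity at the origin for the reflected translate `t ↦ h (x -
t)`; the reflection changes the sign of `dbar`. -/
theorem cauchyTransform_dbar {h : Plane → ℂ} (hh : ContDiff ℝ ∞ h)
    (hc : HasCompactSupport h) : cauchyTransform (dbar h) = h := by
  ext x
  rw [cauchyTransform, ← integral_sub_left_eq_self _ volume x]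
  simp only [sub_sub_cancel]
  set φ : Plane → ℂ := fun t => h (x - t)
  have hφ : ContDiff ℝ 1 φ := (hh.of_le (by simp)).comp (contDiff_const.sub contDiff_id)
  have hφc : HasCompactSupport φ := hc.comp_homeomorph (Homeomorph.subLeft x)
  have hd : ∀ t, dbar φ t = - dbar h (x - t) := by
    intro t
    have hp : ∀ j, pd j φ t = - pd j h (x - t) := by
      intro j
      have h1 : HasFDerivAt h (fderiv ℝ h (x - t)) (x - t) :=
        (hh.differentiable (by simp) _).hasFDerivAt
      have h2 := h1.comp t ((hasFDerivAt_id t).const_sub x)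
      have h3 : HasFDerivAt φ _ t := h2
      simp only [pd]
      rw [h3.fderiv]
      simp
    simp only [dbar, hp]; ring
  have := integral_cauchyKernel_mul_dbar hφ hφc
  simp only [hd] at this
  rw [show φ 0 = h x by simp [φ]] at this
  rw [← neg_inj, ← this, ← integral_neg]
  congr 1; ext t; ring

/-- Derivatives of a convolution fall on the smooth factor, so `dbar` commutes with the transform
and `cauchyTransform_dbar` applies. -/
theorem dbar_cauchyTransform {h : Plane → ℂ} (hh : ContDiff ℝ ∞ h)
    (hc : HasCompactSupport h) : dbar (cauchyTransform h) = h := by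
  conv_rhs => rw [← cauchyTransform_dbar hh hc]
  ext x
  simp only [dbar]
  rw [pd_cauchyTransform hh hc, pd_cauchyTransform hh hc]
  simp only [cauchyTransform]
  rw [← integral_const_mul, ← integral_add]
  · congr 1; ext y; simp only [dbar]; ring
  · exact integrable_mul_cauchyKernel (contDiff_pd hh 0).continuous (hasCompactSupport_pd hc 0) x
  · exact (integrable_mul_cauchyKernel (contDiff_pd hh 1).continuous
      (hasCompactSupport_pd hc 1) x).const_mul _

/-- For `‖x‖ ≥ 2R` every `y` in the support has `‖x - y‖ ≥ ‖x‖ / 2`, so the kernel is at most `(π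
‖x‖)⁻¹`. The decay pays for cutting the transform off at large radii. -/
theorem norm_cauchyTransform_le {h : Plane → ℂ} {R : ℝ} (hR : 0 < R)
    (hs : Function.support h ⊆ Metric.ball 0 R) (hi : Integrable h) {x : Plane} (hx : 2 * R ≤ ‖x‖) :
    ‖cauchyTransform h x‖ ≤ (∫ y, ‖h y‖) * ‖x‖⁻¹ := by
  rw [← integral_mul_const]
  apply norm_integral_le_of_norm_le (hi.norm.mul_const _)
  refine .of_forall fun y => ?_
  rw [norm_mul]
  by_cases hy : h y = 0
  · simp [hy]
  · have h1 : ‖y‖ < R := by simpa using hs hy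
    gcongr
    rw [norm_cauchyKernel, ← mul_inv]
    have hx0 : 0 < ‖x‖ := by linarith
    apply inv_anti₀ hx0
    have h2 : ‖x‖ / 2 ≤ ‖x - y‖ := by linarith [norm_sub_norm_le x y]
    nlinarith [Real.pi_gt_three, norm_nonneg (x - y)]

/-! ### The Cauchy transform in the weak sense -/

/-- Fubini together with oddness of the kernel: the transform is antisymmetric. Truncating the
kernel makes the double integral absolutely convergent. -/
theorem integral_cauchyTransform_mul {H φ : Plane → ℂ} {R : ℝ} (hH : MemLp H 2)
    (hs : Function.support H ⊆ Metric.ball 0 R) (hφ : Continuous φ) (hc : HasCompactSupport φ) :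
    ∫ x, cauchyTransform H x * φ x = - ∫ y, H y * cauchyTransform φ y := by
  obtain ⟨R', -, hR'⟩ := exists_tsupport_subset_ball hc
  have hs' : Function.support φ ⊆ Metric.ball 0 R' := (subset_tsupport φ).trans hR'
  set k := truncKernel (R + R')
  have hi : Integrable (fun p : Plane × Plane => H p.2 * k (p.1 - p.2)) (volume.prod volume) :=
    (integrable_of_memLp_two hH hs).convolution_integrand (ContinuousLinearMap.mul ℝ ℂ)
      (integrable_truncKernel (R + R'))
  have hi2 : Integrable (fun p : Plane × Plane => H p.2 * k (p.1 - p.2) * φ p.1)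
      (volume.prod volume) := by
    obtain ⟨M, hM⟩ := hc.exists_bound_of_continuous hφ
    exact hi.mul_bdd (c := M) (hφ.comp continuous_fst).aestronglyMeasurable
      (.of_forall fun p => hM p.1)
  have e1 : ∀ x, cauchyTransform H x * φ x = ∫ y, H y * k (x - y) * φ x := by
    intro x
    rw [integral_mul_const]
    by_cases hx : φ x = 0
    · simp [hx]
    · rw [cauchyTransform_eq_truncKernel le_rfl hs (hs' hx)]
  have e2 : ∀ y, H y * cauchyTransform φ y = - ∫ x, H y * k (x - y) * φ x := by
    intro y
    by_cases hy : H y = 0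
    · simp [hy]
    · rw [cauchyTransform_eq_truncKernel (D := R + R') (by rw [add_comm]) hs' (hs hy),
        ← integral_const_mul, ← integral_neg]
      congr 1; ext x
      have : truncKernel (R + R') (y - x) = - k (x - y) := by
        simp only [k, truncKernel]
        rw [← neg_sub x y]
        by_cases hxy : x - y ∈ Metric.ball (0 : Plane) (R + R')
        · rw [indicator_of_mem hxy, indicator_of_mem, cauchyKernel_neg]
          rwa [mem_ball_zero_iff, norm_neg, ← mem_ball_zero_iff]
        · rw [indicator_of_notMem hxy, indicator_of_notMem, neg_zero]
          rwa [mem_ball_zero_iff, norm_neg, ← mem_ball_zero_iff]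
      rw [this]; ring
  simp only [e1, e2, integral_neg, neg_neg]
  exact integral_integral_swap hi2

theorem integral_cauchyTransform_mul_dbar {H φ : Plane → ℂ} {R : ℝ} (hH : MemLp H 2)
    (hs : Function.support H ⊆ Metric.ball 0 R) (hφ : ContDiff ℝ ∞ φ) (hc : HasCompactSupport φ) :
    ∫ x, cauchyTransform H x * dbar φ x = - ∫ y, H y * φ y := by
  rw [integral_cauchyTransform_mul hH hs (contDiff_dbar hφ).continuous (hasCompactSupport_dbar hc),
    cauchyTransform_dbar hφ hc]

theorem locallyIntegrable_cauchyTransform {g : Plane → ℂ} {R : ℝ} (hg : MemLp g 2)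
    (hgs : Function.support g ⊆ Metric.ball 0 R) : LocallyIntegrable (cauchyTransform g) := by
  intro x
  refine ⟨Metric.ball 0 (‖x‖ + 1), Metric.isOpen_ball.mem_nhds (by simp), ?_⟩
  have : IsFiniteMeasure (volume.restrict (Metric.ball (0 : Plane) (‖x‖ + 1))) :=
    ⟨by rw [Measure.restrict_apply_univ]; exact measure_ball_lt_top⟩
  exact (memLp_cauchyTransform hg hgs _).integrable (by norm_num)

/-- A compactly supported function is the Cauchy transform of its weak `∂₁ + i ∂₂`. -/
theorem ae_eq_cauchyTransform {u g : Plane → ℂ} {R : ℝ} (hu : LocallyIntegrable u)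
    (hus : Function.support u ⊆ Metric.ball 0 R) (hg : MemLp g 2)
    (hgs : Function.support g ⊆ Metric.ball 0 R)
    (h : ∀ φ : Plane → ℂ, ContDiff ℝ ∞ φ → HasCompactSupport φ →
      ∫ x, u x * dbar φ x = - ∫ x, g x * φ x) :
    u =ᵐ[volume] cauchyTransform g := by
  apply ae_eq_of_integral_contDiff_smul_eq hu (locallyIntegrable_cauchyTransform hg hgs)
  intro φ hφ hc
  set Φ : Plane → ℂ := fun x => (φ x : ℂ)
  have hΦ : ContDiff ℝ ∞ Φ := Complex.ofRealCLM.contDiff.comp hφ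
  have hΦc : HasCompactSupport Φ := hc.comp_left Complex.ofReal_zero
  have hψ := contDiff_cauchyTransform hΦ hΦc
  -- `cauchyTransform Φ` would be the ideal test function but need not have compact support. A
  -- cutoff equal to `1` on the ball carrying `u` and `g` makes it admissible and leaves both
  -- integrals unchanged.
  let χ : ContDiffBump (0 : Plane) := ⟨max R 1, max R 1 + 1, by positivity, by simp⟩
  set X : Plane → ℂ := fun x => (χ x : ℂ)
  have hX : ContDiff ℝ ∞ X := Complex.ofRealCLM.contDiff.comp χ.contDiff
  have hXc : HasCompactSupport X := χ.hasCompactSupport.comp_left Complex.ofReal_zero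
  have hX1 : ∀ x ∈ Metric.ball (0 : Plane) R, X =ᶠ[nhds x] fun _ => 1 := by
    intro x hx
    filter_upwards [Metric.isOpen_ball.mem_nhds hx] with y hy
    have : χ y = 1 := χ.one_of_mem_closedBall
      (Metric.ball_subset_closedBall (Metric.ball_subset_ball (le_max_left _ _) hy))
    simp [X, this]
  have hd : ∀ x ∈ Metric.ball (0 : Plane) R,
      dbar (fun y => X y * cauchyTransform Φ y) x = Φ x := by
    intro x hx
    have : (fun y => X y * cauchyTransform Φ y) =ᶠ[nhds x] cauchyTransform Φ := by
      filter_upwards [hX1 x hx] with y hy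
      rw [hy, one_mul]
    rw [dbar, pd, pd, this.fderiv_eq]
    exact congrFun (dbar_cauchyTransform hΦ hΦc) x
  have h1 := h (fun y => X y * cauchyTransform Φ y) (hX.mul hψ) hXc.mul_right
  have e1 : ∫ x, u x * dbar (fun y => X y * cauchyTransform Φ y) x = ∫ x, φ x • u x := by
    congr 1; ext x
    by_cases hx : u x = 0
    · simp [hx]
    · rw [hd x (hus hx), Complex.real_smul, mul_comm]
  have e2 : ∫ x, g x * (X x * cauchyTransform Φ x) = ∫ x, g x * cauchyTransform Φ x := by
    congr 1; ext x
    by_cases hx : g x = 0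
    · simp [hx]
    · rw [(hX1 x (hgs hx)).eq_of_nhds, one_mul]
  rw [e1, e2] at h1
  rw [h1, ← integral_cauchyTransform_mul hg hgs hΦ.continuous hΦc]
  congr 1; ext x
  rw [Complex.real_smul, mul_comm]

/-! ### Weak convergence in `L²` -/

open Filter Topology

/-- Weak convergence in `L²(μ; ℂ)`, tested without complex conjugation. -/
def WeakTendsto (μ : Measure Plane) (u : ℕ → Plane → ℂ) (g : Plane → ℂ) : Prop :=
  ∀ ψ : Plane → ℂ, MemLp ψ 2 μ → Tendsto (fun n => ∫ x, ψ x * u n x ∂μ) atTop (𝓝 (∫ x, ψ x * g x ∂μ))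

theorem WeakTendsto.comp {μ : Measure Plane} {u : ℕ → Plane → ℂ} {g : Plane → ℂ}
    (h : WeakTendsto μ u g) {ns : ℕ → ℕ} (hns : StrictMono ns) :
    WeakTendsto μ (fun n => u (ns n)) g :=
  fun ψ hψ => (h ψ hψ).comp hns.tendsto_atTop

/-- Sequential Banach–Alaoglu in the separable space `L²`, carried over by the Riesz isomorphism. -/
theorem exists_weakTendsto (μ : Measure Plane) [SigmaFinite μ] {u : ℕ → Plane → ℂ}
    (hu : ∀ n, MemLp (u n) 2 μ) {C : ℝ≥0} (hC : ∀ n, eLpNorm (u n) 2 μ ≤ C) :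
    ∃ (g : Plane → ℂ) (ns : ℕ → ℕ), StrictMono ns ∧ MemLp g 2 μ ∧
      WeakTendsto μ (fun n => u (ns n)) g := by
  have : Fact ((2 : ℝ≥0∞) ≠ ⊤) := ⟨by norm_num⟩
  have : TopologicalSpace.SeparableSpace (Lp ℂ 2 μ) := inferInstance
  set U : ℕ → Lp ℂ 2 μ := fun n => (hu n).toLp (u n)
  have hU : ∀ n, ‖U n‖ ≤ C := by
    intro n
    rw [Lp.norm_toLp]
    exact ENNReal.toReal_le_of_le_ofReal C.2 (by simpa using hC n)
  set x : ℕ → WeakDual ℂ (Lp ℂ 2 μ) := fun n =>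
    StrongDual.toWeakDual (InnerProductSpace.toDual ℂ (Lp ℂ 2 μ) (U n))
  obtain ⟨a, -, ns, hns, hlim⟩ := WeakDual.isSeqCompact_closedBall ℂ (Lp ℂ 2 μ) 0 C
    (x := x) (fun n => by
      simp only [x, mem_preimage, mem_closedBall_zero_iff]
      exact (((InnerProductSpace.toDual ℂ (Lp ℂ 2 μ)).norm_map (U n)).trans_le (hU n)))
  set G : Lp ℂ 2 μ := (InnerProductSpace.toDual ℂ (Lp ℂ 2 μ)).symm (WeakDual.toStrongDual a)
  refine ⟨G, ns, hns, Lp.memLp G, ?_⟩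
  intro ψ hψ
  -- The inner product conjugates its first argument, so the test function enters conjugated.
  set Ψ : Lp ℂ 2 μ := hψ.star.toLp _
  have h1 : Tendsto (fun n => inner ℂ (U (ns n)) Ψ) atTop (𝓝 (inner ℂ G Ψ)) := by
    have h2 := ((WeakDual.eval_continuous Ψ).tendsto a).comp hlim
    have h3 : (inner ℂ G Ψ) = a Ψ := by
      rw [← InnerProductSpace.toDual_apply_apply (𝕜 := ℂ)]
      simp [G]
    rw [h3]
    exact h2
  have h4 := (Complex.continuous_conj.tendsto _).comp h1
  simp only [Function.comp_def, inner_conj_symm] at h4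
  have h5 : ∀ (w : Plane → ℂ) (W : Lp ℂ 2 μ), W =ᵐ[μ] w → inner ℂ Ψ W = ∫ x, ψ x * w x ∂μ := by
    intro w W hW
    rw [L2.inner_def]
    apply integral_congr_ae
    filter_upwards [hW, hψ.star.coeFn_toLp] with y h6 h7
    rw [h6, h7]
    simp [mul_comm]
  rw [h5 G G EventuallyEq.rfl] at h4
  refine h4.congr fun n => ?_
  exact h5 _ _ (hu (ns n)).coeFn_toLp

theorem exists_weakTendsto_family (μ : Measure Plane) [SigmaFinite μ] {ι : Type*} [Finite ι]
    {u : ι → ℕ → Plane → ℂ} (hu : ∀ i n, MemLp (u i n) 2 μ) {C : ι → ℝ≥0}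
    (hC : ∀ i n, eLpNorm (u i n) 2 μ ≤ C i) :
    ∃ (g : ι → Plane → ℂ) (ns : ℕ → ℕ), StrictMono ns ∧ ∀ i, MemLp (g i) 2 μ ∧
      WeakTendsto μ (fun n => u i (ns n)) (g i) := by
  classical
  have := Fintype.ofFinite ι
  have key : ∀ s : Finset ι, ∃ (g : ι → Plane → ℂ) (ns : ℕ → ℕ), StrictMono ns ∧
      ∀ i ∈ s, MemLp (g i) 2 μ ∧ WeakTendsto μ (fun n => u i (ns n)) (g i) := by
    intro s
    induction s using Finset.induction_on with
    | empty => exact ⟨fun _ _ => 0, id, strictMono_id, by simp⟩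
    | insert a s ha ih =>
      obtain ⟨g, ns, hns, hg⟩ := ih
      obtain ⟨g', ms, hms, hg', hw⟩ := exists_weakTendsto μ (u := fun n => u a (ns n))
        (fun n => hu a (ns n)) (fun n => hC a (ns n))
      refine ⟨Function.update g a g', ns ∘ ms, hns.comp hms, fun i hi => ?_⟩
      by_cases hia : i = a
      · subst hia
        rw [Function.update_self]
        exact ⟨hg', hw⟩
      · rw [Function.update_of_ne hia]
        have hi' := hg i ((Finset.mem_insert.mp hi).resolve_left hia)
        exact ⟨hi'.1, hi'.2.comp hms⟩
  obtain ⟨g, ns, hns, h⟩ := key Finset.univ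
  exact ⟨g, ns, hns, fun i => h i (Finset.mem_univ i)⟩

/-- A weak limit is determined only up to null sets, while the Cauchy transform lemmas ask for
pointwise support. Moving the indicator onto the test function shows that the cut-off representative
is still a weak limit. -/
theorem WeakTendsto.indicator {μ : Measure Plane} {u : ℕ → Plane → ℂ} {g : Plane → ℂ}
    {s : Set Plane} (hs : MeasurableSet s) (h : WeakTendsto μ u g)
    (hu : ∀ n, Function.support (u n) ⊆ s) : WeakTendsto μ u (s.indicator g) := by
  intro ψ hψ
  have h1 := h (s.indicator ψ) (hψ.indicator hs)
  have e1 : ∀ x, s.indicator ψ x * g x = ψ x * s.indicator g x := by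
    intro x
    by_cases hx : x ∈ s <;> simp [hx]
  have e2 : ∀ n x, s.indicator ψ x * u n x = ψ x * u n x := by
    intro n x
    by_cases hx : x ∈ s
    · simp [hx]
    · have : u n x = 0 := by
        by_contra h'
        exact hx (hu n h')
      simp [this]
  simpa only [e1, e2] using h1

theorem integrable_mul_of_memLp_two {μ : Measure Plane} {f g : Plane → ℂ} (hf : MemLp f 2 μ)
    (hg : MemLp g 2 μ) : Integrable (fun x => f x * g x) μ := by
  have := hf.integrable_mul hg
  exact this

theorem lintegral_enorm_sq_eq {μ : Measure Plane} {g : Plane → ℂ} (hg : MemLp g 2 μ) :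
    ∫⁻ x, ‖g x‖ₑ ^ 2 ∂μ = ENNReal.ofReal (∫ x, ‖g x‖ ^ 2 ∂μ) := by
  rw [ofReal_integral_eq_lintegral_ofReal]
  · congr 1; ext x
    rw [ENNReal.ofReal_pow (norm_nonneg _), ofReal_norm]
  · exact hg.integrable_norm_pow (by norm_num)
  · exact .of_forall fun x => by positivity

/-- Integrate `|u n|² ≥ 2 Re (conj g · u n) - |g|²` and let `n → ∞`: the right side tends to `∫
|g|²`. -/
theorem WeakTendsto.lintegral_sq_le {μ : Measure Plane} {u : ℕ → Plane → ℂ} {g : Plane → ℂ}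
    (h : WeakTendsto μ u g) (hu : ∀ n, MemLp (u n) 2 μ) (hg : MemLp g 2 μ) :
    ∫⁻ x, ‖g x‖ₑ ^ 2 ∂μ ≤ liminf (fun n => ∫⁻ x, ‖u n x‖ₑ ^ 2 ∂μ) atTop := by
  have h1 := h (fun x => star (g x)) hg.star
  have h2 : Tendsto (fun n => ENNReal.ofReal (2 * (∫ x, star (g x) * u n x ∂μ).re -
      ∫ x, ‖g x‖ ^ 2 ∂μ)) atTop (𝓝 (∫⁻ x, ‖g x‖ₑ ^ 2 ∂μ)) := by
    have h3 := (((Complex.continuous_re.tendsto _).comp h1).const_mul 2).sub_const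
      (∫ x, ‖g x‖ ^ 2 ∂μ)
    have h4 := (ENNReal.continuous_ofReal.tendsto _).comp h3
    have e : (∫ x, star (g x) * g x ∂μ).re = ∫ x, ‖g x‖ ^ 2 ∂μ := by
      have : ∀ x, star (g x) * g x = ((‖g x‖ ^ 2 : ℝ) : ℂ) := by
        intro x
        rw [Complex.star_def, Complex.conj_mul']; push_cast; rfl
      simp only [this]
      rw [integral_complex_ofReal, Complex.ofReal_re]
    rw [e, show 2 * ∫ x, ‖g x‖ ^ 2 ∂μ - ∫ x, ‖g x‖ ^ 2 ∂μ = ∫ x, ‖g x‖ ^ 2 ∂μ by ring] at h4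
    rw [lintegral_enorm_sq_eq hg]
    exact h4
  rw [← h2.liminf_eq]
  refine liminf_le_liminf (.of_forall fun n => ?_)
  rw [lintegral_enorm_sq_eq (hu n)]
  apply ENNReal.ofReal_le_ofReal
  have hi1 : Integrable (fun x => star (g x) * u n x) μ := integrable_mul_of_memLp_two hg.star (hu n)
  have hi2 : Integrable (fun x => ‖g x‖ ^ 2) μ := hg.integrable_norm_pow (by norm_num)
  have hi3 : Integrable (fun x => ‖u n x‖ ^ 2) μ := (hu n).integrable_norm_pow (by norm_num)
  have hi4 : Integrable (fun x => 2 * (star (g x) * u n x).re) μ := hi1.re.const_mul 2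
  have e3 : (∫ x, star (g x) * u n x ∂μ).re = ∫ x, (star (g x) * u n x).re ∂μ :=
    (integral_re hi1).symm
  rw [e3, ← integral_const_mul, ← integral_sub hi4 hi2]
  apply integral_mono (hi4.sub hi2) hi3
  intro x
  simp only [Pi.sub_apply, RCLike.star_def, Complex.mul_re, Complex.conj_re, Complex.conj_im, Complex.sq_norm,
    Complex.normSq_apply]
  nlinarith [sq_nonneg ((g x).re - (u n x).re), sq_nonneg ((g x).im - (u n x).im)]

/-- Taking real parts is not complex linear, but `∫ ψ Re f` is half the sum of `∫ ψ f` and the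
conjugate of `∫ conj ψ · f`, and both terms converge. -/
theorem WeakTendsto.re {μ : Measure Plane} {u : ℕ → Plane → ℂ} {g : Plane → ℂ}
    (h : WeakTendsto μ u g) (hu : ∀ n, MemLp (u n) 2 μ) (hg : MemLp g 2 μ) :
    WeakTendsto μ (fun n x => ((u n x).re : ℂ)) (fun x => ((g x).re : ℂ)) := by
  intro ψ hψ
  have key : ∀ {f : Plane → ℂ}, MemLp f 2 μ → ∫ x, ψ x * ((f x).re : ℂ) ∂μ =
      (∫ x, ψ x * f x ∂μ) / 2 + (starRingEnd ℂ) (∫ x, star (ψ x) * f x ∂μ) / 2 := by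
    intro f hf
    have h1 : Integrable (fun x => ψ x * f x) μ := integrable_mul_of_memLp_two hψ hf
    have h2 : Integrable (fun x => star (ψ x) * f x) μ := integrable_mul_of_memLp_two hψ.star hf
    have h3 : Integrable (fun x => (starRingEnd ℂ) (star (ψ x) * f x)) μ :=
      Complex.conjCLE.toContinuousLinearMap.integrable_comp h2
    rw [← integral_conj, ← integral_div, ← integral_div,
      ← integral_add (h1.div_const 2) (h3.div_const 2)]
    congr 1; ext x
    rw [Complex.re_eq_add_conj]
    simp
    ring
  simp only [key hg, key (hu _)]
  exact ((h ψ hψ).div_const 2).add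
    (((Complex.continuous_conj.tendsto _).comp (h _ hψ.star)).div_const 2)

theorem WeakTendsto.lintegral_re_sq_le {μ : Measure Plane} {u : ℕ → Plane → ℂ} {g : Plane → ℂ}
    (h : WeakTendsto μ u g) (hu : ∀ n, MemLp (u n) 2 μ) (hg : MemLp g 2 μ) :
    ∫⁻ x, ENNReal.ofReal ((g x).re ^ 2) ∂μ ≤
      liminf (fun n => ∫⁻ x, ENNReal.ofReal ((u n x).re ^ 2) ∂μ) atTop := by
  have hre : ∀ {f : Plane → ℂ}, MemLp f 2 μ → MemLp (fun x => ((f x).re : ℂ)) 2 μ :=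
    fun hf => hf.re.ofReal
  have e : ∀ {f : Plane → ℂ}, ∫⁻ x, ENNReal.ofReal ((f x).re ^ 2) ∂μ =
      ∫⁻ x, ‖((f x).re : ℂ)‖ₑ ^ 2 ∂μ := by
    intro f
    congr 1; ext x
    rw [← ofReal_norm, ← ENNReal.ofReal_pow (norm_nonneg _), Complex.norm_real, Real.norm_eq_abs,
      sq_abs]
  simp only [e]
  exact (h.re hu hg).lintegral_sq_le (fun n => hre (hu n)) (hre hg)

/-! ### Complete continuity of the Cauchy transform -/

theorem eLpNorm_one_le {H : Plane → ℂ} {R : ℝ} (hH : AEStronglyMeasurable H)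
    (hs : Function.support H ⊆ Metric.ball 0 R) :
    eLpNorm H 1 volume ≤ eLpNorm H 2 volume * volume (Metric.ball (0 : Plane) R) ^ (1 / 2 : ℝ) := by
  have h1 : ∀ p, eLpNorm H p volume = eLpNorm H p (volume.restrict (Metric.ball 0 R)) := by
    intro p
    rw [← eLpNorm_indicator_eq_eLpNorm_restrict measurableSet_ball,
      indicator_eq_self.mpr hs]
  rw [h1, h1 2]
  have := eLpNorm_le_eLpNorm_mul_rpow_measure_univ (p := 1) (q := 2)
    (μ := volume.restrict (Metric.ball (0 : Plane) R)) (by norm_num) hH.restrict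
  rw [Measure.restrict_apply_univ] at this
  refine this.trans (le_of_eq ?_)
  norm_num

/-- Away from the ball of radius `δ` the kernel is bounded, so this difference is bounded with
bounded support. Its translates are therefore legitimate `L²` test functions for weak convergence.
-/
theorem norm_truncKernel_sub_le {δ D : ℝ} (hδ : 0 < δ) (hD : δ ≤ D) (x : Plane) :
    ‖truncKernel D x - truncKernel δ x‖ ≤ (Metric.ball (0 : Plane) D).indicator (fun _ => δ⁻¹) x := by
  simp only [truncKernel]
  by_cases h1 : x ∈ Metric.ball (0 : Plane) δ
  · rw [indicator_of_mem h1, indicator_of_mem (Metric.ball_subset_ball hD h1),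
      indicator_of_mem (Metric.ball_subset_ball hD h1), sub_self, norm_zero]
    positivity
  · by_cases h2 : x ∈ Metric.ball (0 : Plane) D
    · rw [indicator_of_notMem h1, indicator_of_mem h2, indicator_of_mem h2, sub_zero,
        norm_cauchyKernel, ← mul_inv]
      have h3 : δ ≤ ‖x‖ := by simpa using h1
      apply inv_anti₀ hδ
      nlinarith [Real.pi_gt_three]
    · rw [indicator_of_notMem h1, indicator_of_notMem h2, indicator_of_notMem h2]
      simp

theorem memLp_truncKernel_sub {δ D : ℝ} (hδ : 0 < δ) (hD : δ ≤ D) (x : Plane) :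
    MemLp (fun y => truncKernel D (x - y) - truncKernel δ (x - y)) 2 := by
  have h1 : MemLp ((Metric.ball (0 : Plane) D).indicator (fun _ => δ⁻¹)) 2 volume :=
    memLp_indicator_const 2 measurableSet_ball _ (.inr measure_ball_lt_top.ne)
  have h2 : MemLp (fun z => truncKernel D z - truncKernel δ z) 2 volume :=
    h1.of_le ((measurable_truncKernel D).sub (measurable_truncKernel δ)).aestronglyMeasurable
      (.of_forall fun z => (norm_truncKernel_sub_le hδ hD z).trans (le_abs_self _))
  exact h2.comp_measurePreserving (Measure.measurePreserving_sub_left volume x)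

/-- The Cauchy transform is completely continuous from `L²` of a ball to `L⁴` of a ball. -/
theorem tendsto_eLpNorm_cauchyTransform_sub {H : ℕ → Plane → ℂ} {G : Plane → ℂ} {R : ℝ}
    (hH : ∀ n, MemLp (H n) 2) (hHs : ∀ n, Function.support (H n) ⊆ Metric.ball 0 R)
    (hG : MemLp G 2) (hGs : Function.support G ⊆ Metric.ball 0 R) {C : ℝ≥0}
    (hC : ∀ n, eLpNorm (H n) 2 volume ≤ C) (hw : WeakTendsto volume H G) (R' : ℝ) :
    Tendsto (fun n => eLpNorm (fun x => cauchyTransform (H n) x - cauchyTransform G x) 4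
      (volume.restrict (Metric.ball 0 R'))) atTop (𝓝 0) := by
  set μ := volume.restrict (Metric.ball (0 : Plane) R') with hμ
  have hfin : IsFiniteMeasure μ := ⟨by rw [Measure.restrict_apply_univ]; exact measure_ball_lt_top⟩
  set D := max (R + R') 1 with hD
  have hI : ∀ n, Integrable (H n) := fun n => integrable_of_memLp_two (hH n) (hHs n)
  have hIG : Integrable G := integrable_of_memLp_two hG hGs
  set S : ℝ → (Plane → ℂ) → Plane → ℂ := fun δ h x => ∫ y, h y * truncKernel δ (x - y)
  have hSm : ∀ δ (h : Plane → ℂ), AEStronglyMeasurable h → AEStronglyMeasurable (S δ h) := by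
    intro δ h hh
    have : AEStronglyMeasurable (fun p : Plane × Plane => h p.2 * truncKernel δ (p.1 - p.2))
        (volume.prod volume) :=
      hh.comp_snd.mul ((measurable_truncKernel δ).comp measurable_sub).aestronglyMeasurable
    exact this.integral_prod_right'
  have hce : ∀ δ (h : Plane → ℂ), Integrable h →
      ∀ᵐ x, Integrable (fun y => h y * truncKernel δ (x - y)) := fun δ h hh =>
    hh.ae_convolution_exists (ContinuousLinearMap.mul ℝ ℂ) (integrable_truncKernel δ)
  rw [ENNReal.tendsto_nhds_zero]
  intro ε hε
  -- the singular part of the kernel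
  obtain ⟨δ, hδ0, hδ1, hδ⟩ : ∃ δ > 0, δ ≤ 1 ∧
      (∫⁻ x, ‖truncKernel δ x‖ₑ ^ (4 / 3 : ℝ)) ^ (3 / 4 : ℝ) * (C + eLpNorm G 2 volume) ≤ ε / 2 := by
    have h1 : Tendsto (fun δ : ℝ => ∫⁻ x, ‖truncKernel δ x‖ₑ ^ (4 / 3 : ℝ)) (𝓝[>] 0) (𝓝 0) := by
      have hb : ∫⁻ x, (Metric.ball (0 : Plane) 1).indicator
          (fun x => ‖cauchyKernel x‖ₑ ^ (4 / 3 : ℝ)) x ≠ ⊤ := by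
        rw [lintegral_indicator measurableSet_ball]
        exact (lintegral_ball_cauchyKernel_rpow_lt_top 1 (by norm_num) (by norm_num)).ne
      have hvol : Tendsto (volume ∘ fun δ : ℝ => Metric.ball (0 : Plane) δ) (𝓝[>] 0) (𝓝 0) := by
        have : ∀ δ : ℝ, (volume ∘ fun δ : ℝ => Metric.ball (0 : Plane) δ) δ =
            ENNReal.ofReal δ ^ 2 * volume (Metric.ball (0 : Plane) 1) := by
          intro δ
          simp only [Function.comp]
          rcases le_or_gt δ 0 with h | h
          · simp [Metric.ball_eq_empty.mpr h, ENNReal.ofReal_of_nonpos h]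
          · rw [Measure.addHaar_ball_of_pos volume _ h]
            simp [ENNReal.ofReal_pow h.le]
        rw [show (volume ∘ fun δ : ℝ => Metric.ball (0 : Plane) δ) =
          fun δ => ENNReal.ofReal δ ^ 2 * volume (Metric.ball (0 : Plane) 1) from funext this]
        have h2 : Tendsto (fun δ : ℝ => ENNReal.ofReal δ ^ 2) (𝓝[>] 0) (𝓝 0) := by
          have : Continuous fun δ : ℝ => ENNReal.ofReal δ ^ 2 :=
            (ENNReal.continuous_pow 2).comp ENNReal.continuous_ofReal
          have := (this.tendsto 0).mono_left (nhdsWithin_le_nhds (s := Ioi 0))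
          simpa using this
        have := ENNReal.Tendsto.mul_const h2
          (.inr (measure_ball_lt_top (μ := volume) (x := (0 : Plane)) (r := 1)).ne)
        simpa using this
      have h2 := tendsto_setLIntegral_zero hb hvol
      refine h2.congr' ?_
      filter_upwards [Ioc_mem_nhdsGT (zero_lt_one' ℝ)] with δ hδ
      rw [lintegral_truncKernel δ (by norm_num)]
      apply setLIntegral_congr_fun measurableSet_ball
      intro x hx
      simp only
      rw [indicator_of_mem (Metric.ball_subset_ball hδ.2 hx)]
    have h2 : Tendsto (fun δ : ℝ => (∫⁻ x, ‖truncKernel δ x‖ₑ ^ (4 / 3 : ℝ)) ^ (3 / 4 : ℝ) *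
        (C + eLpNorm G 2 volume)) (𝓝[>] 0) (𝓝 0) := by
      have h3 := ((ENNReal.continuous_rpow_const (y := 3 / 4)).tendsto 0).comp h1
      have h4 := ENNReal.Tendsto.mul_const (b := C + eLpNorm G 2 volume) h3
        (.inr (ENNReal.add_ne_top.mpr ⟨ENNReal.coe_ne_top, hG.2.ne⟩))
      have h5 : (0 : ℝ≥0∞) ^ (3 / 4 : ℝ) * (C + eLpNorm G 2 volume) = 0 := by
        rw [ENNReal.zero_rpow_of_pos (by norm_num), zero_mul]
      rw [h5] at h4
      exact h4
    have h3 := (ENNReal.tendsto_nhds_zero.mp h2) (ε / 2) (ENNReal.half_pos hε.ne')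
    obtain ⟨δ, h4, h5⟩ := (h3.and (Ioc_mem_nhdsGT (zero_lt_one' ℝ))).exists
    exact ⟨δ, h5.1, h5.2, h4⟩
  have hδD : δ ≤ D := hδ1.trans (le_max_right _ _)
  -- the regular part of the kernel
  set r : ℕ → Plane → ℂ := fun n x => (S D (H n) x - S δ (H n) x) - (S D G x - S δ G x)
  -- For fixed `x` the regular part is an integral of `H n` against a fixed `L²` function, so weak
  -- convergence gives pointwise convergence.
  have hr0 : ∀ᵐ x ∂μ, Tendsto (fun n => r n x) atTop (𝓝 0) := by
    have hall := ae_all_iff.mpr fun n => (hce D (H n) (hI n)).and (hce δ (H n) (hI n))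
    apply ae_restrict_of_ae
    filter_upwards [hall, hce D G hIG, hce δ G hIG] with x h1 h2 h3
    have h4 := hw _ (memLp_truncKernel_sub hδ0 hδD x)
    have h5 := h4.sub_const (∫ y, (truncKernel D (x - y) - truncKernel δ (x - y)) * G y)
    rw [sub_self] at h5
    refine h5.congr fun n => ?_
    simp only [r, S]
    rw [← integral_sub (h1 n).1 (h1 n).2, ← integral_sub h2 h3]
    congr 2 <;> · ext y; ring
  set V := volume (Metric.ball (0 : Plane) R) ^ (1 / 2 : ℝ) with hV
  have hVt : V ≠ ⊤ := (ENNReal.rpow_lt_top_of_nonneg (by norm_num) measure_ball_lt_top.ne).ne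
  set M : ℝ≥0∞ := ENNReal.ofReal δ⁻¹ * ((C : ℝ≥0∞) * V) +
    ENNReal.ofReal δ⁻¹ * (eLpNorm G 2 volume * V) with hM
  have hMt : M ≠ ⊤ := by
    simp only [M]
    finiteness [hG.2.ne]
  have hbd : ∀ h : Plane → ℂ, Integrable h → Function.support h ⊆ Metric.ball 0 R →
      ∀ᵐ x, ‖S D h x - S δ h x‖ₑ ≤ ENNReal.ofReal δ⁻¹ * (eLpNorm h 2 volume * V) := by
    intro h hh hs
    filter_upwards [hce D h hh, hce δ h hh] with x h1 h2
    simp only [S]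
    rw [← integral_sub h1 h2]
    refine (enorm_integral_le_lintegral_enorm _).trans ?_
    refine le_trans ?_ (mul_le_mul_right (eLpNorm_one_le hh.1 hs) _)
    rw [eLpNorm_one_eq_lintegral_enorm, ← lintegral_const_mul'' _ hh.1.enorm]
    apply lintegral_mono
    intro y
    simp only
    rw [← mul_sub, enorm_mul, mul_comm]
    gcongr
    rw [← ofReal_norm]
    apply ENNReal.ofReal_le_ofReal
    refine (norm_truncKernel_sub_le hδ0 hδD _).trans ?_
    exact indicator_le_self' (fun _ _ => by positivity) _
  have hrM : ∀ n, ∀ᵐ x ∂μ, ‖r n x‖ₑ ≤ M := by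
    intro n
    apply ae_restrict_of_ae
    filter_upwards [hbd (H n) (hI n) (hHs n), hbd G hIG hGs] with x h1 h2
    refine (enorm_sub_le).trans (add_le_add (h1.trans ?_) h2)
    gcongr
    exact hC n
  -- Dominated convergence: the constant `M` bounds all `r n`, and `μ` is finite.
  have hr : Tendsto (fun n => eLpNorm (r n) 4 μ) atTop (𝓝 0) := by
    have h1 : Tendsto (fun n => ∫⁻ x, ‖r n x‖ₑ ^ (4 : ℝ) ∂μ) atTop (𝓝 (∫⁻ _, 0 ∂μ)) := by
      apply tendsto_lintegral_of_dominated_convergence' (fun _ => M ^ (4 : ℝ))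
      · intro n
        exact ((((hSm D _ (hH n).1).sub (hSm δ _ (hH n).1)).sub
          ((hSm D _ hG.1).sub (hSm δ _ hG.1))).restrict.enorm).pow_const _
      · intro n
        filter_upwards [hrM n] with x hx
        exact ENNReal.rpow_le_rpow hx (by norm_num)
      · rw [lintegral_const]
        exact ENNReal.mul_ne_top (ENNReal.rpow_ne_top_of_nonneg (by norm_num) hMt)
          (measure_ne_top μ _)
      · filter_upwards [hr0] with x hx
        have h2 : Continuous fun z : ℂ => ‖z‖ₑ ^ (4 : ℝ) :=
          ENNReal.continuous_rpow_const.comp continuous_enorm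
        simpa [Function.comp_def] using (h2.tendsto 0).comp hx
    rw [lintegral_zero] at h1
    have h2 := ((ENNReal.continuous_rpow_const (y := 1 / 4)).tendsto 0).comp h1
    rw [ENNReal.zero_rpow_of_pos (by norm_num)] at h2
    refine h2.congr fun n => ?_
    rw [eLpNorm_eq_lintegral_rpow_enorm_toReal (by norm_num) (by norm_num)]
    simp
  have hr' := (ENNReal.tendsto_nhds_zero.mp hr) (ε / 2) (ENNReal.half_pos hε.ne')
  filter_upwards [hr'] with n hn
  -- What remains besides the regular part is the convolution of `H n - G` with the kernel cut off
  -- at `δ`; Young's inequality and the choice of `δ` make its norm at most `ε / 2` for every `n`.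
  have hsplit : (fun x => cauchyTransform (H n) x - cauchyTransform G x) =ᵐ[μ]
      (fun x => r n x) + S δ (fun y => H n y - G y) := by
    have h1 := ae_restrict_of_ae (s := Metric.ball (0 : Plane) R')
      ((hce δ (H n) (hI n)).and (hce δ G hIG))
    filter_upwards [h1, ae_restrict_mem measurableSet_ball] with x h2 hx
    rw [cauchyTransform_eq_truncKernel (le_max_left (R + R') 1) (hHs n) hx,
      cauchyTransform_eq_truncKernel (le_max_left (R + R') 1) hGs hx]
    have : S δ (fun y => H n y - G y) x = S δ (H n) x - S δ G x := by
      simp only [S]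
      rw [← integral_sub h2.1 h2.2]
      congr 1; ext y; ring
    simp only [Pi.add_apply, this, r, S, hD]
    ring
  rw [eLpNorm_congr_ae hsplit]
  have hm1 : AEStronglyMeasurable (r n) μ := (((hSm D _ (hH n).1).sub (hSm δ _ (hH n).1)).sub
          ((hSm D _ hG.1).sub (hSm δ _ hG.1))).restrict
  have hm2 : AEStronglyMeasurable (S δ (fun y => H n y - G y)) μ :=
    (hSm δ _ ((hH n).1.sub hG.1)).restrict
  refine (eLpNorm_add_le hm1 hm2 (by norm_num)).trans ?_
  rw [← ENNReal.add_halves ε]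
  refine add_le_add hn (le_trans ?_ hδ)
  refine (eLpNorm_mono_measure _ Measure.restrict_le_self).trans ?_
  refine (eLpNorm_conv_four_le (measurable_truncKernel δ) ((hH n).1.sub hG.1)).trans ?_
  gcongr
  exact (eLpNorm_sub_le (hH n).1 hG.1 (by norm_num)).trans (by gcongr; exact hC n)

/-! ### The gradient of a Cauchy transform is square integrable -/

theorem pd_comm {u : Plane → ℂ} (hu : ContDiff ℝ ∞ u) (i j : Fin 2) (x : Plane) :
    pd i (pd j u) x = pd j (pd i u) x := by
  have hd : Differentiable ℝ (fderiv ℝ u) :=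
    (hu.fderiv_right (m := ∞) (by simp)).differentiable (by simp)
  have key : ∀ i j : Fin 2, pd i (pd j u) x =
      fderiv ℝ (fderiv ℝ u) x (EuclideanSpace.single i 1) (EuclideanSpace.single j 1) := by
    intro i j
    have h1 := ((ContinuousLinearMap.apply ℝ ℂ (EuclideanSpace.single j (1 : ℝ))).hasFDerivAt
      (x := fderiv ℝ u x)).comp x (hd x).hasFDerivAt
    rw [pd, show pd j u = (ContinuousLinearMap.apply ℝ ℂ (EuclideanSpace.single j (1 : ℝ))) ∘
      fderiv ℝ u from rfl, h1.fderiv]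
    rfl
  rw [key, key]
  exact (hu.contDiffAt.isSymmSndFDerivAt (by
    simp only [minSmoothness_of_isRCLikeNormedField]
    exact WithTop.coe_le_coe.mpr (le_top : (2 : ℕ∞) ≤ ⊤))).eq _ _

theorem pd_star {u : Plane → ℂ} {x : Plane} (hu : DifferentiableAt ℝ u x) (j : Fin 2) :
    pd j (fun y => star (u y)) x = star (pd j u x) := by
  have h1 := (Complex.conjCLE.hasFDerivAt (x := u x)).comp x hu.hasFDerivAt
  rw [pd, show (fun y => star (u y)) = Complex.conjCLE ∘ u from rfl, h1.fderiv]
  rfl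

theorem memLp_of_contDiff {u : Plane → ℂ} (hu : ContDiff ℝ ∞ u) (hc : HasCompactSupport u) :
    MemLp u 2 volume :=
  hu.continuous.memLp_of_hasCompactSupport hc

/-- The elliptic estimate for `∂₁ + i ∂₂`. -/
theorem eLpNorm_pd_le {u : Plane → ℂ} (hu : ContDiff ℝ ∞ u) (hc : HasCompactSupport u)
    (j : Fin 2) : eLpNorm (pd j u) 2 volume ≤ eLpNorm (dbar u) 2 volume := by
  have hp : ∀ i, MemLp (pd i u) 2 volume := fun i =>
    memLp_of_contDiff (contDiff_pd hu i) (hasCompactSupport_pd hc i)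
  have hd : MemLp (dbar u) 2 volume :=
    memLp_of_contDiff (contDiff_dbar hu) (hasCompactSupport_dbar hc)
  set v : Plane → ℂ := fun y => star (u y)
  have hv : ContDiff ℝ ∞ v := Complex.conjCLE.contDiff.comp hu
  have hpv : ∀ i x, pd i v x = star (pd i u x) := fun i x =>
    pd_star (hu.differentiable (by simp) x) i
  -- Two integrations by parts show that `∫ ∂₁u · conj (∂₂u)` equals its own conjugate. Hence the
  -- cross term `2 Im (∂₁u · conj (∂₂u))` in `|dbar u|²` integrates to zero, and `∫ |dbar u|² = ∫
  -- |∇u|²`.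
  have h1 : ∫ x, pd 0 u x * star (pd 1 u x) = ∫ x, pd 1 u x * star (pd 0 u x) := by
    simp only [← hpv]
    rw [integral_mul_pd ((contDiff_pd hu 0).of_le (by simp)) (hv.of_le (by simp))
      (hasCompactSupport_pd hc 0),
      integral_mul_pd ((contDiff_pd hu 1).of_le (by simp)) (hv.of_le (by simp))
      (hasCompactSupport_pd hc 1)]
    simp only [pd_comm hu 1 0]
  have h2 : (∫ x, pd 0 u x * star (pd 1 u x)).im = 0 := by
    have h3 : ∫ x, pd 1 u x * star (pd 0 u x) =
        (starRingEnd ℂ) (∫ x, pd 0 u x * star (pd 1 u x)) := by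
      rw [← integral_conj]
      congr 1; ext x; simp [mul_comm]
    rw [h3] at h1
    exact Complex.conj_eq_iff_im.mp h1.symm
  have hi : Integrable (fun x => pd 0 u x * star (pd 1 u x)) :=
    integrable_mul_of_memLp_two (hp 0) (hp 1).star
  have h3 : ∫ x, (pd 0 u x * star (pd 1 u x)).im = 0 := by
    rw [← h2]; exact integral_im hi
  have h4 : ∫ x, ‖dbar u x‖ ^ 2 = (∫ x, ‖pd 0 u x‖ ^ 2) + ∫ x, ‖pd 1 u x‖ ^ 2 := by
    have hi0 : Integrable (fun x => ‖pd 0 u x‖ ^ 2) := (hp 0).integrable_norm_pow (by norm_num)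
    have hi1 : Integrable (fun x => ‖pd 1 u x‖ ^ 2) := (hp 1).integrable_norm_pow (by norm_num)
    have hi2 : Integrable (fun x => 2 * (pd 0 u x * star (pd 1 u x)).im) := hi.im.const_mul 2
    have : ∀ x, ‖dbar u x‖ ^ 2 =
        (‖pd 0 u x‖ ^ 2 + ‖pd 1 u x‖ ^ 2) + 2 * (pd 0 u x * star (pd 1 u x)).im := by
      intro x
      simp only [dbar, Complex.sq_norm, Complex.normSq_apply, RCLike.star_def, Complex.add_re,
        Complex.add_im, Complex.mul_re, Complex.mul_im, Complex.I_re, Complex.I_im,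
        Complex.conj_re, Complex.conj_im]
      ring
    simp only [this]
    have hi01 : Integrable (fun x => ‖pd 0 u x‖ ^ 2 + ‖pd 1 u x‖ ^ 2) := hi0.add hi1
    rw [integral_add hi01 hi2, integral_add hi0 hi1, integral_const_mul, h3]
    ring
  have h5 : ∫ x, ‖pd j u x‖ ^ 2 ≤ ∫ x, ‖dbar u x‖ ^ 2 := by
    have p0 : 0 ≤ ∫ x, ‖pd 0 u x‖ ^ 2 := integral_nonneg fun x => by positivity
    have p1 : 0 ≤ ∫ x, ‖pd 1 u x‖ ^ 2 := integral_nonneg fun x => by positivity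
    rw [h4]
    fin_cases j
    · exact le_add_of_nonneg_right p1
    · exact le_add_of_nonneg_left p0
  have h6 : ∀ {f : Plane → ℂ}, MemLp f 2 volume →
      eLpNorm f 2 volume = ENNReal.ofReal (∫ x, ‖f x‖ ^ 2) ^ (1 / 2 : ℝ) := by
    intro f hf
    rw [← lintegral_enorm_sq_eq hf, eLpNorm_eq_lintegral_rpow_enorm_toReal (by norm_num) (by norm_num)]
    simp
  rw [h6 (hp j), h6 hd]
  exact ENNReal.rpow_le_rpow (ENNReal.ofReal_le_ofReal h5) (by norm_num)

theorem exists_contDiff_approx {H : Plane → ℂ} {R : ℝ} (hR : 0 < R) (hH : MemLp H 2)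
    (hs : Function.support H ⊆ Metric.ball 0 R) {ε : ℝ} (hε : 0 < ε) :
    ∃ h : Plane → ℂ, ContDiff ℝ ∞ h ∧ HasCompactSupport h ∧
      Function.support h ⊆ Metric.ball 0 (R + 1) ∧
      eLpNorm (fun x => h x - H x) 2 volume ≤ ENNReal.ofReal ε := by
  obtain ⟨g, hgc, hg, hgε⟩ := hH.exist_eLpNorm_sub_le (by norm_num) (by norm_num) hε
  let χ : ContDiffBump (0 : Plane) := ⟨R, R + 1, hR, by simp⟩
  refine ⟨fun x => (χ x : ℂ) * g x, (Complex.ofRealCLM.contDiff.comp χ.contDiff).mul hg,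
    hgc.mul_left, ?_, ?_⟩
  · intro x hx
    rw [← χ.support_eq]
    intro h
    apply hx
    simp [h]
  · refine le_trans (eLpNorm_mono fun x => ?_) hgε
    rw [Pi.sub_apply, norm_sub_rev (H x)]
    by_cases hx : H x = 0
    · rw [hx, sub_zero, sub_zero, norm_mul, Complex.norm_real, Real.norm_of_nonneg χ.nonneg]
      exact mul_le_of_le_one_left (norm_nonneg _) χ.le_one
    · have : χ x = 1 := χ.one_of_mem_closedBall (Metric.ball_subset_closedBall (hs hx))
      simp [this]

/-- One bump is rescaled, so `M` does not depend on `ρ`. Against a function of size `1/ρ` on the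
annulus, `dbar X` produces a term of size `ρ⁻²` on an area of order `ρ²`, whose `L²` norm is of
order `1/ρ`. -/
theorem exists_cutoff : ∃ M : ℝ, 0 ≤ M ∧ ∀ ρ : ℝ, 0 < ρ → ∃ X : Plane → ℂ, ContDiff ℝ ∞ X ∧
    HasCompactSupport X ∧ (∀ x ∈ Metric.ball (0 : Plane) ρ, X x = 1) ∧ (∀ x, ‖X x‖ ≤ 1) ∧
    (∀ x, ‖dbar X x‖ ≤ M / ρ) ∧ ∀ x, dbar X x ≠ 0 → ρ ≤ ‖x‖ ∧ ‖x‖ ≤ 2 * ρ := by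
  let χ : ContDiffBump (0 : Plane) := ⟨1, 2, by norm_num, by norm_num⟩
  set F : Plane → ℂ := fun x => (χ x : ℂ)
  have hF : ContDiff ℝ ∞ F := Complex.ofRealCLM.contDiff.comp χ.contDiff
  have hFc : HasCompactSupport F := χ.hasCompactSupport.comp_left Complex.ofReal_zero
  obtain ⟨M, hM⟩ := (hasCompactSupport_dbar hFc).exists_bound_of_continuous
    (contDiff_dbar hF).continuous
  refine ⟨M, (norm_nonneg _).trans (hM 0), fun ρ hρ => ?_⟩
  set X : Plane → ℂ := fun x => F (ρ⁻¹ • x)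
  have hX : ContDiff ℝ ∞ X := hF.comp (contDiff_const_smul _)
  have hXd : ∀ x, dbar X x = (ρ : ℂ)⁻¹ * dbar F (ρ⁻¹ • x) := by
    intro x
    have : ∀ j, pd j X x = (ρ : ℂ)⁻¹ * pd j F (ρ⁻¹ • x) := by
      intro j
      have h1 : HasFDerivAt F (fderiv ℝ F (ρ⁻¹ • x)) (ρ⁻¹ • x) :=
        (hF.differentiable (by simp) _).hasFDerivAt
      have h2 : HasFDerivAt X _ x := h1.comp x ((hasFDerivAt_id x).const_smul ρ⁻¹)
      simp only [pd]
      rw [h2.fderiv]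
      simp
    simp only [dbar, this]; ring
  have hX1 : ∀ x ∈ Metric.ball (0 : Plane) ρ, X x = 1 := by
    intro x hx
    have : χ (ρ⁻¹ • x) = 1 := by
      apply χ.one_of_mem_closedBall
      rw [mem_closedBall_zero_iff, norm_smul, norm_inv, Real.norm_of_nonneg hρ.le]
      rw [mem_ball_zero_iff] at hx
      change ρ⁻¹ * ‖x‖ ≤ 1
      rw [inv_mul_le_iff₀ hρ]; linarith
    simp [X, F, this]
  refine ⟨X, hX, ?_, hX1, ?_, ?_, ?_⟩
  · exact hFc.comp_smul (inv_ne_zero hρ.ne')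
  · intro x
    simp only [X, F, Complex.norm_real, Real.norm_of_nonneg χ.nonneg]
    exact χ.le_one
  · intro x
    rw [hXd, norm_mul, norm_inv, Complex.norm_real, Real.norm_of_nonneg hρ.le, div_eq_inv_mul]
    gcongr
    exact hM _
  · intro x hx
    constructor
    · by_contra h
      apply hx
      have : X =ᶠ[𝓝 x] fun _ => 1 := by
        filter_upwards [Metric.isOpen_ball.mem_nhds
          (show x ∈ Metric.ball (0 : Plane) ρ by simpa using h)] with y hy using hX1 y hy
      simp [dbar, pd, this.fderiv_eq]
    · by_contra h
      apply hx
      rw [hXd]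
      have h1 : ρ⁻¹ • x ∉ tsupport F := by
        intro h2
        have h3 : ρ⁻¹ • x ∈ tsupport χ := closure_mono (fun y hy => by
          intro h4; apply hy; simp [F, h4]) h2
        rw [χ.tsupport_eq, mem_closedBall_zero_iff, norm_smul, norm_inv,
          Real.norm_of_nonneg hρ.le] at h3
        change ρ⁻¹ * ‖x‖ ≤ 2 at h3
        rw [inv_mul_le_iff₀ hρ] at h3
        linarith
      have h4 : ∀ j, pd j F (ρ⁻¹ • x) = 0 := fun j => by
        by_contra h5
        exact h1 (support_pd_subset F j h5)
      simp [dbar, h4]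

theorem volume_closedBall_rpow_half {r : ℝ} (hr : 0 ≤ r) :
    volume (Metric.closedBall (0 : Plane) r) ^ (1 / 2 : ℝ) =
      ENNReal.ofReal r * volume (Metric.ball (0 : Plane) 1) ^ (1 / 2 : ℝ) := by
  rw [Measure.addHaar_closedBall volume _ hr, ENNReal.mul_rpow_of_nonneg _ _ (by norm_num)]
  congr 1
  simp only [finrank_euclideanSpace, Fintype.card_fin]
  rw [ENNReal.ofReal_pow hr, ← ENNReal.rpow_natCast, ← ENNReal.rpow_mul]
  norm_num

theorem tendsto_integral_mul_of_eLpNorm {μ : Measure Plane} {h : ℕ → Plane → ℂ} {H ψ : Plane → ℂ}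
    (hh : ∀ n, MemLp (h n) 2 μ) (hH : MemLp H 2 μ) (hψ : MemLp ψ 2 μ)
    (hlim : Tendsto (fun n => eLpNorm (fun x => h n x - H x) 2 μ) atTop (𝓝 0)) :
    Tendsto (fun n => ∫ x, h n x * ψ x ∂μ) atTop (𝓝 (∫ x, H x * ψ x ∂μ)) := by
  have hi := fun n => integrable_mul_of_memLp_two (hh n) hψ
  refine tendsto_integral_of_L1' _ (integrable_mul_of_memLp_two hH hψ).1
    (.of_forall hi) ?_
  have h1 : Tendsto (fun n => eLpNorm (fun x => h n x - H x) 2 μ * eLpNorm ψ 2 μ) atTop (𝓝 0) := by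
    have := ENNReal.Tendsto.mul_const (b := eLpNorm ψ 2 μ) hlim (.inr hψ.2.ne)
    simpa using this
  refine tendsto_of_tendsto_of_tendsto_of_le_of_le tendsto_const_nhds h1 (fun _ => zero_le) ?_
  intro n
  have := eLpNorm_smul_le_mul_eLpNorm (p := 2) (q := 2) (r := 1) hψ.1 ((hh n).sub hH).1
  refine le_trans (eLpNorm_mono fun x => ?_) this
  simp [sub_mul]

/-- Smooth `h k` approximate `H` in `L²`, and `u k` is a cutoff of `cauchyTransform (h k)`. The
elliptic estimate bounds `∂ⱼ (u k)` by `dbar (u k) = dbar (X k) · T (h k) + X k · h k`, which is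
bounded in `L²` uniformly in `k`. A weak limit of `∂ⱼ (u k)` is the derivative sought. -/
theorem exists_hasWeakPartial_cauchyTransform {H : Plane → ℂ} {R : ℝ} (hR : 0 < R)
    (hH : MemLp H 2) (hs : Function.support H ⊆ Metric.ball 0 R) (j : Fin 2) :
    ∃ g, HasWeakPartial univ j (cauchyTransform H) g ∧ MemLp g 2 volume := by
  have hex : ∀ k : ℕ, ∃ h : Plane → ℂ, ContDiff ℝ ∞ h ∧ HasCompactSupport h ∧
      Function.support h ⊆ Metric.ball 0 (R + 1) ∧
      eLpNorm (fun x => h x - H x) 2 volume ≤ ENNReal.ofReal (1 / ((k : ℝ) + 1)) :=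
    fun k => exists_contDiff_approx hR hH hs (by positivity)
  choose h hh hhc hhs hhε using hex
  have hh2 : ∀ k, MemLp (h k) 2 volume := fun k => memLp_of_contDiff (hh k) (hhc k)
  have hlim : Tendsto (fun k => eLpNorm (fun x => h k x - H x) 2 volume) atTop (𝓝 0) := by
    have h1 := (ENNReal.continuous_ofReal.tendsto 0).comp tendsto_one_div_add_atTop_nhds_zero_nat
    rw [ENNReal.ofReal_zero] at h1
    exact tendsto_of_tendsto_of_tendsto_of_le_of_le tendsto_const_nhds h1 (fun _ => zero_le) hhε
  have hbd : ∀ k, eLpNorm (h k) 2 volume ≤ eLpNorm H 2 volume + 1 := by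
    intro k
    have e : h k = fun x => (h k x - H x) + H x := by ext x; ring
    calc eLpNorm (h k) 2 volume = eLpNorm (fun x => (h k x - H x) + H x) 2 volume := by rw [← e]
      _ ≤ eLpNorm (fun x => h k x - H x) 2 volume + eLpNorm H 2 volume :=
        eLpNorm_add_le ((hh2 k).1.sub hH.1) hH.1 (by norm_num)
      _ ≤ 1 + eLpNorm H 2 volume := by
        gcongr
        refine (hhε k).trans ?_
        rw [← ENNReal.ofReal_one]
        apply ENNReal.ofReal_le_ofReal
        rw [div_le_one (by positivity)]
        linarith [(Nat.cast_nonneg k : (0 : ℝ) ≤ k)]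
      _ = _ := add_comm _ _
  obtain ⟨M, hM0, hM⟩ := exists_cutoff
  -- At least twice the support radius of `h k`, so that the decay estimate holds on the annulus,
  -- and unbounded, so that the cutoff eventually equals `1` on the support of any test function.
  set ρ : ℕ → ℝ := fun k => 2 * (R + 1) + k
  have hρ : ∀ k, 2 * (R + 1) ≤ ρ k := fun k => by simp [ρ]
  have hρ1 : ∀ k, 1 ≤ ρ k := fun k => by linarith [hρ k]
  choose X hX hXc hX1 hXb hXd hXs using fun k => hM (ρ k) (by linarith [hρ1 k])
  set u : ℕ → Plane → ℂ := fun k x => X k x * cauchyTransform (h k) x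
  have hu : ∀ k, ContDiff ℝ ∞ (u k) := fun k =>
    (hX k).mul (contDiff_cauchyTransform (hh k) (hhc k))
  have huc : ∀ k, HasCompactSupport (u k) := fun k => (hXc k).mul_right
  set A : ℝ≥0∞ := (eLpNorm H 2 volume + 1) * volume (Metric.ball (0 : Plane) (R + 1)) ^ (1 / 2 : ℝ)
  have hAt : A ≠ ⊤ := ENNReal.mul_ne_top (ENNReal.add_ne_top.mpr ⟨hH.2.ne, ENNReal.one_ne_top⟩)
    (ENNReal.rpow_ne_top_of_nonneg (by norm_num) measure_ball_lt_top.ne)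
  have hL1 : ∀ k, ∫ y, ‖h k y‖ ≤ A.toReal := by
    intro k
    rw [integral_norm_eq_lintegral_enorm (hh2 k).1, ← eLpNorm_one_eq_lintegral_enorm]
    apply ENNReal.toReal_mono hAt
    refine (eLpNorm_one_le (hh2 k).1 (hhs k)).trans ?_
    simp only [A]
    gcongr
    exact hbd k
  set B : ℝ≥0∞ := ENNReal.ofReal (2 * M * A.toReal) * volume (Metric.ball (0 : Plane) 1) ^ (1 / 2 : ℝ)
  have hBt : B ≠ ⊤ := ENNReal.mul_ne_top ENNReal.ofReal_ne_top
    (ENNReal.rpow_ne_top_of_nonneg (by norm_num) measure_ball_lt_top.ne)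
  have hdu : ∀ k, eLpNorm (dbar (u k)) 2 volume ≤ B + (eLpNorm H 2 volume + 1) := by
    intro k
    have hTs := contDiff_cauchyTransform (hh k) (hhc k)
    have e : dbar (u k) = fun x => dbar (X k) x * cauchyTransform (h k) x + X k x * h k x := by
      ext x
      rw [dbar_mul ((hX k).differentiable (by simp) x) (hTs.differentiable (by simp) x),
        dbar_cauchyTransform (hh k) (hhc k)]
    rw [e]
    have c1 : Continuous fun x => dbar (X k) x * cauchyTransform (h k) x :=
      (contDiff_dbar (hX k)).continuous.mul hTs.continuous
    have c2 : Continuous fun x => X k x * h k x := (hX k).continuous.mul (hh k).continuous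
    refine (eLpNorm_add_le c1.aestronglyMeasurable c2.aestronglyMeasurable (by norm_num)).trans ?_
    refine add_le_add ?_ ?_
    · have hρ0 : 0 < ρ k := by linarith [hρ1 k]
      set c : ℝ := M / ρ k * (A.toReal * (ρ k)⁻¹) with hc
      have hc0 : 0 ≤ c := by positivity
      have h1 : ∀ x, ‖dbar (X k) x * cauchyTransform (h k) x‖ ≤
          ‖(Metric.closedBall (0 : Plane) (2 * ρ k)).indicator (fun _ => c) x‖ := by
        intro x
        by_cases hx : dbar (X k) x = 0
        · simp [hx]
        · obtain ⟨h2, h3⟩ := hXs k x hx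
          rw [indicator_of_mem (by simpa using h3), Real.norm_of_nonneg hc0, norm_mul]
          have h4 := norm_cauchyTransform_le (by linarith) (hhs k)
            (integrable_of_memLp_two (hh2 k) (hhs k)) ((hρ k).trans h2)
          have h5 : ‖cauchyTransform (h k) x‖ ≤ A.toReal * (ρ k)⁻¹ := by
            refine h4.trans ?_
            have := hL1 k
            gcongr
          have := hXd k x
          rw [hc]
          gcongr
      refine (eLpNorm_mono h1).trans ?_
      rw [eLpNorm_indicator_const measurableSet_closedBall (by norm_num) (by norm_num),
        ENNReal.toReal_ofNat, volume_closedBall_rpow_half (by positivity), ← mul_assoc]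
      simp only [B]
      gcongr
      rw [← ofReal_norm, Real.norm_of_nonneg hc0, ← ENNReal.ofReal_mul hc0]
      apply ENNReal.ofReal_le_ofReal
      have : c * (2 * ρ k) = 2 * M * A.toReal * (ρ k)⁻¹ := by
        rw [hc]; field_simp
      rw [this]
      exact mul_le_of_le_one_right (by positivity) (inv_le_one_of_one_le₀ (hρ1 k))
    · refine le_trans (eLpNorm_mono fun x => ?_) (hbd k)
      rw [norm_mul]
      exact mul_le_of_le_one_left (norm_nonneg _) (hXb k x)
  have hCt : B + (eLpNorm H 2 volume + 1) ≠ ⊤ :=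
    ENNReal.add_ne_top.mpr ⟨hBt, ENNReal.add_ne_top.mpr ⟨hH.2.ne, ENNReal.one_ne_top⟩⟩
  obtain ⟨g, ns, hns, hg, hw⟩ := exists_weakTendsto volume
    (u := fun k => pd j (u k)) (C := (B + (eLpNorm H 2 volume + 1)).toNNReal)
    (fun k => memLp_of_contDiff (contDiff_pd (hu k) j) (hasCompactSupport_pd (huc k) j))
    (fun k => by
      rw [ENNReal.coe_toNNReal hCt]
      exact (eLpNorm_pd_le (hu k) (huc k) j).trans (hdu k))
  refine ⟨g, ⟨?_, ?_, ?_⟩, hg⟩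
  · exact (locallyIntegrable_cauchyTransform hH hs).locallyIntegrableOn _
  · exact (hg.locallyIntegrable (by norm_num)).locallyIntegrableOn _
  intro φ hφ hφc _
  rw [setIntegral_univ, setIntegral_univ]
  set Φ : Plane → ℂ := fun x => (φ x : ℂ)
  have hΦ : ContDiff ℝ ∞ Φ := Complex.ofRealCLM.contDiff.comp hφ
  have hΦc : HasCompactSupport Φ := hφc.comp_left Complex.ofReal_zero
  have hpΦ : ∀ x, pd j Φ x = (partialDeriv j φ x : ℂ) := fun x =>
    pd_ofReal (hφ.differentiable (by simp) x) j
  have hΦ' := contDiff_pd hΦ j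
  have hΦc' := hasCompactSupport_pd hΦc j
  have hTΦ := contDiff_cauchyTransform hΦ' hΦc'
  obtain ⟨R', hR'0, hR'⟩ := exists_tsupport_subset_ball hΦc
  have e1 : ∫ x, partialDeriv j φ x • cauchyTransform H x = ∫ x, cauchyTransform H x * pd j Φ x := by
    congr 1; ext x; rw [hpΦ, Complex.real_smul, mul_comm]
  have e2 : ∫ x, φ x • g x = ∫ x, Φ x * g x := by
    congr 1
  rw [e1, e2]
  -- both sides are limits of the corresponding integrals of the approximations
  set b : Set Plane := Metric.ball 0 (R + 1)
  -- The transform of `∂ⱼ Φ` is paired only with `h k` and `H`, all supported in `b`; restricted to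
  -- `b` it lies in `L²`.
  have hψ : MemLp (b.indicator (cauchyTransform (pd j Φ))) 2 volume := by
    rw [memLp_indicator_iff_restrict measurableSet_ball]
    have : IsFiniteMeasure (volume.restrict b) :=
      ⟨by rw [Measure.restrict_apply_univ]; exact measure_ball_lt_top⟩
    obtain ⟨c, hc⟩ := (isCompact_closedBall (0 : Plane) (R + 1)).exists_bound_of_continuousOn
      hTΦ.continuous.continuousOn
    refine MemLp.of_bound hTΦ.continuous.aestronglyMeasurable c ?_
    filter_upwards [ae_restrict_mem measurableSet_ball] with x hx
    exact hc x (Metric.ball_subset_closedBall hx)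
  have hind : ∀ f : Plane → ℂ, Function.support f ⊆ b →
      ∫ x, f x * b.indicator (cauchyTransform (pd j Φ)) x = ∫ x, f x * cauchyTransform (pd j Φ) x := by
    intro f hf
    congr 1; ext x
    by_cases hx : f x = 0
    · simp [hx]
    · rw [indicator_of_mem (hf hx)]
  have l1 := ((tendsto_integral_mul_of_eLpNorm hh2 hH hψ hlim).comp hns.tendsto_atTop).neg
  rw [hind H (hs.trans (Metric.ball_subset_ball (by linarith))),
    ← integral_cauchyTransform_mul hH hs hΦ'.continuous hΦc'] at l1
  have l2 := (hw Φ (memLp_of_contDiff hΦ hΦc)).neg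
  refine tendsto_nhds_unique (l1.congr' ?_) l2
  have hev : ∀ᶠ n : ℕ in atTop, R' ≤ ρ (ns n) := by
    obtain ⟨N, hN⟩ := exists_nat_ge R'
    filter_upwards [eventually_ge_atTop N] with n hn
    have h1 : (N : ℝ) ≤ ns n := by exact_mod_cast hn.trans (hns.id_le n)
    simp only [ρ]
    linarith
  filter_upwards [hev] with n hn
  simp only [Function.comp]
  rw [hind _ (hhs _), ← integral_cauchyTransform_mul (hh2 _) (hhs _) hΦ'.continuous hΦc',
    integral_mul_pd (hΦ.of_le (by simp)) ((hu (ns n)).of_le (by simp)) hΦc, neg_neg]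
  congr 1; ext x
  by_cases hx : pd j Φ x = 0
  · simp [hx]
  · have h1 := hR' (support_pd_subset Φ j hx)
    simp only [u]
    rw [hX1 _ x (Metric.ball_subset_ball hn h1), one_mul, mul_comm]

/-! ### Primitives of closed one-forms -/

/-- The real numbers with the discrete topology. -/
structure DiscreteReal where
  /-- The underlying real number. -/
  val : ℝ

instance : TopologicalSpace DiscreteReal := ⊥

instance : DiscreteTopology DiscreteReal := ⟨rfl⟩

section Primitive

variable {E : Type*} [NormedAddCommGroup E] [NormedSpace ℝ E]

theorem sub_eq_sub_of_hasFDerivAt {s : Set E} (hs : Convex ℝ s) (hso : IsOpen s) {f g : E → ℝ}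
    {η : E → E →L[ℝ] ℝ} (hf : ∀ x ∈ s, HasFDerivAt f (η x) x) (hg : ∀ x ∈ s, HasFDerivAt g (η x) x)
    {x y : E} (hx : x ∈ s) (hy : y ∈ s) : f x - g x = f y - g y := by
  have h1 : ∀ z ∈ s, HasFDerivAt (fun z => f z - g z) (0 : E →L[ℝ] ℝ) z := by
    intro z hz
    simpa using (hf z hz).fun_sub (hg z hz)
  refine hs.is_const_of_fderivWithin_eq_zero (𝕜 := ℝ) (f := fun z => f z - g z)
    (fun z hz => (h1 z hz).differentiableAt.differentiableWithinAt) (fun z hz => ?_) hx hy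
  rw [fderivWithin_of_isOpen hso hz, (h1 z hz).fderiv]

/-- Local primitives of a one-form on the members of a cover by balls, glued into a covering. -/
def primitiveBundle {Ω : Set E} (r : Ω → ℝ) (hr : ∀ x, 0 < r x) (η : E → E →L[ℝ] ℝ)
    (ξ : Ω → E → ℝ) (hξ : ∀ i : Ω, ∀ x ∈ Metric.ball (i : E) (r i), HasFDerivAt (ξ i) (η x) x) :
    FiberBundleCore Ω Ω DiscreteReal where
  baseSet i := Subtype.val ⁻¹' Metric.ball (i : E) (r i)
  isOpen_baseSet i := Metric.isOpen_ball.preimage continuous_subtype_val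
  indexAt x := x
  mem_baseSet_at x := by simp [hr x]
  coordChange i j x v := ⟨v.val + (ξ i x - ξ j x)⟩
  coordChange_self i x _ v := by simp
  -- Two primitives differ by a constant on the convex overlap of two balls, so the transition map
  -- does not depend on the base point there; it is continuous because the fibre is discrete.
  continuousOn_coordChange i j := by
    rcases ((Subtype.val ⁻¹' Metric.ball (i : E) (r i)) ∩
      (Subtype.val ⁻¹' Metric.ball (j : E) (r j)) : Set Ω).eq_empty_or_nonempty with h | ⟨y, hy⟩
    · rw [h]; simp
    · have : Continuous fun p : Ω × DiscreteReal => (⟨p.2.val + (ξ i y - ξ j y)⟩ : DiscreteReal) :=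
        (continuous_of_discreteTopology (f := fun v : DiscreteReal =>
          (⟨v.val + (ξ i y - ξ j y)⟩ : DiscreteReal))).comp continuous_snd
      refine this.continuousOn.congr fun p hp => ?_
      simp only
      rw [sub_eq_sub_of_hasFDerivAt (s := Metric.ball (i : E) (r i) ∩ Metric.ball (j : E) (r j))
        ((convex_ball _ _).inter (convex_ball _ _)) (Metric.isOpen_ball.inter Metric.isOpen_ball)
        (fun x hx => hξ i x hx.1) (fun x hx => hξ j x hx.2) hp.1 hy]
  coordChange_comp i j k x _ v := by
    simp only [DiscreteReal.mk.injEq]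
    ring

/-- A closed one-form on an open simply connected set has a primitive. -/
theorem exists_hasFDerivAt_of_isSimplyConnected {Ω : Set E} (hΩ : IsOpen Ω)
    (hs : IsSimplyConnected Ω) {η : E → E →L[ℝ] ℝ} (hη : DifferentiableOn ℝ η Ω)
    (hsymm : ∀ a ∈ Ω, ∀ x y, fderiv ℝ η a x y = fderiv ℝ η a y x) :
    ∃ P : E → ℝ, ∀ x ∈ Ω, HasFDerivAt P (η x) x := by
  classical
  have hloc : ∀ i : Ω, ∃ r > 0, ∃ ξ : E → ℝ,
      Metric.ball (i : E) r ⊆ Ω ∧ ∀ x ∈ Metric.ball (i : E) r, HasFDerivAt ξ (η x) x := by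
    intro i
    obtain ⟨r, hr, hb⟩ := Metric.isOpen_iff.mp hΩ i i.2
    obtain ⟨ξ, hξ⟩ := (convex_ball (i : E) r).exists_forall_hasFDerivAt_of_fderiv_symmetric
      Metric.isOpen_ball (hη.mono hb) (fun a ha => hsymm a (hb ha))
    exact ⟨r, hr, ξ, hb, hξ⟩
  choose r hr ξ hb hξ using hloc
  set Z := primitiveBundle r hr η ξ hξ with hZ
  have := hs.simplyConnectedSpace
  have := hΩ.locallyPathConnectedSpace
  obtain ⟨x₀, hx₀⟩ := hs.nonempty
  -- Discrete fibres make the bundle a covering. Over a simply connected, locally path connected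
  -- base the identity lifts, which gives a global section `σ`.
  have hcov : IsCoveringMap (Bundle.TotalSpace.proj : Z.TotalSpace → Ω) :=
    FiberBundle.isCoveringMap (F := DiscreteReal) (E := Z.Fiber)
  obtain ⟨σ, ⟨-, hσ⟩, -⟩ := hcov.existsUnique_continuousMap_lifts (ContinuousMap.id Ω) ⟨x₀, hx₀⟩
    ⟨⟨x₀, hx₀⟩, (⟨0⟩ : DiscreteReal)⟩ rfl
  have hσ1 : ∀ x : Ω, (σ x).1 = x := fun x => congrFun hσ x
  -- The coordinate in chart `i` plus `ξ i` is independent of `i` by the form of `coordChange`, so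
  -- `P` is well defined and is locally a constant plus `ξ i`.
  set P : Ω → ℝ := fun x => DiscreteReal.val (σ x).2 + ξ (σ x).1 x
  refine ⟨fun x => if h : x ∈ Ω then P ⟨x, h⟩ else 0, fun x hx => ?_⟩
  set i : Ω := ⟨x, hx⟩
  have hP : ∀ y : Ω, (y : E) ∈ Metric.ball (i : E) (r i) →
      P y = ((Z.localTriv i) (σ y)).2.val + ξ i y := by
    intro y hy
    rw [Z.localTriv_apply]
    change DiscreteReal.val (σ y).2 + ξ (σ y).1 y =
      DiscreteReal.val (σ y).2 + (ξ (σ y).1 (σ y).1 - ξ i (σ y).1) + ξ i y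
    have : (((σ y).1 : Ω) : E) = y := by rw [hσ1]
    simp only [this]
    ring
  have hcont : ContinuousAt (fun y : Ω => ((Z.localTriv i) (σ y)).2) i := by
    have h1 : ContinuousAt (Z.localTriv i) (σ i) := by
      apply (Z.localTriv i).continuousAt
      rw [(Z.localTriv i).mem_source]
      change (((σ i).1 : Ω) : E) ∈ Metric.ball (i : E) (r i)
      rw [hσ1]
      exact Metric.mem_ball_self (hr i)
    exact (continuous_snd.continuousAt).comp (h1.comp σ.continuous.continuousAt)
  -- A continuous map into a discrete space is locally constant.
  have hconst : ∀ᶠ y : Ω in 𝓝 i, ((Z.localTriv i) (σ y)).2 = ((Z.localTriv i) (σ i)).2 :=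
    hcont.preimage_mem_nhds (t := {((Z.localTriv i) (σ i)).2})
      ((isOpen_discrete _).mem_nhds rfl)
  have hev : (fun x => if h : x ∈ Ω then P ⟨x, h⟩ else 0) =ᶠ[𝓝 x]
      fun y => ((Z.localTriv i) (σ i)).2.val + ξ i y := by
    rw [← hΩ.isOpenEmbedding_subtypeVal.map_nhds_eq i] at *
    rw [EventuallyEq, eventually_map]
    have hball : ∀ᶠ y : Ω in 𝓝 i, (y : E) ∈ Metric.ball (i : E) (r i) :=
      continuous_subtype_val.continuousAt.preimage_mem_nhds (Metric.ball_mem_nhds _ (hr i))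
    filter_upwards [hconst, hball] with y h1 h2
    rw [dif_pos y.2, ← h1]
    exact hP y h2
  exact (HasFDerivAt.const_add _ (hξ i x (Metric.mem_ball_self (hr i)))).congr_of_eventuallyEq hev

end Primitive

/-! ### Weyl's lemma for `∂₁ + i∂₂` -/

theorem memLp_mul_of_support_subset {p : ℝ≥0∞} {Ω : Set Plane} (hΩ : MeasurableSet Ω)
    {c f : Plane → ℂ}
    (hf : MemLp f p (volume.restrict Ω)) (hc : Continuous c) (hcc : HasCompactSupport c)
    (hs : Function.support c ⊆ Ω) : MemLp (fun x => c x * f x) p volume := by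
  have e : (fun x => c x * f x) = Ω.indicator (fun x => c x * f x) := by
    ext x
    by_cases hx : x ∈ Ω
    · rw [indicator_of_mem hx]
    · rw [indicator_of_notMem hx]
      have : c x = 0 := by
        by_contra h
        exact hx (hs h)
      simp [this]
  obtain ⟨M, hM⟩ := hcc.exists_bound_of_continuous hc
  rw [e, memLp_indicator_iff_restrict hΩ]
  refine MemLp.of_le_mul (c := M) hf (hc.aestronglyMeasurable.mul hf.1) (.of_forall fun x => ?_)
  rw [norm_mul]
  exact mul_le_mul_of_nonneg_right (hM x) (norm_nonneg _)

theorem integral_mul_dbar {F φ : Plane → ℂ} (hF : ContDiff ℝ 1 F) (hφ : ContDiff ℝ ∞ φ)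
    (hc : HasCompactSupport φ) : ∫ x, F x * dbar φ x = - ∫ x, dbar F x * φ x := by
  have hφ1 : ContDiff ℝ 1 φ := hφ.of_le (by simp)
  have h : ∀ j, ∫ x, F x * pd j φ x = - ∫ x, pd j F x * φ x := by
    intro j
    have := integral_mul_pd hφ1 hF hc j
    rw [show (fun x => F x * pd j φ x) = fun x => pd j φ x * F x from funext fun x => mul_comm _ _,
      show (fun x => pd j F x * φ x) = fun x => φ x * pd j F x from funext fun x => mul_comm _ _,
      this, neg_neg]
  have hi : ∀ j, Integrable fun x => F x * pd j φ x := fun j =>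
    (hF.continuous.mul (contDiff_pd hφ j).continuous).integrable_of_hasCompactSupport
      (hasCompactSupport_pd hc j).mul_left
  have hi' : ∀ j, Integrable fun x => pd j F x * φ x := fun j =>
    (((hF.continuous_fderiv one_ne_zero).clm_apply continuous_const).mul
      hφ.continuous).integrable_of_hasCompactSupport hc.mul_left
  have e1 : ∫ x, F x * dbar φ x = (∫ x, F x * pd 0 φ x) + Complex.I * ∫ x, F x * pd 1 φ x := by
    rw [← integral_const_mul, ← integral_add (hi 0) ((hi 1).const_mul _)]
    congr 1; ext x; simp only [dbar]; ring
  have e2 : ∫ x, dbar F x * φ x = (∫ x, pd 0 F x * φ x) + Complex.I * ∫ x, pd 1 F x * φ x := by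
    rw [← integral_const_mul, ← integral_add (hi' 0) ((hi' 1).const_mul _)]
    congr 1; ext x; simp only [dbar]; ring
  rw [e1, e2, h 0, h 1]
  ring

theorem contDiffAt_cauchyKernel {z : Plane} (hz : z ≠ 0) : ContDiffAt ℝ ∞ cauchyKernel z := by
  unfold cauchyKernel
  apply ContDiffAt.inv
  · exact contDiffAt_const.mul planeToComplex.toContinuousLinearEquiv.contDiff.contDiffAt
  · simp [hz, Real.pi_ne_zero]

/-- A smooth compactly supported function which agrees with the Cauchy kernel on an annulus. -/
theorem exists_smooth_kernel {a b : ℝ} (ha : 0 < a) (hab : a ≤ b) :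
    ∃ k : Plane → ℂ, ContDiff ℝ ∞ k ∧ HasCompactSupport k ∧
      ∀ z, a ≤ ‖z‖ → ‖z‖ ≤ b → k z = cauchyKernel z := by
  let W : ContDiffBump (0 : Plane) := ⟨a / 2, a, by positivity, by linarith⟩
  let Y : ContDiffBump (0 : Plane) := ⟨b, b + 1, by linarith, by linarith⟩
  refine ⟨fun z => ((Y z - W z : ℝ) : ℂ) * cauchyKernel z, ?_, ?_, ?_⟩
  · rw [contDiff_iff_contDiffAt]
    intro z
    by_cases hz : z = 0
    · have : (fun z => ((Y z - W z : ℝ) : ℂ) * cauchyKernel z) =ᶠ[𝓝 z] fun _ => 0 := by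
        filter_upwards [Metric.ball_mem_nhds z (show 0 < a / 2 by positivity)] with y hy
        rw [hz] at hy
        have h1 : W y = 1 := W.one_of_mem_closedBall (Metric.ball_subset_closedBall hy)
        have h2 : Y y = 1 := Y.one_of_mem_closedBall
          (Metric.closedBall_subset_closedBall (show a / 2 ≤ b by linarith)
            (Metric.ball_subset_closedBall hy))
        simp [h1, h2]
      exact contDiffAt_const.congr_of_eventuallyEq this
    · exact (Complex.ofRealCLM.contDiff.comp (Y.contDiff.sub W.contDiff)).contDiffAt.mul
        (contDiffAt_cauchyKernel hz)
  · exact ((Y.hasCompactSupport.sub W.hasCompactSupport).comp_left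
      (g := fun t : ℝ => (t : ℂ)) Complex.ofReal_zero).mul_right
  · intro z h1 h2
    have e1 : Y z = 1 := Y.one_of_mem_closedBall (by simpa using h2)
    have e2 : W z = 0 := W.zero_of_le_dist (by simpa using h1)
    simp [e1, e2]

/-- **Weyl's lemma** for `∂₁ + i ∂₂`, local form. -/
theorem exists_contDiff_ae_eq_ball {Ω : Set Plane} (hΩ : IsOpen Ω) {f : Plane → ℂ}
    (hf : MemLp f 2 (volume.restrict Ω))
    (hw : ∀ φ : Plane → ℂ, ContDiff ℝ ∞ φ → HasCompactSupport φ → tsupport φ ⊆ Ω →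
      ∫ x, f x * dbar φ x = 0) {x₀ : Plane} (hx₀ : x₀ ∈ Ω) :
    ∃ r > 0, ∃ F : Plane → ℂ, Metric.ball x₀ r ⊆ Ω ∧ ContDiff ℝ ∞ F ∧
      ∀ᵐ x, x ∈ Metric.ball x₀ r → f x = F x := by
  obtain ⟨ε, hε, hb⟩ := Metric.isOpen_iff.mp hΩ x₀ hx₀
  set r := ε / 4 with hr
  have hr0 : 0 < r := by positivity
  let χ : ContDiffBump x₀ := ⟨2 * r, 3 * r, by positivity, by linarith⟩
  set X : Plane → ℂ := fun x => (χ x : ℂ)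
  have hX : ContDiff ℝ ∞ X := Complex.ofRealCLM.contDiff.comp χ.contDiff
  have hXc : HasCompactSupport X := χ.hasCompactSupport.comp_left Complex.ofReal_zero
  have htX : tsupport X ⊆ Metric.closedBall x₀ (3 * r) := by
    refine (closure_mono ?_).trans χ.tsupport_eq.subset
    intro y hy h
    apply hy
    simp [X, h]
  have hXΩ : tsupport X ⊆ Ω :=
    htX.trans ((Metric.closedBall_subset_ball (by rw [hr]; linarith)).trans hb)
  have hX1 : ∀ x ∈ Metric.ball x₀ (2 * r), X x = 1 := by
    intro x hx
    have : χ x = 1 := χ.one_of_mem_closedBall (Metric.ball_subset_closedBall hx)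
    simp [X, this]
  have hdX : ∀ x, dbar X x ≠ 0 → 2 * r ≤ dist x x₀ ∧ dist x x₀ ≤ 3 * r := by
    intro x hx
    constructor
    · by_contra h
      apply hx
      have : X =ᶠ[𝓝 x] fun _ => 1 := by
        filter_upwards [Metric.isOpen_ball.mem_nhds
          (show x ∈ Metric.ball x₀ (2 * r) by simpa using h)] with y hy using hX1 y hy
      simp [dbar, pd, this.fderiv_eq]
    · by_contra h
      apply hx
      have h4 : ∀ j, pd j X x = 0 := fun j => by
        by_contra h5
        exact h (by simpa using htX (support_pd_subset X j h5))
      simp [dbar, h4]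
  have hdXs : Function.support (dbar X) ⊆ Ω := fun x hx => by
    apply hb
    rw [Metric.mem_ball]
    have := (hdX x hx).2
    linarith
  set u : Plane → ℂ := fun x => X x * f x
  set g : Plane → ℂ := fun x => dbar X x * f x
  have hu : MemLp u 2 volume := memLp_mul_of_support_subset hΩ.measurableSet hf hX.continuous hXc
    ((subset_tsupport X).trans hXΩ)
  have hg : MemLp g 2 volume := memLp_mul_of_support_subset hΩ.measurableSet hf
    (contDiff_dbar hX).continuous (hasCompactSupport_dbar hXc) hdXs
  set R := ‖x₀‖ + 4 * r
  have hball : ∀ x, dist x x₀ ≤ 3 * r → x ∈ Metric.ball (0 : Plane) R := by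
    intro x hx
    rw [mem_ball_zero_iff]
    have := norm_le_norm_add_norm_sub' x x₀
    rw [← dist_eq_norm] at this
    simp only [R]; linarith
  have hus : Function.support u ⊆ Metric.ball 0 R := by
    intro x hx
    apply hball
    exact htX (subset_tsupport X (left_ne_zero_of_mul hx))
  have hgs : Function.support g ⊆ Metric.ball 0 R := by
    intro x hx
    exact hball x (hdX x (left_ne_zero_of_mul hx)).2
  have hae := ae_eq_cauchyTransform (hu.locallyIntegrable (by norm_num)) hus hg hgs (by
    intro φ hφ hφc
    have h1 := hw (fun x => X x * φ x) (hX.mul hφ) hXc.mul_right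
      ((tsupport_mul_subset_left).trans hXΩ)
    have hi1 : Integrable fun x => u x * dbar φ x :=
      integrable_mul_of_memLp_two hu (memLp_of_contDiff (contDiff_dbar hφ) (hasCompactSupport_dbar hφc))
    have hi2 : Integrable fun x => g x * φ x :=
      integrable_mul_of_memLp_two hg (memLp_of_contDiff hφ hφc)
    rw [eq_neg_iff_add_eq_zero, ← integral_add hi1 hi2, ← h1]
    congr 1; ext x
    rw [dbar_mul (hX.differentiable (by simp) x) (hφ.differentiable (by simp) x)]
    simp only [u, g]; ring)
  -- By now `u = X f` is the transform of `g = dbar X · f`, which lives on the annulus `2r ≤ |y -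
  -- x₀| ≤ 3r`. For `x` within `r` of `x₀` this forces `r ≤ |x - y| ≤ 4r`, so the kernel may be
  -- replaced by a smooth one and the convolution is smooth.
  obtain ⟨k, hk, hkc, hke⟩ := exists_smooth_kernel hr0 (show r ≤ 4 * r by linarith)
  refine ⟨r, hr0, convolution g k (ContinuousLinearMap.mul ℝ ℂ) volume, ?_, ?_, ?_⟩
  · exact (Metric.ball_subset_ball (by rw [hr]; linarith)).trans hb
  · exact hkc.contDiff_convolution_right (n := ⊤) _ (hg.locallyIntegrable (by norm_num)) hk
  · filter_upwards [hae] with x hx hxr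
    have h1 : u x = f x := by
      simp only [u]
      rw [hX1 x (Metric.ball_subset_ball (by linarith) hxr), one_mul]
    rw [← h1, hx, cauchyTransform, convolution]
    congr 1; ext y
    rw [ContinuousLinearMap.mul_apply']
    by_cases hy : g y = 0
    · simp [hy]
    · obtain ⟨h2, h3⟩ := hdX y (left_ne_zero_of_mul hy)
      rw [Metric.mem_ball] at hxr
      rw [hke]
      · rw [← dist_eq_norm]
        have := dist_triangle_left y x₀ x
        linarith
      · rw [← dist_eq_norm]
        have := dist_triangle_right x y x₀
        linarith

/-- **Weyl's lemma** for `∂₁ + i ∂₂`. -/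
theorem exists_contDiffOn_ae_eq {Ω : Set Plane} (hΩ : IsOpen Ω) {f : Plane → ℂ}
    (hf : MemLp f 2 (volume.restrict Ω))
    (hw : ∀ φ : Plane → ℂ, ContDiff ℝ ∞ φ → HasCompactSupport φ → tsupport φ ⊆ Ω →
      ∫ x, f x * dbar φ x = 0) :
    ∃ F : Plane → ℂ, ContDiffOn ℝ ∞ F Ω ∧ (∀ᵐ x, x ∈ Ω → f x = F x) ∧ ∀ x ∈ Ω, dbar F x = 0 := by
  classical
  have hloc := fun x : Ω => exists_contDiff_ae_eq_ball hΩ hf hw x.2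
  choose r hr G hb hG hae using hloc
  -- Continuous functions that agree almost everywhere on an open set agree on it, so the local
  -- representatives glue.
  have heq : ∀ i j : Ω, ∀ x ∈ Metric.ball (i : Plane) (r i) ∩ Metric.ball (j : Plane) (r j),
      G i x = G j x := by
    intro i j
    apply Measure.eqOn_open_of_ae_eq (μ := volume) ?_
      (Metric.isOpen_ball.inter Metric.isOpen_ball) (hG i).continuous.continuousOn
      (hG j).continuous.continuousOn
    filter_upwards [ae_restrict_of_ae (hae i), ae_restrict_of_ae (hae j),
      ae_restrict_mem (Metric.isOpen_ball.inter Metric.isOpen_ball).measurableSet] with x h1 h2 h3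
    rw [← h1 h3.1, h2 h3.2]
  set F : Plane → ℂ := fun x => if h : x ∈ Ω then G ⟨x, h⟩ x else 0
  have hF : ∀ i : Ω, ∀ x ∈ Metric.ball (i : Plane) (r i), F x = G i x := by
    intro i x hx
    have hxΩ := hb i hx
    simp only [F, dif_pos hxΩ]
    exact heq _ _ x ⟨Metric.mem_ball_self (hr ⟨x, hxΩ⟩), hx⟩
  have hFe : ∀ i : Ω, F =ᶠ[𝓝 (i : Plane)] G i := fun i => by
    filter_upwards [Metric.ball_mem_nhds (i : Plane) (hr i)] with y hy using hF i y hy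
  refine ⟨F, ?_, ?_, ?_⟩
  · intro x hx
    exact ((hG ⟨x, hx⟩).contDiffAt.congr_of_eventuallyEq (hFe ⟨x, hx⟩)).contDiffWithinAt
  · rw [ae_iff]
    apply measure_null_of_locally_null
    intro x hx
    simp only [mem_ofPred_eq, Classical.not_imp] at hx
    have h1 := hae ⟨x, hx.1⟩
    rw [ae_iff] at h1
    refine ⟨_, inter_mem_nhdsWithin _ (Metric.ball_mem_nhds x (hr ⟨x, hx.1⟩)), ?_⟩
    refine measure_mono_null ?_ h1
    rintro y ⟨hy1, hy2⟩
    simp only [mem_ofPred_eq, Classical.not_imp] at hy1 ⊢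
    refine ⟨hy2, ?_⟩
    rw [← hF ⟨x, hx.1⟩ y hy2]
    exact hy1.2
  · intro x hx
    set i : Ω := ⟨x, hx⟩
    have h0 : ∀ᵐ y, y ∈ Metric.ball (i : Plane) (r i) → dbar (G i) y = 0 := by
      apply Metric.isOpen_ball.ae_eq_zero_of_integral_contDiff_smul_eq_zero
      · exact ((contDiff_dbar (hG i)).continuous.locallyIntegrable).locallyIntegrableOn _
      · intro φ hφ hφc hφs
        set Φ : Plane → ℂ := fun x => (φ x : ℂ)
        have hΦ : ContDiff ℝ ∞ Φ := Complex.ofRealCLM.contDiff.comp hφ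
        have hΦc : HasCompactSupport Φ := hφc.comp_left Complex.ofReal_zero
        have hΦs : tsupport Φ ⊆ Metric.ball (i : Plane) (r i) := by
          refine (closure_mono ?_).trans hφs
          intro y hy h
          apply hy
          simp [Φ, h]
        have h1 := hw Φ hΦ hΦc (hΦs.trans (hb i))
        have h2 : ∫ x, f x * dbar Φ x = ∫ x, G i x * dbar Φ x := by
          apply integral_congr_ae
          filter_upwards [hae i] with y hy
          by_cases hy' : y ∈ Metric.ball (i : Plane) (r i)
          · rw [hy hy']
          · have : dbar Φ y = 0 := by
              have h4 : ∀ j, pd j Φ y = 0 := fun j => by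
                by_contra h5
                exact hy' (hΦs (support_pd_subset Φ j h5))
              simp [dbar, h4]
            simp [this]
        rw [h2, integral_mul_dbar ((hG i).of_le (by simp)) hΦ hΦc, neg_eq_zero] at h1
        rw [← h1]
        congr 1; ext y
        rw [Complex.real_smul, mul_comm]
    have h1 : EqOn (dbar (G i)) (fun _ => 0) (Metric.ball (i : Plane) (r i)) := by
      apply Measure.eqOn_open_of_ae_eq (μ := volume) ?_ Metric.isOpen_ball
        (contDiff_dbar (hG i)).continuous.continuousOn continuousOn_const
      filter_upwards [ae_restrict_of_ae h0, ae_restrict_mem measurableSet_ball] with y h2 h3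
      exact h2 h3
    have h2 : dbar F x = dbar (G i) x := by
      simp only [dbar, pd, (hFe i).fderiv_eq, i]
    rw [h2]
    exact h1 (Metric.mem_ball_self (hr i))

/-! ### Calculus of weak derivatives -/

section WeakCalculus

variable {F G : Type*} [NormedAddCommGroup F] [NormedSpace ℝ F] [NormedAddCommGroup G]
  [NormedSpace ℝ G] {Ω : Set Plane} {j : Fin 2}

theorem notMem_support_partialDeriv {φ : Plane → ℝ} {x : Plane} (hx : x ∉ tsupport φ) :
    partialDeriv j φ x = 0 := by
  by_contra h
  exact hx (support_pd_subset φ j h)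

theorem LocallyIntegrableOn.clm_comp' {f : Plane → F} (hf : LocallyIntegrableOn f Ω)
    (L : F →L[ℝ] G) : LocallyIntegrableOn (fun x => L (f x)) Ω := by
  intro x hx
  obtain ⟨s, hs, hi⟩ := hf x hx
  exact ⟨s, hs, L.integrable_comp hi⟩

theorem integrableOn_smul_test {u : Plane → F} (hu : LocallyIntegrableOn u Ω) {φ : Plane → ℝ}
    (hφ : Continuous φ) (hc : HasCompactSupport φ) (hs : tsupport φ ⊆ Ω) :
    IntegrableOn (fun x => φ x • u x) Ω := by
  have h2 : IntegrableOn (fun x => φ x • u x) (tsupport φ) :=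
    (hu.integrableOn_compact_subset hs hc).continuousOn_smul hφ.continuousOn hc
  have h3 : Integrable (fun x => φ x • u x) := by
    rw [← integrableOn_iff_integrable_of_support_subset (s := tsupport φ)]
    · exact h2
    · intro x hx
      by_contra hx'
      exact hx (by simp [image_eq_zero_of_notMem_tsupport hx'])
  exact h3.integrableOn

theorem tsupport_partialDeriv_subset (φ : Plane → ℝ) : tsupport (partialDeriv j φ) ⊆ tsupport φ :=
  closure_minimal (support_pd_subset φ j) (isClosed_tsupport φ)

theorem integrableOn_partialDeriv_smul {u : Plane → F} (hu : LocallyIntegrableOn u Ω)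
    {φ : Plane → ℝ} (hφ : ContDiff ℝ ∞ φ) (hc : HasCompactSupport φ) (hs : tsupport φ ⊆ Ω)
    (j : Fin 2) : IntegrableOn (fun x => partialDeriv j φ x • u x) Ω :=
  integrableOn_smul_test hu (contDiff_pd hφ j).continuous (hasCompactSupport_pd hc j)
    ((tsupport_partialDeriv_subset (j := j) φ).trans hs)

theorem integrableOn_mul_test {u : Plane → ℂ} (hu : LocallyIntegrableOn u Ω) {φ : Plane → ℂ}
    (hφ : Continuous φ) (hc : HasCompactSupport φ) (hs : tsupport φ ⊆ Ω) :
    IntegrableOn (fun x => φ x * u x) Ω := by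
  have h2 : IntegrableOn (fun x => φ x * u x) (tsupport φ) :=
    (hu.integrableOn_compact_subset hs hc).continuousOn_mul hφ.continuousOn hc
  have h3 : Integrable (fun x => φ x * u x) := by
    rw [← integrableOn_iff_integrable_of_support_subset (s := tsupport φ)]
    · exact h2
    · intro x hx
      by_contra hx'
      exact hx (by simp [image_eq_zero_of_notMem_tsupport hx'])
  exact h3.integrableOn

theorem HasWeakPartial.clm_comp [CompleteSpace F] [CompleteSpace G] {f g : Plane → F}
    (h : HasWeakPartial Ω j f g) (L : F →L[ℝ] G) :
    HasWeakPartial Ω j (fun x => L (f x)) (fun x => L (g x)) := by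
  refine ⟨LocallyIntegrableOn.clm_comp' h.1 L, LocallyIntegrableOn.clm_comp' h.2 L, ?_⟩
  intro φ hφ hc hs
  have h1 := integrableOn_smul_test h.1 (contDiff_pd hφ j).continuous (hasCompactSupport_pd hc j)
    ((tsupport_partialDeriv_subset (j := j) φ).trans hs)
  have h2 := integrableOn_smul_test h.2 hφ.continuous hc hs
  have e1 := L.integral_comp_comm h1
  have e2 := L.integral_comp_comm h2
  simp only [map_smul] at e1 e2
  rw [e2, ← map_neg, ← h.integral_eq φ hφ hc hs]
  exact e1

theorem HasWeakPartial.add {f g f' g' : Plane → F}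
    (h : HasWeakPartial Ω j f g) (h' : HasWeakPartial Ω j f' g') :
    HasWeakPartial Ω j (fun x => f x + f' x) (fun x => g x + g' x) := by
  refine ⟨h.1.add h'.1, h.2.add h'.2, ?_⟩
  intro φ hφ hc hs
  simp only [smul_add]
  rw [integral_add (integrableOn_partialDeriv_smul h.1 hφ hc hs j)
      (integrableOn_partialDeriv_smul h'.1 hφ hc hs j),
    integral_add (integrableOn_smul_test h.2 hφ.continuous hc hs)
      (integrableOn_smul_test h'.2 hφ.continuous hc hs),
    h.integral_eq φ hφ hc hs, h'.integral_eq φ hφ hc hs]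
  abel

theorem HasWeakPartial.mono {Ω' : Set Plane} {f g : Plane → F}
    (h : HasWeakPartial Ω j f g) (hsub : Ω' ⊆ Ω) : HasWeakPartial Ω' j f g := by
  refine ⟨h.1.mono_set hsub, h.2.mono_set hsub, ?_⟩
  intro φ hφ hc hs
  have key : ∀ (ψ : Plane → ℝ) (u : Plane → F), (∀ x ∉ tsupport φ, ψ x = 0) →
      ∫ x in Ω', ψ x • u x = ∫ x in Ω, ψ x • u x := by
    intro ψ u hψ
    rw [setIntegral_eq_integral_of_forall_compl_eq_zero, setIntegral_eq_integral_of_forall_compl_eq_zero]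
    · intro x hx
      rw [hψ x (fun h => hx (hsub (hs h))), zero_smul]
    · intro x hx
      rw [hψ x (fun h => hx (hs h)), zero_smul]
  rw [key _ _ fun x hx => notMem_support_partialDeriv hx,
    key _ _ fun x hx => image_eq_zero_of_notMem_tsupport hx]
  exact h.integral_eq φ hφ hc (hs.trans hsub)

theorem LocallyIntegrableOn.congr_ae {E : Type*} [NormedAddCommGroup E] {f f' : Plane → E}
    (hΩ : MeasurableSet Ω)
    (h : LocallyIntegrableOn f Ω) (hff' : ∀ᵐ x, x ∈ Ω → f x = f' x) : LocallyIntegrableOn f' Ω := by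
  intro x hx
  obtain ⟨s, hs, hi⟩ := h x hx
  obtain ⟨t, ht, htx, hts⟩ := mem_nhdsWithin.mp hs
  refine ⟨t ∩ Ω, Filter.inter_mem (mem_nhdsWithin_of_mem_nhds (ht.mem_nhds htx))
    self_mem_nhdsWithin, (hi.mono_set hts).congr ?_⟩
  filter_upwards [ae_restrict_of_ae hff', ae_restrict_mem (ht.measurableSet.inter hΩ)] with y h1 h2
  exact h1 h2.2

theorem HasWeakPartial.congr_ae {f g f' g' : Plane → F} (hΩ : MeasurableSet Ω)
    (h : HasWeakPartial Ω j f g) (hf : ∀ᵐ x, x ∈ Ω → f x = f' x) (hg : ∀ᵐ x, x ∈ Ω → g x = g' x) :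
    HasWeakPartial Ω j f' g' := by
  refine ⟨LocallyIntegrableOn.congr_ae hΩ h.1 hf, LocallyIntegrableOn.congr_ae hΩ h.2 hg, ?_⟩
  intro φ hφ hc hs
  have e1 : ∫ x in Ω, partialDeriv j φ x • f' x = ∫ x in Ω, partialDeriv j φ x • f x := by
    apply setIntegral_congr_ae hΩ
    filter_upwards [hf] with x hx hx'
    rw [hx hx']
  have e2 : ∫ x in Ω, φ x • g' x = ∫ x in Ω, φ x • g x := by
    apply setIntegral_congr_ae hΩ
    filter_upwards [hg] with x hx hx'
    rw [hx hx']
  rw [e1, e2]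
  exact h.integral_eq φ hφ hc hs

/-- Complex-valued test functions may be used. -/
theorem HasWeakPartial.integral_mul_eq {f g : Plane → ℂ} (h : HasWeakPartial Ω j f g)
    {Φ : Plane → ℂ} (hΦ : ContDiff ℝ ∞ Φ) (hc : HasCompactSupport Φ) (hs : tsupport Φ ⊆ Ω) :
    ∫ x in Ω, pd j Φ x * f x = - ∫ x in Ω, Φ x * g x := by
  have key : ∀ (L : ℂ →L[ℝ] ℝ), ContDiff ℝ ∞ (fun x => L (Φ x)) ∧
      HasCompactSupport (fun x => L (Φ x)) ∧ tsupport (fun x => L (Φ x)) ⊆ Ω ∧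
      ∀ x, partialDeriv j (fun x => L (Φ x)) x = L (pd j Φ x) := by
    intro L
    refine ⟨L.contDiff.comp hΦ, hc.comp_left (map_zero L), ?_, ?_⟩
    · refine (closure_mono ?_).trans hs
      intro y hy h
      apply hy
      simp [h]
    · intro x
      have := (L.hasFDerivAt (x := Φ x)).comp x (hΦ.differentiable (by simp) x).hasFDerivAt
      rw [partialDeriv, show (fun x => L (Φ x)) = L ∘ Φ from rfl, this.fderiv]
      rfl
  obtain ⟨a1, a2, a3, a4⟩ := key Complex.reCLM
  obtain ⟨b1, b2, b3, b4⟩ := key Complex.imCLM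
  have ha := h.integral_eq _ a1 a2 a3
  have hb := h.integral_eq _ b1 b2 b3
  have i1 := integrableOn_partialDeriv_smul h.1 a1 a2 a3 j
  have i2 := integrableOn_partialDeriv_smul h.1 b1 b2 b3 j
  have i3 := integrableOn_smul_test h.2 a1.continuous a2 a3
  have i4 := integrableOn_smul_test h.2 b1.continuous b2 b3
  have e1 : ∫ x in Ω, pd j Φ x * f x =
      (∫ x in Ω, partialDeriv j (fun x => Complex.reCLM (Φ x)) x • f x) +
        Complex.I * ∫ x in Ω, partialDeriv j (fun x => Complex.imCLM (Φ x)) x • f x := by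
    rw [← integral_const_mul, ← integral_add i1 (i2.const_mul _)]
    congr 1; ext x
    rw [a4, b4]
    conv_lhs => rw [← Complex.re_add_im (pd j Φ x)]
    simp only [Complex.real_smul, Complex.reCLM_apply, Complex.imCLM_apply]
    ring
  have e2 : ∫ x in Ω, Φ x * g x =
      (∫ x in Ω, Complex.reCLM (Φ x) • g x) +
        Complex.I * ∫ x in Ω, Complex.imCLM (Φ x) • g x := by
    rw [← integral_const_mul, ← integral_add i3 (i4.const_mul _)]
    congr 1; ext x
    conv_lhs => rw [← Complex.re_add_im (Φ x)]
    simp only [Complex.real_smul, Complex.reCLM_apply, Complex.imCLM_apply]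
    ring
  rw [e1, e2, ha, hb]
  ring

theorem hasWeakPartial_of_contDiff {f : Plane → ℂ} (hf : ContDiff ℝ 1 f) (Ω : Set Plane) (j : Fin 2) :
    HasWeakPartial Ω j f (pd j f) := by
  have hc : Continuous (pd j f) := (hf.continuous_fderiv one_ne_zero).clm_apply continuous_const
  refine HasWeakPartial.mono (Ω := univ) ⟨hf.continuous.locallyIntegrable.locallyIntegrableOn _,
    hc.locallyIntegrable.locallyIntegrableOn _, ?_⟩ (subset_univ _)
  intro φ hφ hφc _
  rw [setIntegral_univ, setIntegral_univ]
  have := integral_mul_pd (f := fun x => (φ x : ℂ))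
    (Complex.ofRealCLM.contDiff.comp (hφ.of_le (by simp))) hf
    (hφc.comp_left Complex.ofReal_zero) j
  simp only [Complex.real_smul]
  rw [this, neg_neg]
  congr 1; ext x
  rw [pd_ofReal (hφ.differentiable (by simp) x)]
  rfl

theorem contDiff_mul_of_tsupport_subset {Ω : Set Plane} (hΩ : IsOpen Ω) {φ U : Plane → ℂ}
    (hφ : ContDiff ℝ ∞ φ) (hs : tsupport φ ⊆ Ω) (hU : ContDiffOn ℝ ∞ U Ω) :
    ContDiff ℝ ∞ (fun x => φ x * U x) := by
  rw [contDiff_iff_contDiffAt]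
  intro x
  by_cases hx : x ∈ Ω
  · exact hφ.contDiffAt.mul (hU.contDiffAt (hΩ.mem_nhds hx))
  · have : (fun x => φ x * U x) =ᶠ[𝓝 x] fun _ => 0 := by
      filter_upwards [(isClosed_tsupport φ).isOpen_compl.mem_nhds (fun h => hx (hs h))] with y hy
      rw [image_eq_zero_of_notMem_tsupport hy, zero_mul]
    exact contDiffAt_const.congr_of_eventuallyEq this

/-- Leibniz rule for the product of a smooth and a weakly differentiable function. -/
theorem HasWeakPartial.contDiffOn_mul {Ω : Set Plane} (hΩ : IsOpen Ω) {v g U : Plane → ℂ}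
    (h : HasWeakPartial Ω j v g) (hU : ContDiffOn ℝ ∞ U Ω) :
    HasWeakPartial Ω j (fun x => U x * v x) (fun x => U x * g x + pd j U x * v x) := by
  have hUd : ContDiffOn ℝ ∞ (pd j U) Ω := by
    have : ContDiffOn ℝ ∞ (fderiv ℝ U) Ω := hU.fderiv_of_isOpen hΩ (by simp)
    exact this.clm_apply contDiffOn_const
  have l1 : LocallyIntegrableOn (fun x => U x * v x) Ω :=
    h.1.continuousOn_mul hU.continuousOn hΩ.isLocallyClosed
  have l2 : LocallyIntegrableOn (fun x => U x * g x) Ω :=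
    h.2.continuousOn_mul hU.continuousOn hΩ.isLocallyClosed
  have l3 : LocallyIntegrableOn (fun x => pd j U x * v x) Ω :=
    h.1.continuousOn_mul hUd.continuousOn hΩ.isLocallyClosed
  refine ⟨l1, l2.add l3, ?_⟩
  intro φ hφ hc hs
  set Φ : Plane → ℂ := fun x => (φ x : ℂ)
  have hΦ : ContDiff ℝ ∞ Φ := Complex.ofRealCLM.contDiff.comp hφ
  have hΦc : HasCompactSupport Φ := hc.comp_left Complex.ofReal_zero
  have hΦs : tsupport Φ ⊆ Ω := by
    refine (closure_mono ?_).trans hs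
    intro y hy h
    apply hy
    simp [Φ, h]
  have h1 := h.integral_mul_eq (contDiff_mul_of_tsupport_subset hΩ hΦ hΦs hU) hΦc.mul_right
    (tsupport_mul_subset_left.trans hΦs)
  have i1 := integrableOn_smul_test l1 (contDiff_pd hφ j).continuous (hasCompactSupport_pd hc j)
    ((tsupport_partialDeriv_subset (j := j) _).trans hs)
  have i2 := integrableOn_smul_test l2 hφ.continuous hc hs
  have i3 := integrableOn_smul_test l3 hφ.continuous hc hs
  have e1 : ∫ x in Ω, pd j (fun y => Φ y * U y) x * v x =
      (∫ x in Ω, pd j φ x • (U x * v x)) + ∫ x in Ω, φ x • (pd j U x * v x) := by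
    rw [← integral_add i1 i3]
    apply setIntegral_congr_fun hΩ.measurableSet
    intro x hx
    simp only
    rw [pd_mul (hΦ.differentiable (by simp) x)
      ((hU.contDiffAt (hΩ.mem_nhds hx)).differentiableAt (by simp)),
      pd_ofReal (hφ.differentiable (by simp) x)]
    simp only [Complex.real_smul, Φ]
    ring
  have e2 : ∫ x in Ω, φ x • (U x * g x + pd j U x * v x) =
      (∫ x in Ω, φ x • (U x * g x)) + ∫ x in Ω, φ x • (pd j U x * v x) := by
    rw [← integral_add i2 i3]
    simp only [smul_add]
  have e3 : ∫ x in Ω, Φ x * U x * g x = ∫ x in Ω, φ x • (U x * g x) := by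
    congr 1; ext x
    simp only [Complex.real_smul, Φ]; ring
  rw [e1, e3] at h1
  rw [e2]
  change ∫ x in Ω, pd j φ x • (U x * v x) = _
  linear_combination h1

theorem HasWeakPartial.integral_mul_dbar {f g₀ g₁ : Plane → ℂ} (h0 : HasWeakPartial Ω 0 f g₀)
    (h1 : HasWeakPartial Ω 1 f g₁)
    {Φ : Plane → ℂ} (hΦ : ContDiff ℝ ∞ Φ) (hc : HasCompactSupport Φ) (hs : tsupport Φ ⊆ Ω) :
    ∫ x in Ω, f x * dbar Φ x = - ∫ x in Ω, (g₀ x + Complex.I * g₁ x) * Φ x := by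
  have e0 := h0.integral_mul_eq hΦ hc hs
  have e1 := h1.integral_mul_eq hΦ hc hs
  have t : ∀ k, tsupport (pd k Φ) ⊆ Ω := fun k =>
    (closure_minimal (support_pd_subset Φ k) (isClosed_tsupport Φ)).trans hs
  have i0 := integrableOn_mul_test h0.1 (contDiff_pd hΦ 0).continuous (hasCompactSupport_pd hc 0) (t 0)
  have i1 := integrableOn_mul_test h0.1 (contDiff_pd hΦ 1).continuous (hasCompactSupport_pd hc 1) (t 1)
  have i2 := integrableOn_mul_test h0.2 hΦ.continuous hc hs
  have i3 := integrableOn_mul_test h1.2 hΦ.continuous hc hs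
  have a1 : ∫ x in Ω, f x * dbar Φ x =
      (∫ x in Ω, pd 0 Φ x * f x) + Complex.I * ∫ x in Ω, pd 1 Φ x * f x := by
    rw [← integral_const_mul, ← integral_add i0 (i1.const_mul _)]
    congr 1; ext x
    simp only [dbar]; ring
  have a2 : ∫ x in Ω, (g₀ x + Complex.I * g₁ x) * Φ x =
      (∫ x in Ω, Φ x * g₀ x) + Complex.I * ∫ x in Ω, Φ x * g₁ x := by
    rw [← integral_const_mul, ← integral_add i2 (i3.const_mul _)]
    congr 1; ext x
    ring
  rw [a1, a2, e0, e1]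
  ring

end WeakCalculus

/-! ### Vector fields as complex functions, and the field decomposition -/

/-- The vector field `(Im β, Re β)`; its curl and divergence are the real and imaginary part of
`dbar β`. -/
def fieldOf (β : Plane → ℂ) (x : Plane) : Plane := !₂[(β x).im, (β x).re]

@[simp] theorem fieldOf_zero (β : Plane → ℂ) (x : Plane) : fieldOf β x 0 = (β x).im := rfl

@[simp] theorem fieldOf_one (β : Plane → ℂ) (x : Plane) : fieldOf β x 1 = (β x).re := rfl

/-- A field of constant curl `h` and vanishing divergence. -/
def uniformField (h : ℝ) (x : Plane) : ℂ := (h / 2 : ℂ) * star (planeToComplex x)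

theorem contDiff_uniformField (h : ℝ) : ContDiff ℝ ∞ (uniformField h) := by
  have : ContDiff ℝ ∞ fun x => Complex.conjCLE (planeToComplex x) :=
    Complex.conjCLE.contDiff.comp planeToComplex.contDiff
  exact contDiff_const.mul this

theorem pd_uniformField (h : ℝ) (j : Fin 2) (x : Plane) :
    pd j (uniformField h) x =
      (h / 2 : ℂ) * star (planeToComplex (EuclideanSpace.single j (1 : ℝ))) := by
  have h1 : HasFDerivAt (uniformField h) ((h / 2 : ℂ) •
      ((Complex.conjCLE : ℂ →L[ℝ] ℂ).comp
        (planeToComplex.toContinuousLinearEquiv : Plane →L[ℝ] ℂ))) x :=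
    (((Complex.conjCLE : ℂ →L[ℝ] ℂ).comp
        (planeToComplex.toContinuousLinearEquiv : Plane →L[ℝ] ℂ)).hasFDerivAt).const_mul _
  rw [pd, h1.fderiv]
  rfl

theorem dbar_uniformField (h : ℝ) (x : Plane) : dbar (uniformField h) x = h := by
  rw [dbar, pd_uniformField, pd_uniformField, planeToComplex_single_zero, planeToComplex_single_one]
  simp only [star_one, RCLike.star_def, Complex.conj_I]
  linear_combination (-(h / 2 : ℂ)) * Complex.I_sq

theorem pd_re {G : Plane → ℂ} {x : Plane} (hG : DifferentiableAt ℝ G x) (j : Fin 2) :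
    pd j (fun y => (G y).re) x = (pd j G x).re := by
  have := (Complex.reCLM.hasFDerivAt (x := G x)).comp x hG.hasFDerivAt
  rw [pd, show (fun y => (G y).re) = Complex.reCLM ∘ G from rfl, this.fderiv]
  rfl

theorem pd_im {G : Plane → ℂ} {x : Plane} (hG : DifferentiableAt ℝ G x) (j : Fin 2) :
    pd j (fun y => (G y).im) x = (pd j G x).im := by
  have := (Complex.imCLM.hasFDerivAt (x := G x)).comp x hG.hasFDerivAt
  rw [pd, show (fun y => (G y).im) = Complex.imCLM ∘ G from rfl, this.fderiv]
  rfl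

theorem apply_eq_sum_pd {F : Type*} [NormedAddCommGroup F] [NormedSpace ℝ F]
    (L : Plane →L[ℝ] F) (y : Plane) : L y = y 0 • L (EuclideanSpace.single 0 1) +
      y 1 • L (EuclideanSpace.single 1 1) := by
  rw [← map_smul, ← map_smul, ← map_add]
  congr 1
  ext i
  fin_cases i <;> simp

/-- A smooth curl-free field on a simply connected domain is a gradient. -/
theorem exists_potential {Ω : Set Plane} (hΩ : IsOpen Ω) (hs : IsSimplyConnected Ω)
    {G : Plane → ℂ} (hG : ContDiffOn ℝ ∞ G Ω) (hcurl : ∀ x ∈ Ω, (dbar G x).re = 0) :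
    ∃ ξ : Plane → ℝ, ContDiffOn ℝ ∞ ξ Ω ∧ ∀ x ∈ Ω, ∀ j, pd j ξ x = fieldOf G x j := by
  set p : Fin 2 → Plane →L[ℝ] ℝ := fun j => EuclideanSpace.proj j
  set η : Plane → Plane →L[ℝ] ℝ := fun x => (G x).im • p 0 + (G x).re • p 1 with hη
  have hre : ContDiffOn ℝ ∞ (fun x => (G x).re) Ω := Complex.reCLM.contDiff.comp_contDiffOn hG
  have him : ContDiffOn ℝ ∞ (fun x => (G x).im) Ω := Complex.imCLM.contDiff.comp_contDiffOn hG
  have hηs : ContDiffOn ℝ ∞ η Ω := (him.smul contDiffOn_const).add (hre.smul contDiffOn_const)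
  have hd : ∀ x ∈ Ω, DifferentiableAt ℝ G x := fun x hx =>
    (hG.contDiffAt (hΩ.mem_nhds hx)).differentiableAt (by simp)
  obtain ⟨ξ, hξ⟩ := exists_hasFDerivAt_of_isSimplyConnected hΩ hs
    (hηs.differentiableOn (by simp)) (by
    intro a ha x y
    have h1 : DifferentiableAt ℝ (fun x => (G x).re) a :=
      (hre.contDiffAt (hΩ.mem_nhds ha)).differentiableAt (by simp)
    have h2 : DifferentiableAt ℝ (fun x => (G x).im) a :=
      (him.contDiffAt (hΩ.mem_nhds ha)).differentiableAt (by simp)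
    have h3 : HasFDerivAt η ((fderiv ℝ (fun x => (G x).im) a).smulRight (p 0) +
        (fderiv ℝ (fun x => (G x).re) a).smulRight (p 1)) a :=
      (h2.hasFDerivAt.smul_const (p 0)).add (h1.hasFDerivAt.smul_const (p 1))
    have hc := hcurl a ha
    simp only [dbar, Complex.add_re, Complex.mul_re, Complex.I_re, Complex.I_im] at hc
    rw [← pd_re (hd a ha), ← pd_im (hd a ha)] at hc
    rw [h3.fderiv]
    simp only [_root_.add_apply, ContinuousLinearMap.smulRight_apply,
      _root_.smul_apply]
    rw [apply_eq_sum_pd _ x, apply_eq_sum_pd (fderiv ℝ (fun x => (G x).re) a) x,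
      apply_eq_sum_pd (fderiv ℝ (fun x => (G x).im) a) y,
      apply_eq_sum_pd (fderiv ℝ (fun x => (G x).re) a) y]
    change (x 0 • pd 0 (fun x => (G x).im) a + x 1 • pd 1 (fun x => (G x).im) a) * y 0 +
      (x 0 • pd 0 (fun x => (G x).re) a + x 1 • pd 1 (fun x => (G x).re) a) * y 1 =
      (y 0 • pd 0 (fun x => (G x).im) a + y 1 • pd 1 (fun x => (G x).im) a) * x 0 +
      (y 0 • pd 0 (fun x => (G x).re) a + y 1 • pd 1 (fun x => (G x).re) a) * x 1
    simp only [smul_eq_mul]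
    linear_combination (x 0 * y 1 - x 1 * y 0) * hc)
  refine ⟨ξ, ?_, ?_⟩
  · rw [contDiffOn_infty_iff_fderiv_of_isOpen hΩ]
    exact ⟨fun x hx => (hξ x hx).differentiableAt.differentiableWithinAt,
      hηs.congr fun x hx => (hξ x hx).fderiv⟩
  · intro x hx j
    rw [pd, (hξ x hx).fderiv]
    fin_cases j <;> simp [hη, p]

theorem support_indicator_subset_ball {α : Type*} [Zero α] {Ω : Set Plane} {R : ℝ}
    (hR : Ω ⊆ Metric.ball 0 R) (f : Plane → α) :
    Function.support (Ω.indicator f) ⊆ Metric.ball 0 R :=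
  fun x hx => hR (by by_contra h; exact hx (indicator_of_notMem h f))

theorem memLp_ball_of_continuous {f : Plane → ℂ} (hf : Continuous f) (R : ℝ) (p : ℝ≥0∞) :
    MemLp f p (volume.restrict (Metric.ball 0 R)) := by
  have hfin : IsFiniteMeasure (volume.restrict (Metric.ball (0 : Plane) R)) :=
    ⟨by rw [Measure.restrict_apply_univ]; exact measure_ball_lt_top⟩
  obtain ⟨C, hC⟩ := (isCompact_closedBall (0 : Plane) R).exists_bound_of_continuousOn hf.continuousOn
  refine MemLp.of_bound hf.aestronglyMeasurable C ?_
  filter_upwards [ae_restrict_mem measurableSet_ball] with x hx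
  exact hC x (Metric.ball_subset_closedBall hx)

theorem tsupport_dbar_subset (φ : Plane → ℂ) : tsupport (dbar φ) ⊆ tsupport φ := by
  refine closure_minimal ?_ (isClosed_tsupport φ)
  intro x hx
  by_contra h0
  apply hx
  have : ∀ j, pd j φ x = 0 := fun j => by
    by_contra h1
    exact h0 (support_pd_subset φ j h1)
  simp [dbar, this]

/-- A weak solution `β` of `dbar β = h + H + K` on a bounded open set, in terms of Cauchy
transforms. -/
theorem exists_contDiffOn_of_dbar_eq {Ω : Set Plane} (hΩ : IsOpen Ω) {R R' : ℝ}
    (hΩR : Ω ⊆ Metric.ball 0 R) {β g₀ g₁ H K : Plane → ℂ} {h : ℝ}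
    (hβ : MemLp β 2 (volume.restrict Ω)) (h0 : HasWeakPartial Ω 0 β g₀)
    (h1 : HasWeakPartial Ω 1 β g₁) (hH : MemLp H 2) (hK : MemLp K 2)
    (hHs : Function.support H ⊆ Metric.ball 0 R') (hKs : Function.support K ⊆ Metric.ball 0 R')
    (heq : ∀ x ∈ Ω, g₀ x + Complex.I * g₁ x = h + H x + K x) :
    ∃ F : Plane → ℂ, ContDiffOn ℝ ∞ F Ω ∧ (∀ x ∈ Ω, dbar F x = 0) ∧
      ∀ᵐ x, x ∈ Ω → β x = F x + uniformField h x + cauchyTransform H x + cauchyTransform K x := by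
  have hfin : IsFiniteMeasure (volume.restrict Ω) :=
    ⟨by rw [Measure.restrict_apply_univ]; exact (measure_mono hΩR).trans_lt measure_ball_lt_top⟩
  have hu : MemLp (uniformField h) 2 (volume.restrict Ω) :=
    (memLp_ball_of_continuous (contDiff_uniformField h).continuous R 2).mono_measure
      (Measure.restrict_mono hΩR le_rfl)
  have hT : ∀ {u : Plane → ℂ}, MemLp u 2 → Function.support u ⊆ Metric.ball 0 R' →
      MemLp (cauchyTransform u) 2 (volume.restrict Ω) := fun hu hs =>
    ((memLp_cauchyTransform hu hs R).mono_measure (Measure.restrict_mono hΩR le_rfl)).mono_exponent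
      (by norm_num)
  have hf2 : MemLp (fun x => β x - uniformField h x - cauchyTransform H x - cauchyTransform K x) 2
      (volume.restrict Ω) := ((hβ.sub hu).sub (hT hH hHs)).sub (hT hK hKs)
  -- The three subtracted terms have weak `dbar` equal to `h`, `H` and `K`, so the difference is
  -- weakly annihilated by `dbar` and Weyl's lemma applies.
  obtain ⟨F, hF, hFf, hF0⟩ := exists_contDiffOn_ae_eq hΩ hf2 (by
    intro φ hφ hφc hφs
    have hz : ∀ x, x ∉ Ω → φ x = 0 := fun x hx =>
      image_eq_zero_of_notMem_tsupport fun h0 => hx (hφs h0)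
    have hdφs := (tsupport_dbar_subset φ).trans hφs
    have hz' : ∀ x, x ∉ Ω → dbar φ x = 0 := fun x hx =>
      image_eq_zero_of_notMem_tsupport fun h0 => hx (hdφs h0)
    have hdφ := contDiff_dbar hφ
    have hdφc := hasCompactSupport_dbar hφc
    have e1 := h0.integral_mul_dbar h1 hφ hφc hφs
    have e2 := integral_mul_dbar ((contDiff_uniformField h).of_le (by simp)) hφ hφc
    have e3 := integral_cauchyTransform_mul_dbar hH hHs hφ hφc
    have e4 := integral_cauchyTransform_mul_dbar hK hKs hφ hφc
    have test : ∀ {u : Plane → ℂ}, LocallyIntegrableOn u Ω →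
        Integrable (fun x => u x * dbar φ x) (volume.restrict Ω) := fun hu => by
      have := integrableOn_mul_test hu hdφ.continuous hdφc hdφs
      refine this.congr (ae_of_all _ fun x => mul_comm _ _)
    have i2 := test ((contDiff_uniformField h).continuous.locallyIntegrable.locallyIntegrableOn Ω)
    have i3 := test ((locallyIntegrable_cauchyTransform hH hHs).locallyIntegrableOn Ω)
    have i4 := test ((locallyIntegrable_cauchyTransform hK hKs).locallyIntegrableOn Ω)
    have test' : ∀ {u : Plane → ℂ}, MemLp u 2 → Integrable (fun x => u x * φ x) (volume.restrict Ω) :=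
      fun hu => (integrable_mul_of_memLp_two hu (memLp_of_contDiff hφ hφc)).restrict
    have i5 := test' hH
    have i6 := test' hK
    have i7 : Integrable (fun x => (h : ℂ) * φ x) (volume.restrict Ω) :=
      ((hφ.continuous.integrable_of_hasCompactSupport hφc).const_mul _).restrict
    simp only [dbar_uniformField] at e2
    rw [← setIntegral_eq_integral_of_forall_compl_eq_zero (s := Ω)
      (fun x hx => by rw [hz' x hx, mul_zero])] at e2 e3 e4 ⊢
    rw [← setIntegral_eq_integral_of_forall_compl_eq_zero (s := Ω) (f := fun x => _ * φ x)
      (fun x hx => by rw [hz x hx, mul_zero])] at e2 e3 e4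
    have e5 : ∫ x in Ω, (g₀ x + Complex.I * g₁ x) * φ x = (∫ x in Ω, (h : ℂ) * φ x) +
        (∫ x in Ω, H x * φ x) + ∫ x in Ω, K x * φ x := by
      have i8 : Integrable (fun x => (h : ℂ) * φ x + H x * φ x) (volume.restrict Ω) := i7.add i5
      rw [← integral_add i7 i5, ← integral_add i8 i6]
      refine setIntegral_congr_fun hΩ.measurableSet fun x hx => ?_
      simp only [heq x hx]
      ring
    have e6 : ∫ x in Ω, (β x - uniformField h x - cauchyTransform H x - cauchyTransform K x) *
        dbar φ x = (∫ x in Ω, β x * dbar φ x) - (∫ x in Ω, uniformField h x * dbar φ x) -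
          (∫ x in Ω, cauchyTransform H x * dbar φ x) - ∫ x in Ω, cauchyTransform K x * dbar φ x := by
      have i9 : Integrable (fun x => β x * dbar φ x - uniformField h x * dbar φ x)
        (volume.restrict Ω) := (test h0.1).sub i2
      have i10 : Integrable (fun x => β x * dbar φ x - uniformField h x * dbar φ x -
        cauchyTransform H x * dbar φ x) (volume.restrict Ω) := i9.sub i3
      rw [← integral_sub (test h0.1) i2, ← integral_sub i9 i3, ← integral_sub i10 i4]
      congr 1; ext x
      ring
    rw [e6, e1, e2, e3, e4, e5]
    ring)
  refine ⟨F, hF, hF0, ?_⟩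
  filter_upwards [hFf] with x hx hxΩ
  rw [← hx hxΩ]
  ring

/-- Up to a smooth curl-free field, a field on a bounded domain is the Cauchy transform of its
curl, corrected by a small imaginary part. -/
theorem exists_cauchyTransform_add {Ω : Set Plane} (hΩ : IsOpen Ω) {R : ℝ} (hR : 0 < R)
    (hΩR : Ω ⊆ Metric.ball 0 R) (hex : ℝ) {b : Fin 2 → Plane → ℝ} {g : Fin 2 → Fin 2 → Plane → ℝ}
    (hb : ∀ k, MemLp (b k) 2 (volume.restrict Ω)) (hg : ∀ k j, HasWeakPartial Ω j (b k) (g k j))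
    (hg2 : ∀ k j, MemLp (g k j) 2 (volume.restrict Ω)) :
    ∃ H G : Plane → ℂ, MemLp H 2 ∧ Function.support H ⊆ Metric.ball 0 (R + 1) ∧
      (∀ x, (H x).re = Ω.indicator (fun x => g 1 0 x - g 0 1 x - hex) x) ∧
      eLpNorm (fun x => (H x).im) 2 volume ≤ 1 ∧ ContDiffOn ℝ ∞ G Ω ∧
      (∀ x ∈ Ω, (dbar G x).re = 0) ∧
      ∀ᵐ x, x ∈ Ω → uniformField hex x + cauchyTransform H x =
        b 1 x + Complex.I * b 0 x + G x := by
  have hfin : IsFiniteMeasure (volume.restrict Ω) :=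
    ⟨by rw [Measure.restrict_apply_univ]; exact (measure_mono hΩR).trans_lt measure_ball_lt_top⟩
  obtain ⟨c, hc⟩ : ∃ c : Plane → ℝ, c = Ω.indicator (fun x => g 1 0 x - g 0 1 x - hex) := ⟨_, rfl⟩
  obtain ⟨d, hd⟩ : ∃ d : Plane → ℝ, d = Ω.indicator (fun x => g 0 0 x + g 1 1 x) := ⟨_, rfl⟩
  have hc2 : MemLp c 2 volume := by
    rw [hc, memLp_indicator_iff_restrict hΩ.measurableSet]
    exact ((hg2 1 0).sub (hg2 0 1)).sub (memLp_const hex)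
  have hd2 : MemLp d 2 volume := by
    rw [hd, memLp_indicator_iff_restrict hΩ.measurableSet]
    exact (hg2 0 0).add (hg2 1 1)
  have hcs : Function.support c ⊆ Metric.ball 0 R := hc ▸ support_indicator_subset_ball hΩR _
  have hds : Function.support d ⊆ Metric.ball 0 R := hd ▸ support_indicator_subset_ball hΩR _
  have hd3 : MemLp (fun x => (d x : ℂ)) 2 volume := hd2.ofReal
  -- The energy does not control the divergence `d`. Removing a smooth approximation `K` of `i d`
  -- leaves an imaginary part of norm at most `1` in `H`. The removed part contributes
  -- `-cauchyTransform K` to `G`: it is smooth, and has no curl because `K` is purely imaginary.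
  obtain ⟨h, h1, h2, h3, h4⟩ := exists_contDiff_approx hR hd3
    (fun x hx => hds (by simpa using hx)) one_pos
  have hδ1 : ContDiff ℝ ∞ (fun x => ((h x).re : ℂ)) :=
    Complex.ofRealCLM.contDiff.comp (Complex.reCLM.contDiff.comp h1)
  obtain ⟨K, hK⟩ : ∃ K : Plane → ℂ, K = fun x => Complex.I * ((h x).re : ℂ) := ⟨_, rfl⟩
  have hK1 : ContDiff ℝ ∞ K := hK ▸ contDiff_const.mul hδ1
  have hKh : Function.support K ⊆ Function.support h := fun x hx h0 => hx (by simp [hK, h0])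
  have hKc : HasCompactSupport K := h2.mono hKh
  have hKs : Function.support K ⊆ Metric.ball 0 (R + 1) := hKh.trans h3
  have hK2 : MemLp K 2 volume := memLp_of_contDiff hK1 hKc
  obtain ⟨H, hH⟩ : ∃ H : Plane → ℂ, H = fun x => (c x : ℂ) + Complex.I * (d x : ℂ) - K x := ⟨_, rfl⟩
  have hc3 : MemLp (fun x => (c x : ℂ)) 2 volume := hc2.ofReal
  have hH2 : MemLp H 2 volume := hH ▸ (hc3.add (hd3.const_mul Complex.I)).sub hK2
  have hHs : Function.support H ⊆ Metric.ball 0 (R + 1) := by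
    intro x hx
    by_contra hx'
    have hx'' : x ∉ Metric.ball (0 : Plane) R :=
      fun h0 => hx' (Metric.ball_subset_ball (by linarith) h0)
    apply hx
    have a1 : c x = 0 := by by_contra h0; exact hx'' (hcs h0)
    have a2 : d x = 0 := by by_contra h0; exact hx'' (hds h0)
    have a3 : K x = 0 := by by_contra h0; exact hx' (hKs h0)
    simp [hH, a1, a2, a3]
  have hβ0 : MemLp (fun x => (b 1 x : ℂ)) 2 (volume.restrict Ω) := (hb 1).ofReal
  have hβ1 : MemLp (fun x => (b 0 x : ℂ)) 2 (volume.restrict Ω) := (hb 0).ofReal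
  have hβw : ∀ j, HasWeakPartial Ω j (fun x => (b 1 x : ℂ) + Complex.I * (b 0 x : ℂ))
      (fun x => (g 1 j x : ℂ) + Complex.I * (g 0 j x : ℂ)) := fun j =>
    ((hg 1 j).clm_comp Complex.ofRealCLM).add
      ((hg 0 j).clm_comp ((ContinuousLinearMap.mul ℝ ℂ Complex.I).comp Complex.ofRealCLM))
  obtain ⟨F, hF, hF0, hFe⟩ := exists_contDiffOn_of_dbar_eq (h := hex) hΩ hΩR
    (hβ0.add (hβ1.const_mul Complex.I)) (hβw 0) (hβw 1) hH2 hK2 hHs hKs (by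
      intro x hx
      simp only [hH, hc, hd, indicator_of_mem hx]
      push_cast
      linear_combination (g 0 1 x : ℂ) * Complex.I_sq)
  have hTK := contDiff_cauchyTransform hK1 hKc
  refine ⟨H, fun x => - F x - cauchyTransform K x, hH2, hHs, ?_, ?_,
    hF.neg.sub hTK.contDiffOn, ?_, ?_⟩
  · intro x
    rw [← hc]
    simp [hH, hK]
  · refine (eLpNorm_mono (g := fun x => h x - (d x : ℂ)) fun x => ?_).trans (h4.trans (by simp))
    have : (H x).im = -(h x - (d x : ℂ)).re := by simp [hH, hK]
    rw [this, norm_neg]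
    exact Complex.abs_re_le_norm _
  · intro x hx
    have d1 : DifferentiableAt ℝ F x := (hF.contDiffAt (hΩ.mem_nhds hx)).differentiableAt (by simp)
    have d2 : DifferentiableAt ℝ (cauchyTransform K) x := hTK.differentiable (by simp) x
    have e1 : ∀ j, pd j (fun x => - F x - cauchyTransform K x) x =
        - pd j F x - pd j (cauchyTransform K) x := by
      intro j
      have := (d1.hasFDerivAt.neg.sub d2.hasFDerivAt).fderiv
      rw [pd]
      erw [this]
      rfl
    have e2 : dbar (fun x => - F x - cauchyTransform K x) x =
        - dbar F x - dbar (cauchyTransform K) x := by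
      simp only [dbar, e1]; ring
    rw [e2, hF0 x hx, dbar_cauchyTransform hK1 hKc]
    simp [hK]
  · filter_upwards [hFe] with x hx hxΩ
    have := hx hxΩ
    simp only [Pi.add_apply] at this
    rw [this]
    ring

/-! ### Gauge invariance and gauge fixing -/

/-- The energy in terms of the covariant derivatives `w` and of a complex field `H` whose real part
is the curl. -/
def reducedEnergy (Ω : Set Plane) (ε : ℝ) (v : Plane → ℂ) (w : Fin 2 → Plane → ℂ) (H : Plane → ℂ) :
    ℝ≥0∞ :=
  (2⁻¹ * ∫⁻ x in Ω, ENNReal.ofReal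
    (∑ j, ‖w j x‖ ^ 2 + 1 / (2 * ε ^ 2) * (1 - ‖v x‖ ^ 2) ^ 2)) +
  2⁻¹ * ∫⁻ x, ENNReal.ofReal ((H x).re ^ 2)

/-- The energy sees `v` and its covariant derivatives only through their moduli. Asking for equal
norms, not equal functions, makes the identity cover every gauge change by a unimodular factor. -/
theorem energyF_eq {Ω : Set Plane} (hΩ : IsOpen Ω) (ε hex : ℝ) {v : Plane → ℂ} {b : Plane → Plane}
    {D : Fin 2 → Plane → ℂ} {g : Fin 2 → Fin 2 → Plane → ℝ} (hD : ∀ j, HasWeakPartial Ω j v (D j))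
    (hg : ∀ k j, HasWeakPartial Ω j (fun x => b x k) (g k j)) {w : Fin 2 → Plane → ℂ}
    {v' H : Plane → ℂ} (hv : ∀ x ∈ Ω, ‖v' x‖ = ‖v x‖)
    (hw : ∀ j, ∀ x ∈ Ω, ‖w j x‖ = ‖D j x - Complex.I * (b x j : ℂ) * v x‖)
    (hH : ∀ x, (H x).re = Ω.indicator (fun x => g 1 0 x - g 0 1 x - hex) x) :
    energyF Ω ε hex (v, b) = reducedEnergy Ω ε v' w H := by
  rw [energyF, reducedEnergy, matterEnergy, magneticEnergy]
  congr 2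
  · refine setLIntegral_congr_fun_ae hΩ.measurableSet ?_
    filter_upwards [(hD 0).weakPartial_ae_eq hΩ, (hD 1).weakPartial_ae_eq hΩ] with x h0 h1 hx
    simp only [covGradSq, Fin.sum_univ_two, h0 hx, h1 hx, hv x hx, hw 0 x hx, hw 1 x hx]
  · have e : ∀ x, ENNReal.ofReal ((H x).re ^ 2) =
        Ω.indicator (fun x => ENNReal.ofReal ((g 1 0 x - g 0 1 x - hex) ^ 2)) x := by
      intro x
      rw [hH]
      by_cases hx : x ∈ Ω
      · simp only [indicator_of_mem hx]
      · simp [indicator_of_notMem hx]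
    simp_rw [e]
    rw [lintegral_indicator hΩ.measurableSet]
    refine setLIntegral_congr_fun_ae hΩ.measurableSet ?_
    filter_upwards [(hg 1 0).weakPartial_ae_eq hΩ, (hg 0 1).weakPartial_ae_eq hΩ] with x h0 h1 hx
    simp only [weakCurl, h0 hx, h1 hx]

/-- Gauge-fixed configurations: the field is `uniformField hex + cauchyTransform H`, and `w` is the
covariant gradient of `v`. -/
structure IsGaugeFixed (Ω : Set Plane) (R hex : ℝ) (v : Plane → ℂ) (w : Fin 2 → Plane → ℂ)
    (H : Plane → ℂ) : Prop where
  memLp : MemLp H 2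
  support_subset : Function.support H ⊆ Metric.ball 0 R
  eLpNorm_im_le : eLpNorm (fun x => (H x).im) 2 volume ≤ 1
  aestronglyMeasurable : AEStronglyMeasurable v (volume.restrict Ω)
  aestronglyMeasurable_covDeriv : ∀ j, AEStronglyMeasurable (w j) (volume.restrict Ω)
  hasWeakPartial : ∀ j, HasWeakPartial Ω j v (fun x => w j x + Complex.I *
    (fieldOf (fun x => uniformField hex x + cauchyTransform H x) x j : ℂ) * v x)

/-- A configuration on a bounded simply connected domain is gauge equivalent to one whose field is,
up to a fixed field, the Cauchy transform of essentially its curl. -/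
theorem exists_gauge {Ω : Set Plane} (hΩ : IsOpen Ω) (hsc : IsSimplyConnected Ω) {R : ℝ}
    (hR : 0 < R) (hΩR : Ω ⊆ Metric.ball 0 R) (ε hex : ℝ) {p : (Plane → ℂ) × (Plane → Plane)}
    (hp : p ∈ spaceXΩ Ω) :
    ∃ (v H : Plane → ℂ) (w : Fin 2 → Plane → ℂ), IsGaugeFixed Ω (R + 1) hex v w H ∧
      reducedEnergy Ω ε v w H = energyF Ω ε hex p := by
  obtain ⟨v, b⟩ := p
  obtain ⟨⟨hv2, hv⟩, hb⟩ := hp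
  choose D hD hD2 using hv
  have hb2 : ∀ k, MemLp (fun x => b x k) 2 (volume.restrict Ω) := fun k => (hb k).1
  have hb' := fun k => (hb k).2
  choose g hg hg2 using hb'
  obtain ⟨H, G, hH, hHs, hHre, hHim, hG, hG0, hGe⟩ :=
    exists_cauchyTransform_add hΩ hR hΩR hex hb2 hg hg2
  obtain ⟨ξ, hξ, hξG⟩ := exists_potential hΩ hsc hG hG0
  -- Since `∂ⱼ U = i Gⱼ U`, the covariant derivative of `U v` for the field `b + G` is `U` times
  -- that of `v` for `b`.
  obtain ⟨U, hU⟩ : ∃ U : Plane → ℂ, U = fun x => Complex.exp ((ξ x : ℂ) * Complex.I) := ⟨_, rfl⟩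
  have hUn : ∀ x, ‖U x‖ = 1 := fun x => by rw [hU]; exact Complex.norm_exp_ofReal_mul_I _
  have hUs : ContDiffOn ℝ ∞ U Ω := by
    rw [hU]
    exact ((Complex.ofRealCLM.contDiff.comp_contDiffOn hξ).mul contDiffOn_const).cexp
  have hUd : ∀ x ∈ Ω, ∀ j, pd j U x = Complex.I * (fieldOf G x j : ℂ) * U x := by
    intro x hx j
    have h1 : DifferentiableAt ℝ ξ x := (hξ.contDiffAt (hΩ.mem_nhds hx)).differentiableAt (by simp)
    have h2 : HasFDerivAt U (U x • (Complex.I • Complex.ofRealCLM.comp (fderiv ℝ ξ x))) x := by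
      rw [hU]
      exact ((Complex.ofRealCLM.hasFDerivAt.comp x h1.hasFDerivAt).mul_const Complex.I).cexp
    rw [pd, h2.fderiv, ← hξG x hx j]
    simp only [_root_.smul_apply, ContinuousLinearMap.comp_apply, Complex.ofRealCLM_apply,
      smul_eq_mul, pd]
    ring
  refine ⟨fun x => U x * v x, H, fun j x => U x * (D j x - Complex.I * (b x j : ℂ) * v x),
    ⟨hH, hHs, hHim, ?_, ?_, ?_⟩, ?_⟩
  · exact (hUs.continuousOn.aestronglyMeasurable hΩ.measurableSet).mul hv2.1
  · intro j
    have hbj : AEStronglyMeasurable (fun x => (b x j : ℂ)) (volume.restrict Ω) :=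
      Complex.continuous_ofReal.comp_aestronglyMeasurable (hb2 j).1
    exact (hUs.continuousOn.aestronglyMeasurable hΩ.measurableSet).mul
      ((hD2 j).1.sub ((aestronglyMeasurable_const.mul hbj).mul hv2.1))
  · intro j
    refine ((hD j).contDiffOn_mul hΩ hUs).congr_ae hΩ.measurableSet (ae_of_all _ fun _ _ => rfl) ?_
    filter_upwards [hGe] with x hx hxΩ
    have e : fieldOf (fun x => uniformField hex x + cauchyTransform H x) x j =
        b x j + fieldOf G x j := by
      fin_cases j <;> simp [hx hxΩ]
    rw [hUd x hxΩ j, e]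
    push_cast
    ring
  · refine (energyF_eq hΩ ε hex hD hg (fun x _ => ?_) (fun j x _ => ?_) hHre).symm
    · rw [norm_mul, hUn, one_mul]
    · rw [norm_mul, hUn, one_mul]

/-! ### Local Rellich compactness -/

theorem WeakTendsto.add {μ : Measure Plane} {u u' : ℕ → Plane → ℂ} {g g' : Plane → ℂ}
    (h : WeakTendsto μ u g) (h' : WeakTendsto μ u' g') (hu : ∀ n, MemLp (u n) 2 μ)
    (hu' : ∀ n, MemLp (u' n) 2 μ) (hg : MemLp g 2 μ) (hg' : MemLp g' 2 μ) :
    WeakTendsto μ (fun n x => u n x + u' n x) (fun x => g x + g' x) := by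
  intro ψ hψ
  simp only [mul_add]
  rw [integral_add (integrable_mul_of_memLp_two hψ hg) (integrable_mul_of_memLp_two hψ hg')]
  refine ((h ψ hψ).add (h' ψ hψ)).congr fun n => ?_
  rw [integral_add (integrable_mul_of_memLp_two hψ (hu n)) (integrable_mul_of_memLp_two hψ (hu' n))]

theorem WeakTendsto.mul_of_support_subset {Ω : Set Plane} (hΩ : MeasurableSet Ω)
    {u : ℕ → Plane → ℂ} {g : Plane → ℂ} (h : WeakTendsto (volume.restrict Ω) u g) {c : Plane → ℂ}
    (hc : Continuous c) (hcc : HasCompactSupport c) (hs : Function.support c ⊆ Ω) :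
    WeakTendsto volume (fun n x => c x * u n x) (fun x => c x * g x) := by
  intro ψ hψ
  have e : ∀ w : Plane → ℂ, ∫ x, ψ x * (c x * w x) = ∫ x in Ω, (c x * ψ x) * w x := by
    intro w
    rw [setIntegral_eq_integral_of_forall_compl_eq_zero]
    · congr 1; ext x; ring
    · intro x hx
      have : c x = 0 := by
        by_contra h
        exact hx (hs h)
      simp [this]
  simp only [e]
  exact h _ ((memLp_mul_of_support_subset hΩ (hψ.restrict Ω) hc hcc hs).restrict Ω)

theorem eLpNorm_mul_le_of_support_subset {Ω : Set Plane} {c : Plane → ℂ} {M : ℝ≥0}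
    (hM : ∀ x, ‖c x‖ ≤ M) (hs : Function.support c ⊆ Ω) (u : Plane → ℂ) :
    eLpNorm (fun x => c x * u x) 2 volume ≤ M * eLpNorm u 2 (volume.restrict Ω) := by
  have hs' : Function.support (fun x => c x * u x) ⊆ Ω := fun x hx => hs fun h => hx (by simp [h])
  rw [← eLpNorm_restrict_eq_of_support_subset hs']
  have := eLpNorm_le_mul_eLpNorm_of_ae_le_mul (μ := volume.restrict Ω) (f := fun x => c x * u x)
    (g := u) (c := M) (ae_of_all _ fun x => by
      rw [norm_mul]
      exact mul_le_mul_of_nonneg_right (hM x) (norm_nonneg _)) 2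
  simpa using this

theorem support_dbar_subset (φ : Plane → ℂ) : Function.support (dbar φ) ⊆ tsupport φ :=
  (subset_tsupport _).trans (tsupport_dbar_subset φ)

/-- Cut-off representation of a function by its weak derivatives. -/
theorem mul_ae_eq_cauchyTransform {Ω : Set Plane} (hΩ : IsOpen Ω) {R : ℝ}
    (hΩR : Ω ⊆ Metric.ball 0 R) {v : Plane → ℂ} {D : Fin 2 → Plane → ℂ}
    (hv : MemLp v 2 (volume.restrict Ω)) (hD2 : ∀ j, MemLp (D j) 2 (volume.restrict Ω))
    (hD : ∀ j, HasWeakPartial Ω j v (D j)) {χ : Plane → ℂ} (hχ : ContDiff ℝ ∞ χ)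
    (hχc : HasCompactSupport χ) (hχs : tsupport χ ⊆ Ω) :
    (fun x => χ x * v x) =ᵐ[volume] cauchyTransform
      (fun x => χ x * D 0 x + Complex.I * χ x * D 1 x + dbar χ x * v x) := by
  have hχs' := (subset_tsupport χ).trans hχs
  have hIs : Function.support (fun x => Complex.I * χ x) ⊆ Ω :=
    fun x hx => hχs' fun h => hx (by simp [h])
  have hdc := contDiff_dbar hχ
  have hdcc := hasCompactSupport_dbar hχc
  have hds : Function.support (dbar χ) ⊆ Ω := (support_dbar_subset χ).trans hχs
  have m1 := memLp_mul_of_support_subset hΩ.measurableSet (hD2 0) hχ.continuous hχc hχs'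
  have m2 : MemLp (fun x => Complex.I * χ x * D 1 x) 2 volume :=
    memLp_mul_of_support_subset hΩ.measurableSet (hD2 1)
      (continuous_const.mul hχ.continuous) hχc.mul_left hIs
  have m3 := memLp_mul_of_support_subset hΩ.measurableSet hv hdc.continuous hdcc hds
  have m4 := memLp_mul_of_support_subset hΩ.measurableSet hv hχ.continuous hχc hχs'
  have hus : Function.support (fun x => χ x * v x) ⊆ Metric.ball 0 R :=
    fun x hx => hΩR (hχs' fun h => hx (by simp [h]))
  refine ae_eq_cauchyTransform (R := R) (integrable_of_memLp_two m4 hus).locallyIntegrable hus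
    ((m1.add m2).add m3) ?_ ?_
  · intro x hx
    apply hΩR
    by_contra h
    have a1 : χ x = 0 := by by_contra h1; exact h (hχs' h1)
    have a2 : dbar χ x = 0 := by by_contra h1; exact h (hds h1)
    exact hx (by simp [a1, a2])
  · intro φ hφ hφc
    have key := (hD 0).integral_mul_dbar (hD 1) (hχ.mul hφ) hφc.mul_left
      (tsupport_mul_subset_left.trans hχs)
    have hφ2 := memLp_of_contDiff hφ hφc
    have hdφ2 := memLp_of_contDiff (contDiff_dbar hφ) (hasCompactSupport_dbar hφc)
    have hz : ∀ x ∉ Ω, χ x = 0 := fun x hx => by by_contra h1; exact hx (hχs' h1)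
    have hz' : ∀ x ∉ Ω, dbar χ x = 0 := fun x hx => by by_contra h1; exact hx (hds h1)
    have e : ∀ x, dbar (fun y => χ y * φ y) x = dbar χ x * φ x + χ x * dbar φ x := fun x =>
      dbar_mul (hχ.differentiable (by simp) x) (hφ.differentiable (by simp) x)
    have e1 : ∫ x in Ω, v x * dbar (fun y => χ y * φ y) x =
        ∫ x, v x * dbar (fun y => χ y * φ y) x :=
      setIntegral_eq_integral_of_forall_compl_eq_zero fun x hx => by simp [e, hz x hx, hz' x hx]
    have e2 : ∫ x in Ω, (D 0 x + Complex.I * D 1 x) * (χ x * φ x) =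
        ∫ x, (D 0 x + Complex.I * D 1 x) * (χ x * φ x) :=
      setIntegral_eq_integral_of_forall_compl_eq_zero fun x hx => by simp [hz x hx]
    have i1 : Integrable (fun x => χ x * v x * dbar φ x) := integrable_mul_of_memLp_two m4 hdφ2
    have i2 : Integrable (fun x => dbar χ x * v x * φ x) := integrable_mul_of_memLp_two m3 hφ2
    have i3 : Integrable (fun x => (χ x * D 0 x + Complex.I * χ x * D 1 x) * φ x) :=
      integrable_mul_of_memLp_two (m1.add m2) hφ2
    have e3 : ∫ x, v x * dbar (fun y => χ y * φ y) x =
        (∫ x, dbar χ x * v x * φ x) + ∫ x, χ x * v x * dbar φ x := by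
      rw [← integral_add i2 i1]
      congr 1; ext x
      rw [e]; ring
    have e4 : ∫ x, (D 0 x + Complex.I * D 1 x) * (χ x * φ x) =
        ∫ x, (χ x * D 0 x + Complex.I * χ x * D 1 x) * φ x := by
      congr 1; ext x
      ring
    have e5 : ∫ x, (χ x * D 0 x + Complex.I * χ x * D 1 x + dbar χ x * v x) * φ x =
        (∫ x, (χ x * D 0 x + Complex.I * χ x * D 1 x) * φ x) + ∫ x, dbar χ x * v x * φ x := by
      rw [← integral_add i3 i2]
      congr 1; ext x
      ring
    have key' : ∫ x in Ω, v x * dbar (fun y => χ y * φ y) x =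
      -∫ x in Ω, (D 0 x + Complex.I * D 1 x) * (χ x * φ x) := key
    rw [e1, e2, e3, e4] at key'
    rw [e5]
    linear_combination key'

theorem exists_smooth_cutoff {Ω K : Set Plane} (hΩ : IsOpen Ω) (hK : IsCompact K) (hKΩ : K ⊆ Ω) :
    ∃ χ : Plane → ℂ, ContDiff ℝ ∞ χ ∧ HasCompactSupport χ ∧ tsupport χ ⊆ Ω ∧ ∀ x ∈ K, χ x = 1 := by
  obtain ⟨L, hL, hKL, hLΩ⟩ := exists_compact_between hK hΩ hKΩ
  obtain ⟨f, h1, h2, -⟩ := exists_contMDiffMap_one_nhds_of_subset_interior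
    (modelWithCornersSelf ℝ Plane) (n := ⊤) hK.isClosed hKL
  have hs : Function.support (fun x => (f x : ℂ)) ⊆ L := by
    intro x hx
    by_contra h
    exact hx (by simp [h2 x h])
  have hts := closure_minimal hs hL.isClosed
  refine ⟨fun x => (f x : ℂ), Complex.ofRealCLM.contDiff.comp f.contMDiff.contDiff,
    hL.of_isClosed_subset (isClosed_tsupport _) hts, hts.trans hLΩ, fun x hx => ?_⟩
  simp [h1.self_of_nhdsSet x hx]

/-- Rellich's theorem on compact subsets of `Ω`. -/
theorem tendsto_eLpNorm_sub_of_weakTendsto {Ω K : Set Plane} (hΩ : IsOpen Ω) {R : ℝ}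
    (hΩR : Ω ⊆ Metric.ball 0 R) {v : ℕ → Plane → ℂ} {D : ℕ → Fin 2 → Plane → ℂ}
    {v' : Plane → ℂ} {D' : Fin 2 → Plane → ℂ} {C : ℝ≥0}
    (hv : ∀ n, MemLp (v n) 2 (volume.restrict Ω)) (hvC : ∀ n, eLpNorm (v n) 2 (volume.restrict Ω) ≤ C)
    (hD2 : ∀ n j, MemLp (D n j) 2 (volume.restrict Ω))
    (hDC : ∀ n j, eLpNorm (D n j) 2 (volume.restrict Ω) ≤ C)
    (hD : ∀ n j, HasWeakPartial Ω j (v n) (D n j)) (hv' : MemLp v' 2 (volume.restrict Ω))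
    (hD2' : ∀ j, MemLp (D' j) 2 (volume.restrict Ω)) (hD' : ∀ j, HasWeakPartial Ω j v' (D' j))
    (hvw : WeakTendsto (volume.restrict Ω) v v')
    (hDw : ∀ j, WeakTendsto (volume.restrict Ω) (fun n => D n j) (D' j))
    (hK : IsCompact K) (hKΩ : K ⊆ Ω) :
    Tendsto (fun n => eLpNorm (v n - v') 4 (volume.restrict K)) atTop (𝓝 0) := by
  obtain ⟨χ, hχ, hχc, hχs, hχ1⟩ := exists_smooth_cutoff hΩ hK hKΩ
  have hχs' := (subset_tsupport χ).trans hχs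
  have hIs : Function.support (fun x => Complex.I * χ x) ⊆ Ω :=
    fun x hx => hχs' fun h => hx (by simp [h])
  have hIc : Continuous (fun x => Complex.I * χ x) := continuous_const.mul hχ.continuous
  have hIcc : HasCompactSupport (fun x => Complex.I * χ x) := hχc.mul_left
  have hdc := contDiff_dbar hχ
  have hdcc := hasCompactSupport_dbar hχc
  have hds : Function.support (dbar χ) ⊆ Ω := (support_dbar_subset χ).trans hχs
  have M := hΩ.measurableSet
  -- `S D v` is `dbar (χ v)` in the weak sense, and `χ v` is its Cauchy transform. Weak convergence
  -- of `v` and `D` gives weak convergence of `S`, which the transform turns into strong convergence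
  -- on `K`, where `χ = 1`.
  obtain ⟨S, hS⟩ : ∃ S : (Fin 2 → Plane → ℂ) → (Plane → ℂ) → Plane → ℂ, S = fun D v x =>
    χ x * D 0 x + Complex.I * χ x * D 1 x + dbar χ x * v x := ⟨_, rfl⟩
  have hSs : ∀ D v, Function.support (S D v) ⊆ Metric.ball 0 R := by
    intro D v x hx
    apply hΩR
    by_contra h
    have a1 : χ x = 0 := by by_contra h1; exact h (hχs' h1)
    have a2 : dbar χ x = 0 := by by_contra h1; exact h (hds h1)
    exact hx (by simp [hS, a1, a2])
  have m1 := fun {u : Plane → ℂ} (hu : MemLp u 2 (volume.restrict Ω)) =>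
    memLp_mul_of_support_subset M hu hχ.continuous hχc hχs'
  have m2 := fun {u : Plane → ℂ} (hu : MemLp u 2 (volume.restrict Ω)) =>
    memLp_mul_of_support_subset M hu hIc hIcc hIs
  have m3 := fun {u : Plane → ℂ} (hu : MemLp u 2 (volume.restrict Ω)) =>
    memLp_mul_of_support_subset M hu hdc.continuous hdcc hds
  have hS2 : ∀ {D : Fin 2 → Plane → ℂ} {v : Plane → ℂ}, MemLp v 2 (volume.restrict Ω) →
      (∀ j, MemLp (D j) 2 (volume.restrict Ω)) → MemLp (S D v) 2 volume := fun hv hD =>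
    hS ▸ ((m1 (hD 0)).add (m2 (hD 1))).add (m3 hv)
  obtain ⟨A, hA⟩ := hχc.exists_bound_of_continuous hχ.continuous
  obtain ⟨B, hB⟩ := hdcc.exists_bound_of_continuous hdc.continuous
  have hA' : ∀ x, ‖χ x‖ ≤ A.toNNReal := fun x => (hA x).trans (Real.le_coe_toNNReal A)
  have hI' : ∀ x, ‖Complex.I * χ x‖ ≤ A.toNNReal := fun x => by simpa using hA' x
  have hB' : ∀ x, ‖dbar χ x‖ ≤ B.toNNReal := fun x => (hB x).trans (Real.le_coe_toNNReal B)
  have hbound : ∀ n, eLpNorm (S (D n) (v n)) 2 volume ≤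
      ((A.toNNReal * C + A.toNNReal * C + B.toNNReal * C : ℝ≥0) : ℝ≥0∞) := by
    intro n
    have t1 : eLpNorm (S (D n) (v n)) 2 volume ≤ eLpNorm (fun x => χ x * D n 0 x) 2 volume +
        eLpNorm (fun x => Complex.I * χ x * D n 1 x) 2 volume +
        eLpNorm (fun x => dbar χ x * v n x) 2 volume := by
      rw [hS]
      refine (eLpNorm_add_le ((m1 (hD2 n 0)).add (m2 (hD2 n 1))).1 (m3 (hv n)).1
        (by norm_num)).trans ?_
      gcongr
      exact eLpNorm_add_le (m1 (hD2 n 0)).1 (m2 (hD2 n 1)).1 (by norm_num)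
    refine t1.trans ?_
    push_cast
    gcongr
    · exact (eLpNorm_mul_le_of_support_subset hA' hχs' _).trans (by gcongr; exact hDC n 0)
    · exact (eLpNorm_mul_le_of_support_subset hI' hIs _).trans (by gcongr; exact hDC n 1)
    · exact (eLpNorm_mul_le_of_support_subset hB' hds _).trans (by gcongr; exact hvC n)
  have hweak : WeakTendsto volume (fun n => S (D n) (v n)) (S D' v') := by
    rw [hS]
    exact (((hDw 0).mul_of_support_subset M hχ.continuous hχc hχs').add
      ((hDw 1).mul_of_support_subset M hIc hIcc hIs) (fun n => m1 (hD2 n 0))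
      (fun n => m2 (hD2 n 1)) (m1 (hD2' 0)) (m2 (hD2' 1))).add
      (hvw.mul_of_support_subset M hdc.continuous hdcc hds)
      (fun n => (m1 (hD2 n 0)).add (m2 (hD2 n 1))) (fun n => m3 (hv n))
      ((m1 (hD2' 0)).add (m2 (hD2' 1))) (m3 hv')
  have hlim := tendsto_eLpNorm_cauchyTransform_sub (fun n => hS2 (hv n) (hD2 n))
    (fun n => hSs (D n) (v n)) (hS2 hv' hD2') (hSs D' v') hbound hweak R
  refine tendsto_of_tendsto_of_tendsto_of_le_of_le tendsto_const_nhds hlim (fun _ => zero_le)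
    fun n => ?_
  have r1 := mul_ae_eq_cauchyTransform hΩ hΩR (hv n) (hD2 n) (hD n) hχ hχc hχs
  have r2 := mul_ae_eq_cauchyTransform hΩ hΩR hv' hD2' hD' hχ hχc hχs
  have r3 : eLpNorm (v n - v') 4 (volume.restrict K) = eLpNorm (fun x =>
      cauchyTransform (S (D n) (v n)) x - cauchyTransform (S D' v') x) 4 (volume.restrict K) := by
    refine eLpNorm_congr_ae ?_
    filter_upwards [ae_restrict_of_ae r1, ae_restrict_of_ae r2, ae_restrict_mem hK.measurableSet]
      with x h1 h2 hx
    simp only [hS, ← h1, ← h2, hχ1 x hx, Pi.sub_apply, one_mul]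
  simp only
  rw [r3]
  exact eLpNorm_mono_measure _ (Measure.restrict_mono (hKΩ.trans hΩR) le_rfl)

/-- By inner regularity a compact subset misses only a part of `Ω` of measure below `δ / 2`, so
local convergence is enough. Convergence in measure suffices for Fatou's lemma, after extraction of
an almost everywhere convergent subsequence. -/
theorem tendstoInMeasure_restrict {Ω : Set Plane} (hΩ : IsOpen Ω) (hfin : volume Ω ≠ ⊤)
    {v : ℕ → Plane → ℂ} {v' : Plane → ℂ} (hv : ∀ n, AEStronglyMeasurable (v n) (volume.restrict Ω))
    (hv' : AEStronglyMeasurable v' (volume.restrict Ω))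
    (h : ∀ K ⊆ Ω, IsCompact K →
      Tendsto (fun n => eLpNorm (v n - v') 4 (volume.restrict K)) atTop (𝓝 0)) :
    TendstoInMeasure (volume.restrict Ω) v atTop v' := by
  intro ε hε
  rw [ENNReal.tendsto_atTop_zero]
  intro δ hδ
  obtain ⟨K, hKΩ, hK, hKδ⟩ := hΩ.measurableSet.exists_isCompact_sdiff_lt hfin
    (ENNReal.half_pos hδ.ne').ne'
  have hmono := Measure.restrict_mono hKΩ (le_refl (volume : Measure Plane))
  have hK4 := tendstoInMeasure_of_tendsto_eLpNorm (p := 4) (by norm_num)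
    (fun n => (hv n).mono_measure hmono) (hv'.mono_measure hmono) (h K hKΩ hK) ε hε
  rw [ENNReal.tendsto_atTop_zero] at hK4
  obtain ⟨N, hN⟩ := hK4 (δ / 2) (ENNReal.half_pos hδ.ne')
  refine ⟨N, fun n hn => ?_⟩
  have e : volume.restrict Ω = volume.restrict K + volume.restrict (Ω \ K) := by
    rw [← Measure.restrict_union disjoint_sdiff_right (hΩ.measurableSet.diff hK.measurableSet),
      union_sdiff_cancel hKΩ]
  rw [e, Measure.add_apply, ← ENNReal.add_halves δ]
  refine add_le_add (hN n hn) ?_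
  refine (measure_mono (subset_univ _)).trans ?_
  rw [Measure.restrict_apply_univ]
  exact hKδ.le

/-! ### Limits of weak derivatives and of products -/

theorem hasWeakPartial_of_tendsto {Ω : Set Plane} {j : Fin 2} {v d : ℕ → Plane → ℂ}
    {v' d' : Plane → ℂ} (h : ∀ n, HasWeakPartial Ω j (v n) (d n)) (hv : LocallyIntegrableOn v' Ω)
    (hd : LocallyIntegrableOn d' Ω)
    (hvt : ∀ φ : Plane → ℂ, Continuous φ → HasCompactSupport φ →
      Tendsto (fun n => ∫ x in Ω, φ x * v n x) atTop (𝓝 (∫ x in Ω, φ x * v' x)))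
    (hdt : ∀ φ : Plane → ℂ, Continuous φ → HasCompactSupport φ →
      Tendsto (fun n => ∫ x in Ω, φ x * d n x) atTop (𝓝 (∫ x in Ω, φ x * d' x))) :
    HasWeakPartial Ω j v' d' := by
  refine ⟨hv, hd, fun φ hφ hc hs => ?_⟩
  have t1 := hvt (fun x => (partialDeriv j φ x : ℂ))
    (Complex.continuous_ofReal.comp (contDiff_pd hφ j).continuous)
    ((hasCompactSupport_pd hc j).comp_left Complex.ofReal_zero)
  have t2 := hdt (fun x => (φ x : ℂ)) (Complex.continuous_ofReal.comp hφ.continuous)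
    (hc.comp_left Complex.ofReal_zero)
  have e := fun n => (h n).integral_eq φ hφ hc hs
  simp only [Complex.real_smul] at e ⊢
  simp only [e] at t1
  exact tendsto_nhds_unique t1 t2.neg

theorem memLp_of_continuous_of_hasCompactSupport {φ : Plane → ℂ} (hφ : Continuous φ)
    (hc : HasCompactSupport φ) (μ : Measure Plane) [IsFiniteMeasureOnCompacts μ] : MemLp φ 2 μ :=
  hφ.memLp_of_hasCompactSupport hc

theorem locallyIntegrableOn_of_memLp {Ω : Set Plane} (hfin : volume Ω ≠ ⊤) {f : Plane → ℂ} {p : ℝ≥0∞}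
    (hp : 1 ≤ p) (hf : MemLp f p (volume.restrict Ω)) : LocallyIntegrableOn f Ω := by
  have : IsFiniteMeasure (volume.restrict Ω) :=
    ⟨by rw [Measure.restrict_apply_univ]; exact hfin.lt_top⟩
  exact IntegrableOn.locallyIntegrableOn (hf.integrable hp)

/-- Weak-strong convergence of products. -/
theorem WeakTendsto.integral_mul_mul {μ : Measure Plane} {v β : ℕ → Plane → ℂ} {v' β' : Plane → ℂ}
    (h : WeakTendsto μ v v') (hv : ∀ n, MemLp (v n) 2 μ) {C : ℝ≥0} (hC : ∀ n, eLpNorm (v n) 2 μ ≤ C)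
    (hβ : ∀ n, MemLp (β n) 2 μ) (hβ' : MemLp β' 2 μ)
    (hlim : Tendsto (fun n => eLpNorm (fun x => β n x - β' x) 2 μ) atTop (𝓝 0)) {φ : Plane → ℂ}
    (hφ : Continuous φ) (hφc : HasCompactSupport φ) :
    Tendsto (fun n => ∫ x, φ x * (β n x * v n x) ∂μ) atTop (𝓝 (∫ x, φ x * (β' x * v' x) ∂μ)) := by
  obtain ⟨M, hM⟩ := hφc.exists_bound_of_continuous hφ
  have hφb : ∀ {f : Plane → ℂ}, MemLp f 2 μ → MemLp (fun x => φ x * f x) 2 μ := fun hf =>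
    MemLp.of_le_mul (c := M) hf (hφ.aestronglyMeasurable.mul hf.1) (.of_forall fun x => by
      rw [norm_mul]
      exact mul_le_mul_of_nonneg_right (hM x) (norm_nonneg _))
  have t1 := h _ (hφb hβ')
  -- Write `β n · v n = (β n - β') v n + β' v n`. The first product tends to zero by Cauchy–Schwarz
  -- and the bound on `v n`; the second is weak convergence tested with `φ β'`.
  have t2 : Tendsto (fun n => ∫ x, φ x * (β n x - β' x) * v n x ∂μ) atTop (𝓝 0) := by
    rw [tendsto_zero_iff_enorm_tendsto_zero]
    have hz : Tendsto (fun n => ENNReal.ofReal M * eLpNorm (fun x => β n x - β' x) 2 μ * C) atTop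
        (𝓝 0) := by
      have := ENNReal.Tendsto.mul_const (ENNReal.Tendsto.const_mul hlim
        (Or.inr (ENNReal.ofReal_ne_top (r := M)))) (Or.inr (ENNReal.coe_ne_top (r := C)))
      simpa using this
    refine tendsto_of_tendsto_of_tendsto_of_le_of_le tendsto_const_nhds hz (fun _ => zero_le)
      fun n => ?_
    have hd := hφb ((hβ n).sub hβ')
    refine (enorm_integral_le_lintegral_enorm _).trans ?_
    rw [← eLpNorm_one_eq_lintegral_enorm]
    refine (eLpNorm_smul_le_mul_eLpNorm (p := 2) (q := 2) (hv n).1 hd.1).trans ?_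
    refine mul_le_mul' ?_ (hC n)
    exact eLpNorm_le_mul_eLpNorm_of_ae_le_mul (.of_forall fun x => by
      rw [norm_mul]
      exact mul_le_mul_of_nonneg_right (hM x) (norm_nonneg _)) 2
  have e : ∀ n, ∫ x, φ x * (β n x * v n x) ∂μ =
      (∫ x, φ x * (β n x - β' x) * v n x ∂μ) + ∫ x, φ x * β' x * v n x ∂μ := by
    intro n
    have i1 : Integrable (fun x => φ x * (β n x - β' x) * v n x) μ :=
      integrable_mul_of_memLp_two (hφb ((hβ n).sub hβ')) (hv n)
    have i2 : Integrable (fun x => φ x * β' x * v n x) μ :=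
      integrable_mul_of_memLp_two (hφb hβ') (hv n)
    rw [← integral_add i1 i2]
    congr 1; ext x
    ring
  have e' : ∫ x, φ x * (β' x * v' x) ∂μ = 0 + ∫ x, φ x * β' x * v' x ∂μ := by
    rw [zero_add]
    congr 1; ext x
    ring
  simp only [e, e']
  exact t2.add t1

/-! ### A priori bounds, lower semicontinuity and the limit configuration -/

theorem le_liminf_add (u v : ℕ → ℝ≥0∞) :
    liminf u atTop + liminf v atTop ≤ liminf (fun n => u n + v n) atTop := by
  simp only [liminf_eq_iSup_iInf_of_nat]
  rw [ENNReal.iSup_add_iSup_of_monotone]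
  · refine iSup_mono fun n => le_iInf₂ fun i hi => ?_
    exact add_le_add (iInf₂_le i hi) (iInf₂_le i hi)
  all_goals
    intro m n hmn
    exact le_iInf₂ fun i hi => iInf₂_le i (hmn.trans hi)

theorem ofReal_norm_sq (z : ℂ) : ENNReal.ofReal (‖z‖ ^ 2) = ‖z‖ₑ ^ 2 := by
  rw [ENNReal.ofReal_pow (norm_nonneg _), ofReal_norm]

theorem reducedEnergy_eq {Ω : Set Plane} (ε : ℝ) {v H : Plane → ℂ} {w : Fin 2 → Plane → ℂ}
    (hw : ∀ j, AEStronglyMeasurable (w j) (volume.restrict Ω)) :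
    reducedEnergy Ω ε v w H = 2⁻¹ * ((∫⁻ x in Ω, ‖w 0 x‖ₑ ^ 2) + (∫⁻ x in Ω, ‖w 1 x‖ₑ ^ 2) +
      (∫⁻ x in Ω, ENNReal.ofReal (1 / (2 * ε ^ 2) * (1 - ‖v x‖ ^ 2) ^ 2)) +
      ∫⁻ x, ENNReal.ofReal ((H x).re ^ 2)) := by
  have hw' : ∀ j, AEMeasurable (fun x => ‖w j x‖ₑ ^ 2) (volume.restrict Ω) := fun j =>
    (hw j).enorm.pow_const 2
  rw [reducedEnergy, ← mul_add, ← lintegral_add_left' (hw' 0),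
    ← lintegral_add_left' (f := fun x => ‖w 0 x‖ₑ ^ 2 + ‖w 1 x‖ₑ ^ 2) ((hw' 0).add (hw' 1))]
  congr 3
  ext x
  rw [ENNReal.ofReal_add (Finset.sum_nonneg fun j _ => by positivity) (by positivity),
    Fin.sum_univ_two, ENNReal.ofReal_add (by positivity) (by positivity), ofReal_norm_sq,
    ofReal_norm_sq]

theorem eLpNorm_two_le {μ : Measure Plane} {f : Plane → ℂ} {A : ℝ≥0∞}
    (h : ∫⁻ x, ‖f x‖ₑ ^ 2 ∂μ ≤ A) : eLpNorm f 2 μ ≤ A ^ (1 / 2 : ℝ) := by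
  rw [eLpNorm_eq_lintegral_rpow_enorm_toReal (by norm_num) (by norm_num)]
  simp only [ENNReal.toReal_ofNat, ENNReal.rpow_ofNat]
  gcongr

/-- Pointwise `|v|⁴ ≤ 2 + 2 (1 - |v|²)²`, which is `(|v|² - 2)² ≥ 0` rearranged; the second term is
`4ε²` times the potential density. -/
theorem eLpNorm_four_le {Ω : Set Plane} {ε : ℝ} (hε : 0 < ε) {v : Plane → ℂ} {A : ℝ≥0∞}
    (h : ∫⁻ x in Ω, ENNReal.ofReal (1 / (2 * ε ^ 2) * (1 - ‖v x‖ ^ 2) ^ 2) ≤ A) :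
    eLpNorm v 4 (volume.restrict Ω) ≤
      (2 * volume Ω + ENNReal.ofReal (4 * ε ^ 2) * A) ^ (1 / 4 : ℝ) := by
  rw [eLpNorm_eq_lintegral_rpow_enorm_toReal (by norm_num) (by norm_num)]
  simp only [ENNReal.toReal_ofNat, ENNReal.rpow_ofNat]
  gcongr
  have e : ∀ x, ‖v x‖ₑ ^ 4 ≤ 2 + ENNReal.ofReal (4 * ε ^ 2) *
      ENNReal.ofReal (1 / (2 * ε ^ 2) * (1 - ‖v x‖ ^ 2) ^ 2) := by
    intro x
    have h2 : (2 : ℝ≥0∞) = ENNReal.ofReal 2 := by simp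
    rw [← ofReal_norm, ← ENNReal.ofReal_pow (norm_nonneg _), ← ENNReal.ofReal_mul
      (by positivity), h2, ← ENNReal.ofReal_add (by norm_num) (by positivity)]
    apply ENNReal.ofReal_le_ofReal
    have : 4 * ε ^ 2 * (1 / (2 * ε ^ 2) * (1 - ‖v x‖ ^ 2) ^ 2) = 2 * (1 - ‖v x‖ ^ 2) ^ 2 := by
      field_simp
      ring
    rw [this]
    nlinarith [sq_nonneg (‖v x‖ ^ 2 - 2)]
  refine (lintegral_mono e).trans ?_
  rw [lintegral_add_left measurable_const, lintegral_const_mul' _ _ ENNReal.ofReal_ne_top]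
  simp only [lintegral_const, Measure.restrict_apply_univ]
  gcongr

theorem norm_fieldOf_le (β : Plane → ℂ) (x : Plane) (j : Fin 2) : ‖(fieldOf β x j : ℂ)‖ ≤ ‖β x‖ := by
  rw [Complex.norm_real]
  fin_cases j
  · exact Complex.abs_im_le_norm _
  · exact Complex.abs_re_le_norm _

theorem aestronglyMeasurable_fieldOf {μ : Measure Plane} {β : Plane → ℂ}
    (h : AEStronglyMeasurable β μ) (j : Fin 2) :
    AEStronglyMeasurable (fun x => (fieldOf β x j : ℂ)) μ := by
  refine Complex.continuous_ofReal.comp_aestronglyMeasurable ?_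
  fin_cases j
  · exact Complex.continuous_im.comp_aestronglyMeasurable h
  · exact Complex.continuous_re.comp_aestronglyMeasurable h

theorem isFiniteMeasure_restrict {Ω : Set Plane} {R : ℝ} (hΩR : Ω ⊆ Metric.ball 0 R) :
    IsFiniteMeasure (volume.restrict Ω) :=
  ⟨by rw [Measure.restrict_apply_univ]; exact (measure_mono hΩR).trans_lt measure_ball_lt_top⟩

/-- The full weak derivative in terms of the covariant one. -/
def gaugeDeriv (hex : ℝ) (v : Plane → ℂ) (w : Fin 2 → Plane → ℂ) (H : Plane → ℂ) (j : Fin 2)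
    (x : Plane) : ℂ :=
  w j x + Complex.I * (fieldOf (fun x => uniformField hex x + cauchyTransform H x) x j : ℂ) * v x

theorem memLp_four_field {Ω : Set Plane} {R R' : ℝ} (hΩR : Ω ⊆ Metric.ball 0 R) (hex : ℝ)
    {H : Plane → ℂ} (hH : MemLp H 2) (hHs : Function.support H ⊆ Metric.ball 0 R') :
    MemLp (fun x => uniformField hex x + cauchyTransform H x) 4 (volume.restrict Ω) :=
  ((memLp_ball_of_continuous (contDiff_uniformField hex).continuous R 4).add
    (memLp_cauchyTransform hH hHs R)).mono_measure (Measure.restrict_mono hΩR le_rfl)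

theorem memLp_two_fieldOf {Ω : Set Plane} {R R' : ℝ} (hΩR : Ω ⊆ Metric.ball 0 R) (hex : ℝ)
    {H : Plane → ℂ} (hH : MemLp H 2) (hHs : Function.support H ⊆ Metric.ball 0 R') (j : Fin 2) :
    MemLp (fun x => (fieldOf (fun x => uniformField hex x + cauchyTransform H x) x j : ℂ)) 2
      (volume.restrict Ω) := by
  have := isFiniteMeasure_restrict hΩR
  have h := (memLp_four_field hΩR hex hH hHs).mono_exponent (p := 2) (by norm_num)
  exact MemLp.of_le h (aestronglyMeasurable_fieldOf h.1 j) (.of_forall fun x => norm_fieldOf_le _ x j)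

/-- A priori bounds for gauge-fixed configurations of bounded energy. -/
theorem exists_bound {Ω : Set Plane} {R R' : ℝ} (hΩR : Ω ⊆ Metric.ball 0 R) {ε : ℝ} (hε : 0 < ε)
    (hex : ℝ) {E : ℝ≥0∞} (hE : E ≠ ⊤) :
    ∃ C : ℝ≥0, ∀ (v : Plane → ℂ) (w : Fin 2 → Plane → ℂ) (H : Plane → ℂ),
      IsGaugeFixed Ω R' hex v w H → reducedEnergy Ω ε v w H ≤ E →
      eLpNorm H 2 volume ≤ C ∧ eLpNorm v 2 (volume.restrict Ω) ≤ C ∧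
      (∀ j, eLpNorm (w j) 2 (volume.restrict Ω) ≤ C) ∧
      ∀ j, eLpNorm (gaugeDeriv hex v w H j) 2 (volume.restrict Ω) ≤ C := by
  have hfin := isFiniteMeasure_restrict hΩR
  have hvol : volume Ω ≠ ⊤ := by
    have := hfin.measure_univ_lt_top
    rw [Measure.restrict_apply_univ] at this
    exact this.ne
  -- `W` bounds the `L²` norms of each `w j` and of `Re H`, `V` the `L⁴` norm of `v`, `B` the `L⁴`
  -- norm of the field (with `W + 1` for `H`, the `1` being `Im H`), and `V2` the `L²` norm of `v`
  -- by Hölder.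
  obtain ⟨W, hW⟩ : ∃ W : ℝ≥0∞, W = (2 * E) ^ (1 / 2 : ℝ) := ⟨_, rfl⟩
  have h2E : 2 * E ≠ ⊤ := ENNReal.mul_ne_top (by norm_num) hE
  have hWt : W ≠ ⊤ := hW ▸ ENNReal.rpow_ne_top_of_nonneg (by norm_num) h2E
  obtain ⟨V, hV⟩ : ∃ V : ℝ≥0∞, V =
    (2 * volume Ω + ENNReal.ofReal (4 * ε ^ 2) * (2 * E)) ^ (1 / 4 : ℝ) := ⟨_, rfl⟩
  have hVt : V ≠ ⊤ := hV ▸ ENNReal.rpow_ne_top_of_nonneg (by norm_num)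
    (ENNReal.add_ne_top.mpr ⟨ENNReal.mul_ne_top (by norm_num) hvol,
      ENNReal.mul_ne_top ENNReal.ofReal_ne_top h2E⟩)
  obtain ⟨B, hB⟩ : ∃ B : ℝ≥0∞, B = eLpNorm (uniformField hex) 4 (volume.restrict (Metric.ball 0 R)) +
    (∫⁻ x, ‖truncKernel (R' + R) x‖ₑ ^ (4 / 3 : ℝ)) ^ (3 / 4 : ℝ) * (W + 1) := ⟨_, rfl⟩
  have hBt : B ≠ ⊤ := hB ▸ ENNReal.add_ne_top.mpr
    ⟨(memLp_ball_of_continuous (contDiff_uniformField hex).continuous R 4).2.ne,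
      ENNReal.mul_ne_top (lintegral_truncKernel_lt_top _).ne (ENNReal.add_ne_top.mpr ⟨hWt, by simp⟩)⟩
  obtain ⟨V2, hV2⟩ : ∃ V2 : ℝ≥0∞, V2 = V * (volume.restrict Ω) univ ^
    (1 / (2 : ℝ≥0∞).toReal - 1 / (4 : ℝ≥0∞).toReal) := ⟨_, rfl⟩
  have hV2t : V2 ≠ ⊤ := hV2 ▸ ENNReal.mul_ne_top hVt
    (ENNReal.rpow_ne_top_of_nonneg (by norm_num) hfin.measure_univ_lt_top.ne)
  have hCt : (W + 1) + V2 + (W + B * V) ≠ ⊤ := by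
    simp only [ENNReal.add_ne_top]
    exact ⟨⟨⟨hWt, by simp⟩, hV2t⟩, hWt, ENNReal.mul_ne_top hBt hVt⟩
  refine ⟨((W + 1) + V2 + (W + B * V)).toNNReal, fun v w H h hle => ?_⟩
  rw [ENNReal.coe_toNNReal hCt]
  rw [reducedEnergy_eq ε h.aestronglyMeasurable_covDeriv] at hle
  have hle' : (∫⁻ x in Ω, ‖w 0 x‖ₑ ^ 2) + (∫⁻ x in Ω, ‖w 1 x‖ₑ ^ 2) +
      (∫⁻ x in Ω, ENNReal.ofReal (1 / (2 * ε ^ 2) * (1 - ‖v x‖ ^ 2) ^ 2)) +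
      (∫⁻ x, ENNReal.ofReal ((H x).re ^ 2)) ≤ 2 * E := by
    refine le_trans (le_of_eq ?_) (mul_le_mul_right hle 2)
    rw [← mul_assoc, ENNReal.mul_inv_cancel (by norm_num) (by norm_num), one_mul]
  have hw : ∀ j, eLpNorm (w j) 2 (volume.restrict Ω) ≤ W := by
    intro j
    rw [hW]
    apply eLpNorm_two_le
    fin_cases j
    · exact (le_self_add.trans (le_self_add.trans le_self_add)).trans hle'
    · exact (le_add_self.trans (le_self_add.trans le_self_add)).trans hle'
  have hv : eLpNorm v 4 (volume.restrict Ω) ≤ V :=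
    hV ▸ eLpNorm_four_le hε ((le_add_self.trans le_self_add).trans hle')
  have hre : eLpNorm (fun x => ((H x).re : ℂ)) 2 volume ≤ W := by
    rw [hW]
    apply eLpNorm_two_le
    refine le_trans (le_of_eq ?_) (le_add_self.trans hle')
    congr 1; ext x
    rw [← ofReal_norm_sq, Complex.norm_real, Real.norm_eq_abs, sq_abs]
  have hH : eLpNorm H 2 volume ≤ W + 1 := by
    have e : H = (fun x => ((H x).re : ℂ)) + fun x => ((H x).im : ℂ) * Complex.I := by
      ext x
      exact (Complex.re_add_im (H x)).symm
    have m1 : AEStronglyMeasurable (fun x => ((H x).re : ℂ)) volume :=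
      (Complex.continuous_ofReal.comp Complex.continuous_re).comp_aestronglyMeasurable h.memLp.1
    have m2 : AEStronglyMeasurable (fun x => ((H x).im : ℂ) * Complex.I) volume :=
      ((Complex.continuous_ofReal.comp Complex.continuous_im).comp_aestronglyMeasurable
        h.memLp.1).mul aestronglyMeasurable_const
    calc eLpNorm H 2 volume = eLpNorm ((fun x => ((H x).re : ℂ)) +
          fun x => ((H x).im : ℂ) * Complex.I) 2 volume := by rw [← e]
      _ ≤ _ := eLpNorm_add_le m1 m2 (by norm_num)
      _ ≤ W + 1 := by
        refine add_le_add hre (le_trans (eLpNorm_mono fun x => ?_) h.eLpNorm_im_le)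
        simp
  have hβ : eLpNorm (fun x => uniformField hex x + cauchyTransform H x) 4 (volume.restrict Ω) ≤ B := by
    have hm := memLp_ball_of_continuous (contDiff_uniformField hex).continuous R 4
    have hT := memLp_cauchyTransform h.memLp h.support_subset R
    refine (eLpNorm_mono_measure _ (Measure.restrict_mono hΩR le_rfl)).trans ?_
    refine (eLpNorm_add_le hm.1 hT.1 (by norm_num)).trans ?_
    rw [hB]
    refine add_le_add le_rfl ((eLpNorm_cauchyTransform_le h.memLp.1 h.support_subset R).trans ?_)
    gcongr
  have hβm := (memLp_four_field hΩR hex h.memLp h.support_subset).1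
  refine ⟨hH.trans (le_self_add.trans le_self_add), ?_, fun j => (hw j).trans ?_, fun j => ?_⟩
  · refine (eLpNorm_le_eLpNorm_mul_rpow_measure_univ (q := 4) (by norm_num)
      h.aestronglyMeasurable).trans ?_
    refine le_trans ?_ (le_add_self.trans le_self_add)
    rw [hV2]
    gcongr
  · exact le_self_add.trans le_add_self
  · refine le_trans ?_ le_add_self
    have m1 : AEStronglyMeasurable (fun x => Complex.I * (fieldOf (fun x =>
        uniformField hex x + cauchyTransform H x) x j : ℂ)) (volume.restrict Ω) :=
      aestronglyMeasurable_const.mul (aestronglyMeasurable_fieldOf hβm j)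
    refine (eLpNorm_add_le (h.aestronglyMeasurable_covDeriv j) (m1.mul h.aestronglyMeasurable)
      (by norm_num)).trans (add_le_add (hw j) ?_)
    -- Field and `v` are both in `L⁴`, so their product, the difference between full and covariant
    -- derivative, is in `L²`.
    have : ENNReal.HolderTriple 4 4 2 := ⟨by
      rw [← two_mul, show (4 : ℝ≥0∞) = 2 * 2 by norm_num, ENNReal.mul_inv (by simp) (by simp),
        ← mul_assoc, ENNReal.mul_inv_cancel (by norm_num) (by norm_num), one_mul]⟩
    refine (eLpNorm_smul_le_mul_eLpNorm (p := 4) (q := 4) h.aestronglyMeasurable m1).trans ?_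
    refine mul_le_mul' (le_trans (eLpNorm_mono fun x => ?_) hβ) hv
    rw [norm_mul, Complex.norm_I, one_mul]
    exact norm_fieldOf_le _ x j

theorem WeakTendsto.hasWeakPartial {Ω : Set Plane} (hvol : volume Ω ≠ ⊤) {j : Fin 2}
    {v d : ℕ → Plane → ℂ} {v' d' : Plane → ℂ} (hv : WeakTendsto (volume.restrict Ω) v v')
    (hd : WeakTendsto (volume.restrict Ω) d d') (hv' : MemLp v' 2 (volume.restrict Ω))
    (hd' : MemLp d' 2 (volume.restrict Ω)) (h : ∀ n, HasWeakPartial Ω j (v n) (d n)) :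
    HasWeakPartial Ω j v' d' :=
  hasWeakPartial_of_tendsto h (locallyIntegrableOn_of_memLp hvol (by norm_num) hv')
    (locallyIntegrableOn_of_memLp hvol (by norm_num) hd')
    (fun φ hφ hc => hv φ (memLp_of_continuous_of_hasCompactSupport hφ hc _))
    (fun φ hφ hc => hd φ (memLp_of_continuous_of_hasCompactSupport hφ hc _))

/-- The uniform field cancels in the difference, and `L⁴` convergence of the Cauchy transforms on a
ball gives `L²` convergence on the subset `Ω`, of finite measure. -/
theorem tendsto_eLpNorm_fieldOf_sub {Ω : Set Plane} {R R' : ℝ} (hΩR : Ω ⊆ Metric.ball 0 R)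
    (hex : ℝ) {H : ℕ → Plane → ℂ} {H' : Plane → ℂ} (hH : ∀ n, MemLp (H n) 2)
    (hHs : ∀ n, Function.support (H n) ⊆ Metric.ball 0 R') (hH' : MemLp H' 2)
    (hHs' : Function.support H' ⊆ Metric.ball 0 R') {C : ℝ≥0}
    (hC : ∀ n, eLpNorm (H n) 2 volume ≤ C) (hw : WeakTendsto volume H H') (j : Fin 2) :
    Tendsto (fun n => eLpNorm (fun x =>
      Complex.I * (fieldOf (fun x => uniformField hex x + cauchyTransform (H n) x) x j : ℂ) -
      Complex.I * (fieldOf (fun x => uniformField hex x + cauchyTransform H' x) x j : ℂ)) 2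
      (volume.restrict Ω)) atTop (𝓝 0) := by
  have hfin := isFiniteMeasure_restrict hΩR
  have hlim := tendsto_eLpNorm_cauchyTransform_sub hH hHs hH' hHs' hC hw R
  obtain ⟨V, hV⟩ : ∃ V : ℝ≥0∞, V = (volume.restrict Ω) univ ^
    (1 / (2 : ℝ≥0∞).toReal - 1 / (4 : ℝ≥0∞).toReal) := ⟨_, rfl⟩
  have hVt : V ≠ ⊤ := hV ▸
    (ENNReal.rpow_ne_top_of_nonneg (by norm_num) hfin.measure_univ_lt_top.ne)
  have hlim' := ENNReal.Tendsto.mul_const hlim (Or.inr hVt)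
  rw [zero_mul] at hlim'
  refine tendsto_of_tendsto_of_tendsto_of_le_of_le tendsto_const_nhds hlim' (fun _ => zero_le)
    fun n => ?_
  have hm : AEStronglyMeasurable (fun x => cauchyTransform (H n) x - cauchyTransform H' x)
      (volume.restrict Ω) := ((aestronglyMeasurable_cauchyTransform (hH n).1).sub
        (aestronglyMeasurable_cauchyTransform hH'.1)).restrict
  have e1 : eLpNorm (fun x =>
      Complex.I * (fieldOf (fun x => uniformField hex x + cauchyTransform (H n) x) x j : ℂ) -
      Complex.I * (fieldOf (fun x => uniformField hex x + cauchyTransform H' x) x j : ℂ)) 2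
      (volume.restrict Ω) ≤ eLpNorm (fun x => cauchyTransform (H n) x - cauchyTransform H' x) 2
      (volume.restrict Ω) := by
    refine eLpNorm_mono fun x => ?_
    rw [← mul_sub, norm_mul, Complex.norm_I, one_mul]
    have : (fieldOf (fun x => uniformField hex x + cauchyTransform (H n) x) x j : ℂ) -
        (fieldOf (fun x => uniformField hex x + cauchyTransform H' x) x j : ℂ) =
        (fieldOf (fun x => cauchyTransform (H n) x - cauchyTransform H' x) x j : ℂ) := by
      rw [← Complex.ofReal_sub]
      congr 1
      fin_cases j <;> simp
    rw [this]
    exact norm_fieldOf_le _ x j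
  refine e1.trans ((eLpNorm_le_eLpNorm_mul_rpow_measure_univ (q := 4) (by norm_num) hm).trans ?_)
  rw [← hV]
  exact mul_le_mul' (eLpNorm_mono_measure _ (Measure.restrict_mono hΩR le_rfl)) le_rfl

/-- Lower semicontinuity of the energy along weakly convergent gauge-fixed configurations. -/
theorem reducedEnergy_le_of_weakTendsto {Ω : Set Plane} (ε : ℝ) {v H : ℕ → Plane → ℂ}
    {w : ℕ → Fin 2 → Plane → ℂ} {v' H' : Plane → ℂ} {w' : Fin 2 → Plane → ℂ}
    (hv : ∀ n, AEStronglyMeasurable (v n) (volume.restrict Ω))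
    (hw2 : ∀ n j, MemLp (w n j) 2 (volume.restrict Ω)) (hH2 : ∀ n, MemLp (H n) 2)
    (hw2' : ∀ j, MemLp (w' j) 2 (volume.restrict Ω)) (hH2' : MemLp H' 2)
    (hvt : ∀ᵐ x ∂volume.restrict Ω, Tendsto (fun n => v n x) atTop (𝓝 (v' x)))
    (hwt : ∀ j, WeakTendsto (volume.restrict Ω) (fun n => w n j) (w' j))
    (hHt : WeakTendsto volume H H') {m : ℝ≥0∞}
    (hm : Tendsto (fun n => reducedEnergy Ω ε (v n) (w n) (H n)) atTop (𝓝 m)) :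
    reducedEnergy Ω ε v' w' H' ≤ m := by
  -- The potential is not convex in `v`, so weak convergence is not enough; almost everywhere
  -- convergence and Fatou's lemma are used.
  have pot : ∫⁻ x in Ω, ENNReal.ofReal (1 / (2 * ε ^ 2) * (1 - ‖v' x‖ ^ 2) ^ 2) ≤ liminf (fun n =>
      ∫⁻ x in Ω, ENNReal.ofReal (1 / (2 * ε ^ 2) * (1 - ‖v n x‖ ^ 2) ^ 2)) atTop := by
    have hc : Continuous fun z : ℂ => ENNReal.ofReal (1 / (2 * ε ^ 2) * (1 - ‖z‖ ^ 2) ^ 2) :=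
      ENNReal.continuous_ofReal.comp (by fun_prop)
    refine le_trans (le_of_eq ?_) (lintegral_liminf_le' fun n =>
      (hc.comp_aestronglyMeasurable (hv n)).aemeasurable)
    refine lintegral_congr_ae ?_
    filter_upwards [hvt] with x hx
    exact (((hc.tendsto _).comp hx).liminf_eq).symm
  have h0 := (hwt 0).lintegral_sq_le (fun n => hw2 n 0) (hw2' 0)
  have h1 := (hwt 1).lintegral_sq_le (fun n => hw2 n 1) (hw2' 1)
  have h2 := hHt.lintegral_re_sq_le hH2 hH2'
  rw [reducedEnergy_eq ε fun j => (hw2' j).1, ← hm.liminf_eq]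
  simp only [fun n => reducedEnergy_eq (v := v n) (H := H n) ε fun j => (hw2 n j).1]
  rw [ENNReal.liminf_const_mul_of_ne_top (by norm_num)]
  gcongr
  refine (add_le_add (add_le_add (add_le_add h0 h1) pot) h2).trans ?_
  refine le_trans (add_le_add_left ?_ _) (le_liminf_add _ _)
  refine le_trans (add_le_add_left ?_ _) (le_liminf_add _ _)
  exact le_liminf_add _ _

/-- Energy-bounded gauge-fixed configurations with converging energies have a limit configuration
whose energy is at most the limit. -/
theorem exists_gauge_limit {Ω : Set Plane} (hΩ : IsOpen Ω) {R R' : ℝ}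
    (hΩR : Ω ⊆ Metric.ball 0 R) {ε : ℝ} (hε : 0 < ε) (hex : ℝ) {v H : ℕ → Plane → ℂ}
    {w : ℕ → Fin 2 → Plane → ℂ} (h : ∀ n, IsGaugeFixed Ω R' hex (v n) (w n) (H n)) {E m : ℝ≥0∞}
    (hE : E ≠ ⊤) (hle : ∀ n, reducedEnergy Ω ε (v n) (w n) (H n) ≤ E)
    (hm : Tendsto (fun n => reducedEnergy Ω ε (v n) (w n) (H n)) atTop (𝓝 m)) :
    ∃ (v' H' : Plane → ℂ) (w' : Fin 2 → Plane → ℂ), MemLp H' 2 ∧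
      Function.support H' ⊆ Metric.ball 0 R' ∧ MemH1 Ω v' ∧
      (∀ j, HasWeakPartial Ω j v' (gaugeDeriv hex v' w' H' j)) ∧
      reducedEnergy Ω ε v' w' H' ≤ m := by
  have hfin := isFiniteMeasure_restrict hΩR
  have hvol : volume Ω ≠ ⊤ := ((measure_mono hΩR).trans_lt measure_ball_lt_top).ne
  obtain ⟨C, hC⟩ := exists_bound (R' := R') hΩR hε hex hE
  have hb := fun n => hC _ _ _ (h n) (hle n)
  have hmem : ∀ {f : Plane → ℂ}, AEStronglyMeasurable f (volume.restrict Ω) →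
      eLpNorm f 2 (volume.restrict Ω) ≤ C → MemLp f 2 (volume.restrict Ω) :=
    fun h1 h2 => ⟨h1, h2.trans_lt ENNReal.coe_lt_top⟩
  have hv2 : ∀ n, MemLp (v n) 2 (volume.restrict Ω) := fun n =>
    hmem (h n).aestronglyMeasurable (hb n).2.1
  have hw2 : ∀ n j, MemLp (w n j) 2 (volume.restrict Ω) := fun n j =>
    hmem ((h n).aestronglyMeasurable_covDeriv j) ((hb n).2.2.1 j)
  have hβ2 : ∀ n j, MemLp (fun x => Complex.I *
      (fieldOf (fun x => uniformField hex x + cauchyTransform (H n) x) x j : ℂ)) 2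
      (volume.restrict Ω) := fun n j =>
    (memLp_two_fieldOf hΩR hex (h n).memLp (h n).support_subset j).const_mul Complex.I
  obtain ⟨D, hD⟩ : ∃ D : ℕ → Fin 2 → Plane → ℂ, D = fun n => gaugeDeriv hex (v n) (w n) (H n) :=
    ⟨_, rfl⟩
  have hD2 : ∀ n j, MemLp (D n j) 2 (volume.restrict Ω) := fun n j => by
    rw [hD]
    exact hmem (((h n).aestronglyMeasurable_covDeriv j).add
      ((hβ2 n j).1.mul (h n).aestronglyMeasurable)) ((hb n).2.2.2 j)
  have hDw : ∀ n j, HasWeakPartial Ω j (v n) (D n j) := fun n j => by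
    rw [hD]; exact (h n).hasWeakPartial j
  have hDC : ∀ n j, eLpNorm (D n j) 2 (volume.restrict Ω) ≤ C := fun n j => by
    rw [hD]; exact (hb n).2.2.2 j
  -- One subsequence for five sequences: `none` stands for `v`, `inl j` for the covariant
  -- derivatives, `inr j` for the full derivatives.
  obtain ⟨g, ns, hns, hg⟩ := exists_weakTendsto_family (volume.restrict Ω)
    (u := fun (i : Option (Fin 2 ⊕ Fin 2)) n => i.elim (v n) (Sum.elim (w n) (D n)))
    (C := fun _ => C)
    (by
      rintro (_ | _ | _) n
      exacts [hv2 n, hw2 n _, hD2 n _])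
    (by
      rintro (_ | _ | _) n
      exacts [(hb n).2.1, (hb n).2.2.1 _, hDC n _])
  obtain ⟨H₀, ns', hns', hH₀, hHt₀⟩ := exists_weakTendsto volume (fun n => (h (ns n)).memLp)
    (fun n => (hb (ns n)).1)
  obtain ⟨H', hH'⟩ : ∃ H' : Plane → ℂ, H' = (Metric.ball (0 : Plane) R').indicator H₀ := ⟨_, rfl⟩
  have hH2' : MemLp H' 2 := hH' ▸ hH₀.indicator measurableSet_ball
  have hHs' : Function.support H' ⊆ Metric.ball 0 R' := hH' ▸ support_indicator_subset
  have hHt : WeakTendsto volume (fun n => H (ns (ns' n))) H' :=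
    hH' ▸ hHt₀.indicator measurableSet_ball fun n => (h (ns (ns' n))).support_subset
  have hv' := (hg none).1
  have hw' := fun j => (hg (some (Sum.inl j))).1
  have hD' := fun j => (hg (some (Sum.inr j))).1
  have hvt : WeakTendsto (volume.restrict Ω) (fun n => v (ns (ns' n))) (g none) :=
    (hg none).2.comp hns'
  have hwt : ∀ j, WeakTendsto (volume.restrict Ω) (fun n => w (ns (ns' n)) j)
      (g (some (Sum.inl j))) := fun j => (hg (some (Sum.inl j))).2.comp hns'
  have hDt : ∀ j, WeakTendsto (volume.restrict Ω) (fun n => D (ns (ns' n)) j)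
      (g (some (Sum.inr j))) := fun j => (hg (some (Sum.inr j))).2.comp hns'
  have hDw' : ∀ j, HasWeakPartial Ω j (g none) (g (some (Sum.inr j))) := fun j =>
    hvt.hasWeakPartial hvol (hDt j) hv' (hD' j) fun n => hDw _ j
  have hmeas := tendstoInMeasure_restrict hΩ hvol (fun n => (hv2 (ns (ns' n))).1) hv'.1
    fun K hK hKc => tendsto_eLpNorm_sub_of_weakTendsto hΩ hΩR (fun n => hv2 _)
      (fun n => (hb (ns (ns' n))).2.1) (fun n => hD2 _) (fun n => hDC (ns (ns' n)))
      (fun n => hDw _) hv' hD' hDw' hvt hDt hKc hK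
  obtain ⟨ms, hms, hae⟩ := hmeas.exists_seq_tendsto_ae
  refine ⟨g none, H', fun j => g (some (Sum.inl j)), hH2', hHs',
    ⟨hv', fun j => ⟨_, hDw' j, hD' j⟩⟩, fun j => ?_, ?_⟩
  -- The weak limit of the full derivatives already gives `v' ∈ H¹`. It remains to see that the
  -- limits of `w` and `H` form a derivative of `v'` as well: the field converges strongly in `L²`,
  -- so its product with `v n` passes to the limit under test functions.
  · have hβ' : MemLp (fun x => Complex.I *
        (fieldOf (fun x => uniformField hex x + cauchyTransform H' x) x j : ℂ)) 2
        (volume.restrict Ω) :=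
      (memLp_two_fieldOf hΩR hex hH2' hHs' j).const_mul Complex.I
    have hlim := tendsto_eLpNorm_fieldOf_sub hΩR hex (fun n => (h (ns (ns' n))).memLp)
      (fun n => (h (ns (ns' n))).support_subset) hH2' hHs' (fun n => (hb (ns (ns' n))).1) hHt j
    have loc : LocallyIntegrableOn (gaugeDeriv hex (g none) (fun j => g (some (Sum.inl j))) H' j)
        Ω := locallyIntegrableOn_of_memLp (p := 1) hvol le_rfl
      (((hw' j).mono_exponent (by norm_num)).add
        (memLp_one_iff_integrable.mpr (integrable_mul_of_memLp_two hβ' hv')))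
    refine hasWeakPartial_of_tendsto (fun n => hDw (ns (ns' n)) j)
      (locallyIntegrableOn_of_memLp hvol (by norm_num) hv') loc
      (fun φ hφ hc => hvt φ (memLp_of_continuous_of_hasCompactSupport hφ hc _)) fun φ hφ hc => ?_
    have hφ2 := memLp_of_continuous_of_hasCompactSupport hφ hc (volume.restrict Ω)
    have t1 := hvt.integral_mul_mul (fun n => hv2 _) (fun n => (hb (ns (ns' n))).2.1)
      (fun n => hβ2 _ j) hβ' hlim hφ hc
    have t2 := hwt j φ hφ2
    obtain ⟨M, hM⟩ := hc.exists_bound_of_continuous hφ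
    have split : ∀ {u β f : Plane → ℂ}, MemLp u 2 (volume.restrict Ω) →
        MemLp β 2 (volume.restrict Ω) → MemLp f 2 (volume.restrict Ω) →
        ∫ x in Ω, φ x * (u x + β x * f x) =
          (∫ x in Ω, φ x * u x) + ∫ x in Ω, φ x * (β x * f x) := by
      intro u β f hu hβ hf
      have i2 : Integrable (fun x => φ x * (β x * f x)) (volume.restrict Ω) :=
        (integrable_mul_of_memLp_two hβ hf).bdd_mul hφ.aestronglyMeasurable (ae_of_all _ hM)
      rw [← integral_add (integrable_mul_of_memLp_two hφ2 hu) i2]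
      congr 1; ext x
      ring
    have e' : ∫ x in Ω, φ x * gaugeDeriv hex (g none) (fun j => g (some (Sum.inl j))) H' j x = _ :=
      split (hw' j) hβ' hv'
    rw [e']
    refine (t2.add t1).congr fun n => ?_
    rw [hD]
    exact (split (hw2 _ j) (hβ2 _ j) (hv2 _)).symm
  · exact reducedEnergy_le_of_weakTendsto ε (fun n => (hv2 (ns (ns' (ms n)))).1)
      (fun n => hw2 (ns (ns' (ms n)))) (fun n => (h (ns (ns' (ms n)))).memLp) hw' hH2' hae
      (fun j => (hwt j).comp hms) (hHt.comp hms)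
      (hm.comp ((hns.comp (hns'.comp hms)).tendsto_atTop))

/-! ### The full-plane minimiser and comparison of the two energies -/

/-- The weak derivatives of a Cauchy transform `T H` satisfy `dbar (T H) = H`. -/
theorem ae_dbar_cauchyTransform_eq {H g₀ g₁ : Plane → ℂ} {R : ℝ} (hH : MemLp H 2)
    (hHs : Function.support H ⊆ Metric.ball 0 R)
    (h0 : HasWeakPartial univ 0 (cauchyTransform H) g₀)
    (h1 : HasWeakPartial univ 1 (cauchyTransform H) g₁) :
    ∀ᵐ x, g₀ x + Complex.I * g₁ x = H x := by
  have hHl : LocallyIntegrableOn H univ :=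
    (integrable_of_memLp_two hH hHs).locallyIntegrable.locallyIntegrableOn _
  have hI : LocallyIntegrableOn (fun x => Complex.I * g₁ x) univ :=
    LocallyIntegrableOn.clm_comp' h1.2 (ContinuousLinearMap.mul ℝ ℂ Complex.I)
  have hs : LocallyIntegrableOn (fun x => g₀ x + Complex.I * g₁ x) univ := h0.2.add hI
  have key : ∀ᵐ x, x ∈ univ → (fun x => g₀ x + Complex.I * g₁ x - H x) x = 0 := by
    refine isOpen_univ.ae_eq_zero_of_integral_contDiff_smul_eq_zero (hs.sub hHl) ?_
    intro φ hφ hc _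
    have hΦ : ContDiff ℝ ∞ fun x => (φ x : ℂ) := Complex.ofRealCLM.contDiff.comp hφ
    have hΦc : HasCompactSupport fun x => (φ x : ℂ) := hc.comp_left Complex.ofReal_zero
    have e1 := h0.integral_mul_dbar h1 hΦ hΦc (subset_univ _)
    rw [setIntegral_univ, setIntegral_univ, integral_cauchyTransform_mul_dbar hH hHs hΦ hΦc] at e1
    have i1 := integrableOn_mul_test hs hΦ.continuous hΦc (subset_univ _)
    have i2 := integrableOn_mul_test hHl hΦ.continuous hΦc (subset_univ _)
    rw [integrableOn_univ] at i1 i2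
    have e2 : ∫ x, φ x • (g₀ x + Complex.I * g₁ x - H x) =
        (∫ x, (φ x : ℂ) * (g₀ x + Complex.I * g₁ x)) - ∫ x, (φ x : ℂ) * H x := by
      rw [← integral_sub i1 i2]
      congr 1; ext x
      simp only [Complex.real_smul]
      ring
    rw [e2, sub_eq_zero]
    simp only [mul_comm (_ : ℂ) (φ _ : ℂ)] at e1
    exact (neg_injective e1).symm
  filter_upwards [key] with x hx
  exact sub_eq_zero.mp (hx (mem_univ x))

theorem memLp_two_of_isCompact {f : Plane → ℂ} {p : ℝ≥0∞} (hp : 2 ≤ p)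
    (hf : ∀ R, MemLp f p (volume.restrict (Metric.ball 0 R))) {K : Set Plane} (hK : IsCompact K) :
    MemLp f 2 (volume.restrict K) := by
  obtain ⟨R, hR⟩ := hK.isBounded.subset_ball (0 : Plane)
  have := isFiniteMeasure_restrict hR
  exact ((hf R).mono_measure (Measure.restrict_mono hR le_rfl)).mono_exponent hp

/-- The full-plane configuration given by a limit of gauge-fixed configurations. -/
theorem mem_spaceX_and_energyGL_eq {Ω : Set Plane} (hΩ : IsOpen Ω) {R : ℝ} (hR : 0 < R) (ε hex : ℝ)
    {v H : Plane → ℂ} {w : Fin 2 → Plane → ℂ} (hv : MemH1 Ω v) (hH : MemLp H 2)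
    (hHs : Function.support H ⊆ Metric.ball 0 R)
    (hw : ∀ j, HasWeakPartial Ω j v (gaugeDeriv hex v w H j)) :
    (v, fieldOf fun x => uniformField hex x + cauchyTransform H x) ∈ spaceX Ω hex ∧
      energyGL Ω ε hex (v, fieldOf fun x => uniformField hex x + cauchyTransform H x) =
        reducedEnergy Ω ε v w H := by
  obtain ⟨β, hβ⟩ : ∃ β : Plane → ℂ, β = fun x => uniformField hex x + cauchyTransform H x := ⟨_, rfl⟩
  choose t ht ht2 using exists_hasWeakPartial_cauchyTransform hR hH hHs
  have hB : ∀ j, HasWeakPartial univ j β (fun x => pd j (uniformField hex) x + t j x) := fun j =>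
    hβ ▸ (hasWeakPartial_of_contDiff ((contDiff_uniformField hex).of_le (by simp)) univ j).add (ht j)
  have hdbar := ae_dbar_cauchyTransform_eq hH hHs (ht 0) (ht 1)
  have hβK : ∀ K : Set Plane, IsCompact K → MemLp β 2 (volume.restrict K) := fun K hK =>
    memLp_two_of_isCompact (p := 4) (by norm_num) (fun R' => hβ ▸
      (memLp_ball_of_continuous (contDiff_uniformField hex).continuous R' 4).add
        (memLp_cauchyTransform hH hHs R')) hK
  have hBK : ∀ j, ∀ K : Set Plane, IsCompact K →
      MemLp (fun x => pd j (uniformField hex) x + t j x) 2 (volume.restrict K) := fun j K hK =>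
    memLp_two_of_isCompact (p := 2) le_rfl (fun R' =>
      (memLp_ball_of_continuous (contDiff_pd (contDiff_uniformField hex) j).continuous R' 2).add
        ((ht2 j).restrict _)) hK
  have him : ∀ j, HasWeakPartial univ j (fun x => fieldOf β x 0)
      (fun x => (pd j (uniformField hex) x + t j x).im) := fun j => (hB j).clm_comp Complex.imCLM
  have hre : ∀ j, HasWeakPartial univ j (fun x => fieldOf β x 1)
      (fun x => (pd j (uniformField hex) x + t j x).re) := fun j => (hB j).clm_comp Complex.reCLM
  -- The curl is the real part of `dbar β`: the uniform field contributes `hex` and the Cauchy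
  -- transform contributes `Re H`.
  have hcurl : ∀ᵐ x, weakCurl univ (fieldOf β) x - hex = (H x).re := by
    filter_upwards [(hre 0).weakPartial_ae_eq isOpen_univ, (him 1).weakPartial_ae_eq isOpen_univ,
      hdbar] with x h1 h2 h3
    have h4 := congrArg Complex.re (dbar_uniformField hex x)
    have h5 := congrArg Complex.re h3
    rw [weakCurl, h1 (mem_univ x), h2 (mem_univ x)]
    simp only [dbar, Complex.add_re, Complex.mul_re, Complex.I_re, Complex.I_im, Complex.ofReal_re,
      Complex.add_im] at h4 h5 ⊢
    linear_combination h4 + h5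
  rw [← hβ]
  refine ⟨⟨hv, ?_, ?_⟩, ?_⟩
  · intro k
    fin_cases k
    · exact ⟨fun K hK => Complex.imCLM.comp_memLp' (hβK K hK), fun j =>
        ⟨_, him j, fun K hK => Complex.imCLM.comp_memLp' (hBK j K hK)⟩⟩
    · exact ⟨fun K hK => Complex.reCLM.comp_memLp' (hβK K hK), fun j =>
        ⟨_, hre j, fun K hK => Complex.reCLM.comp_memLp' (hBK j K hK)⟩⟩
  · have h : MemLp (fun x => (H x).re) 2 volume := Complex.reCLM.comp_memLp' hH
    refine h.ae_eq ?_
    filter_upwards [hcurl] with x hx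
    exact hx.symm
  · rw [energyGL, reducedEnergy, matterEnergy, magneticEnergy]
    congr 2
    · refine setLIntegral_congr_fun_ae hΩ.measurableSet ?_
      filter_upwards [(hw 0).weakPartial_ae_eq hΩ, (hw 1).weakPartial_ae_eq hΩ] with x h0 h1 hx
      simp only [covGradSq, Fin.sum_univ_two, h0 hx, h1 hx, gaugeDeriv, ← hβ, add_sub_cancel_right]
    · rw [setLIntegral_univ]
      refine lintegral_congr_ae ?_
      filter_upwards [hcurl] with x hx
      simp only [hx]

theorem MemH1Loc.memH1 {Ω : Set Plane} {f : Plane → ℝ} (h : MemH1Loc f)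
    (hb : Bornology.IsBounded Ω) : MemH1 Ω f := by
  have hmono := Measure.restrict_mono (subset_closure (s := Ω)) (le_refl (volume : Measure Plane))
  have hc := hb.isCompact_closure
  refine ⟨(h.1 _ hc).mono_measure hmono, fun j => ?_⟩
  obtain ⟨g, hg, hg2⟩ := h.2 j
  exact ⟨g, hg.mono (subset_univ Ω), (hg2 _ hc).mono_measure hmono⟩

theorem spaceX_subset {Ω : Set Plane} (hb : Bornology.IsBounded Ω) (hex : ℝ) :
    spaceX Ω hex ⊆ spaceXΩ Ω := fun _ hp => ⟨hp.1, fun j => (hp.2.1 j).memH1 hb⟩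

/-- A weak derivative on the plane is one on `Ω`, so by uniqueness the two curls agree almost
everywhere in `Ω`; enlarging the domain of a non-negative integrand does the rest. -/
theorem energyF_le_energyGL {Ω : Set Plane} (hΩ : IsOpen Ω) (ε hex : ℝ)
    {p : (Plane → ℂ) × (Plane → Plane)} (hp : p ∈ spaceX Ω hex) :
    energyF Ω ε hex p ≤ energyGL Ω ε hex p := by
  rw [energyF, energyGL, magneticEnergy, magneticEnergy]
  refine add_le_add le_rfl (mul_le_mul' le_rfl ?_)
  refine le_trans (le_of_eq ?_) (lintegral_mono_set (subset_univ Ω))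
  obtain ⟨g, hg, -⟩ := (hp.2.1 1).2 0
  obtain ⟨g', hg', -⟩ := (hp.2.1 0).2 1
  refine setLIntegral_congr_fun_ae hΩ.measurableSet ?_
  filter_upwards [hg.weakPartial_ae_eq isOpen_univ, hg'.weakPartial_ae_eq isOpen_univ,
    (hg.mono (subset_univ Ω)).weakPartial_ae_eq hΩ,
    (hg'.mono (subset_univ Ω)).weakPartial_ae_eq hΩ] with x h1 h2 h3 h4 hx
  simp only [weakCurl, h1 (mem_univ x), h2 (mem_univ x), h3 hx, h4 hx]

theorem hasWeakPartial_zero {F : Type*} [NormedAddCommGroup F] [NormedSpace ℝ F] (Ω : Set Plane)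
    (j : Fin 2) : HasWeakPartial Ω j (fun _ => (0 : F)) (fun _ => (0 : F)) :=
  ⟨locallyIntegrableOn_zero, locallyIntegrableOn_zero, fun φ _ _ _ => by simp⟩

/-- The zero pair has constant energy density on `Ω`, which has finite measure. -/
theorem exists_energyF_lt_top {Ω : Set Plane} (hΩ : IsOpen Ω) (hb : Bornology.IsBounded Ω)
    (ε hex : ℝ) : ∃ p ∈ spaceXΩ Ω, energyF Ω ε hex p < ⊤ := by
  have hvol : volume Ω ≠ ⊤ := hb.measure_lt_top.ne
  refine ⟨(fun _ => 0, fun _ => 0), ⟨⟨MemLp.zero', fun j => ⟨_, hasWeakPartial_zero Ω j,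
    MemLp.zero'⟩⟩, fun k => ⟨MemLp.zero', fun j => ⟨_, hasWeakPartial_zero Ω j, MemLp.zero'⟩⟩⟩, ?_⟩
  have e := energyF_eq (v := fun _ => 0) (b := fun _ => 0) (v' := fun _ => 0)
    (D := fun _ _ => 0) (g := fun _ _ _ => 0) (w := fun _ _ => 0)
    (H := fun x => ((Ω.indicator (fun _ => 0 - 0 - hex) x : ℝ) : ℂ)) hΩ ε hex
    (fun j => hasWeakPartial_zero Ω j) (fun k j => hasWeakPartial_zero Ω j)
    (fun _ _ => rfl) (fun j x _ => by simp) (fun x => by simp)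
  rw [e, reducedEnergy]
  refine ENNReal.add_lt_top.mpr ⟨ENNReal.mul_lt_top (by simp) ?_, ENNReal.mul_lt_top (by simp) ?_⟩
  · rw [setLIntegral_const]
    exact ENNReal.mul_lt_top ENNReal.ofReal_lt_top hvol.lt_top
  · have e' : ∀ x, ENNReal.ofReal ((((Ω.indicator (fun _ => 0 - 0 - hex) x : ℝ) : ℂ)).re ^ 2) =
        Ω.indicator (fun _ => ENNReal.ofReal (hex ^ 2)) x := by
      intro x
      by_cases hx : x ∈ Ω <;> simp [hx]
    simp only [e']
    rw [lintegral_indicator hΩ.measurableSet, setLIntegral_const]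
    exact ENNReal.mul_lt_top ENNReal.ofReal_lt_top hvol.lt_top

/-- A full-plane configuration whose energy is at most the infimum of `energyF`. -/
theorem exists_energyGL_le {Ω : Set Plane} (hΩ : IsBddSimplyConnectedLipschitzDomain Ω) {ε : ℝ}
    (hε : 0 < ε) (hex : ℝ) : ∃ p ∈ spaceX Ω hex, energyGL Ω ε hex p ≠ ⊤ ∧
      ∀ q ∈ spaceXΩ Ω, energyGL Ω ε hex p ≤ energyF Ω ε hex q := by
  obtain ⟨R₀, hR₀⟩ := hΩ.isBounded.subset_ball (0 : Plane)
  obtain ⟨R, hR, hΩR⟩ : ∃ R > 0, Ω ⊆ Metric.ball 0 R :=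
    ⟨max R₀ 1, by positivity, hR₀.trans (Metric.ball_subset_ball (le_max_left _ _))⟩
  obtain ⟨q₀, hq₀, hq₀t⟩ := exists_energyF_lt_top hΩ.isOpen hΩ.isBounded ε hex
  obtain ⟨u, hu, hut, huS⟩ := exists_seq_tendsto_sInf
    (S := energyF Ω ε hex '' spaceXΩ Ω) ⟨_, mem_image_of_mem _ hq₀⟩ (OrderBot.bddBelow _)
  obtain ⟨m, hm⟩ : ∃ m, m = sInf (energyF Ω ε hex '' spaceXΩ Ω) := ⟨_, rfl⟩
  rw [← hm] at hut
  have hmt : m < ⊤ := hm ▸ (sInf_le (mem_image_of_mem _ hq₀)).trans_lt hq₀t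
  -- Dropping finitely many terms of the minimising sequence gives the uniform energy bound `m + 1`
  -- needed for compactness.
  obtain ⟨N, hN⟩ := (hut.eventually (gt_mem_nhds
    (ENNReal.lt_add_right hmt.ne one_ne_zero))).exists_forall_of_atTop
  choose q hq hqu using huS
  choose v H w hg he using fun n => exists_gauge hΩ.isOpen hΩ.isSimplyConnected hR hΩR ε hex (hq n)
  have hmu : Tendsto (fun n => reducedEnergy Ω ε (v (n + N)) (w (n + N)) (H (n + N))) atTop
      (𝓝 m) := by
    simp only [he, hqu]
    exact hut.comp (tendsto_add_atTop_nat N)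
  obtain ⟨v', H', w', hH', hHs', hv', hw', hle⟩ := exists_gauge_limit hΩ.isOpen hΩR hε hex
    (fun n => hg (n + N)) (E := m + 1) (ENNReal.add_ne_top.mpr ⟨hmt.ne, by simp⟩)
    (fun n => by rw [he, hqu]; exact (hN _ (Nat.le_add_left N n)).le) hmu
  obtain ⟨h1, h2⟩ := mem_spaceX_and_energyGL_eq hΩ.isOpen (by linarith) ε hex hv' hH' hHs' hw'
  rw [← h2] at hle
  exact ⟨_, h1, (hle.trans_lt hmt).ne, fun q hq =>
    hle.trans (hm ▸ sInf_le (mem_image_of_mem _ hq))⟩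

end GL2D

/-- Both energies attain their minimum, at a finite value, and the two minima coincide. -/
theorem proposition2p1 (Ω : Set GL2D.Plane) (hΩ : GL2D.IsBddSimplyConnectedLipschitzDomain Ω)
    (ε : ℝ) (hε : 0 < ε) (hex : ℝ) :
    ∃ m : ℝ≥0,
      IsLeast (GL2D.energyGL Ω ε hex '' GL2D.spaceX Ω hex) (m : ℝ≥0∞) ∧
      IsLeast (GL2D.energyF Ω ε hex '' GL2D.spaceXΩ Ω) (m : ℝ≥0∞) := by
  obtain ⟨p, hp, hpt, hmin⟩ := GL2D.exists_energyGL_le hΩ hε hex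
  have hX := GL2D.spaceX_subset hΩ.isBounded hex
  have hF : ∀ {q}, q ∈ GL2D.spaceX Ω hex → _ := fun hq =>
    GL2D.energyF_le_energyGL hΩ.isOpen ε hex hq
  refine ⟨(GL2D.energyGL Ω ε hex p).toNNReal, ?_⟩
  rw [ENNReal.coe_toNNReal hpt]
  -- For every `q ∈ X_Ω`, `F(p) ≤ GL(p) ≤ F(q)`; taking `q = p` gives equality of the two values, so
  -- `p` realises both minima.
  refine ⟨⟨mem_image_of_mem _ hp, ?_⟩,
    ⟨⟨p, hX hp, le_antisymm (hF hp) (hmin p (hX hp))⟩, ?_⟩⟩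
  · rintro _ ⟨q, hq, rfl⟩
    exact (hmin q (hX hq)).trans (hF hq)
  · rintro _ ⟨q, hq, rfl⟩
    exact hmin q hq

end
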